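/- Let $G=PSL_2(\mathbb R)$, and in $\mathfrak g=\mathfrak{sl}_2(\mathbb R)$ put $\Xi=\frac12\begin{pmatrix}0&1\\-1&0\end{pmatrix}$, $H=\frac12\begin{pmatrix}1&0\\0&-1\end{pmatrix}$, $B=\frac12\begin{pmatrix}0&1\\1&0\end{pmatrix}$, $\Omega=4\Xi^2-4H^2-4B^2$. Let $\pi$ be a (strongly continuous) irreducible unitary representation of $G$ on a complex Hilbert space $\mathcal H_\pi$, and let $\lambda_\pi$ be the scalar by which $\Omega$ acts on the smooth vectors. We call $\pi$ a principal series representation if $\lambda_\pi=1+s^2$ with $s\in\mathbb R$, a complementary series representation if $\lambda_\pi=1-s^2$ with $s\in(-1,1)\setminus\{0\}$, and a discrete series representation if $\pi$ is not the trivial representation and $\lambda_\pi=1-(2n-1)^2$ with an integer $n\ge1$ (by the classification of the irreducible unitary representations of $G$ these are exactly the usual series). For $x\in\mathbb C$ let $T_\pi(x)=-\Xi^2+xH$ be the closed operator on $\mathcal H_\pi$ with domain $\{u\in\mathcal H_\pi\mid T_\pi(x)u\in\mathcal H_\pi\}$, where $T_\pi(x)u$ is understood in the sense of distributions (as a functional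 on the smooth vectors), and let $\sigma(T_\pi(x))$ be its spectrum. (i) Let $\pi$ be a principal or complementary series representation and $r_\pi=(\lambda_\pi+6)^{-1/2}$. Then there is a holomorphic function $\mu\colon\{x\in\mathbb C:|x|<r_\pi\}\to\mathbb C$ such that for all $x\in\mathbb C$ with $|x|<r_\pi$: $\mu(x)$ is an eigenvalue of $T_\pi(x)$ of (algebraic) multiplicity $1$, $|\mu(x)|\le\frac12$, $$\sigma(T_\pi(x))\cap\{\zeta\in\mathbb C\mid \operatorname{Re}\zeta\le\tfrac12\}=\{\mu(x)\},$$ and $$\Bigl|\mu(x)-\frac{\lambda_\pi}{8}x^2\Bigr|\le\frac{|x|^3}{2r_\pi^2\,(r_\pi-|x|)}.$$ (ii) Let $\pi$ be a discrete series representation. Then every $\zeta\in\sigma(T_\pi(x))$ satisfies $\operatorname{Re}\zeta>\frac12$, for all $x\in\mathbb C$ with $|x|<1/\sqrt{32}$. -/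

import Mathlib

open scoped MatrixGroups ComplexConjugate

noncomputable section

namespace KineticBrownian

/-! ### The group `PSL₂(ℝ)`, its Lie algebra and the exponential map -/

/-- The Lie algebra `𝔰𝔩₂(ℝ)` of real `2 × 2` matrices of trace zero. -/
abbrev sl2 : Type := LieAlgebra.SpecialLinear.sl (Fin 2) ℝ

lemma mem_sl2_iff (X : Matrix (Fin 2) (Fin 2) ℝ) :
    X ∈ LieAlgebra.SpecialLinear.sl (Fin 2) ℝ ↔ X 0 0 + X 1 1 = 0 := by
  rw [← Matrix.trace_fin_two]
  exact LinearMap.mem_ker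

/-- `Ξ = ½ (0 1; -1 0)`, the generator of rotations. -/
def Xi : sl2 := ⟨!![0, 1 / 2; -(1 / 2), 0], (mem_sl2_iff _).2 (by simp)⟩

/-- `H = ½ (1 0; 0 -1)`, the generator of the geodesic flow. -/
def Hg : sl2 := ⟨!![1 / 2, 0; 0, -(1 / 2)], (mem_sl2_iff _).2 (by simp)⟩

/-- `B = ½ (0 1; 1 0)`. -/
def Bg : sl2 := ⟨!![0, 1 / 2; 1 / 2, 0], (mem_sl2_iff _).2 (by simp)⟩

section
open scoped Matrix.Norms.Operator

lemma det_exp_sl2 (X : sl2) : (NormedSpace.exp (X : Matrix (Fin 2) (Fin 2) ℝ)).det = 1 := by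
  obtain ⟨A, hX⟩ := X
  have htr : A 0 0 + A 1 1 = 0 := (mem_sl2_iff A).1 hX
  set M : ℝ → Matrix (Fin 2) (Fin 2) ℝ := fun t => NormedSpace.exp (t • A) with hM
  have hd : ∀ t, HasDerivAt M (A * M t) t := fun t => hasDerivAt_exp_smul_const' A t
  have hij : ∀ (i j : Fin 2) (t : ℝ), HasDerivAt (fun s => M s i j) ((A * M t) i j) t := by
    intro i j t
    exact hasDerivAt_pi.1 (hasDerivAt_pi.1 (hd t) i) j
  have hdet : ∀ t, HasDerivAt (fun s => (M s).det) 0 t := by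
    intro t
    have h := ((hij 0 0 t).mul (hij 1 1 t)).sub ((hij 0 1 t).mul (hij 1 0 t))
    have h0 : (A * M t) 0 0 * M t 1 1 + M t 0 0 * (A * M t) 1 1
        - ((A * M t) 0 1 * M t 1 0 + M t 0 1 * (A * M t) 1 0) = 0 := by
      simp only [Matrix.mul_apply, Fin.sum_univ_two]
      linear_combination (M t 0 0 * M t 1 1 - M t 0 1 * M t 1 0) * htr
    rw [h0] at h
    refine h.congr_of_eventuallyEq (Filter.Eventually.of_forall fun s => ?_)
    simp [Matrix.det_fin_two]
  have hc := is_const_of_deriv_eq_zero (fun t => (hdet t).differentiableAt)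
    (fun t => (hdet t).deriv) 1 0
  simpa [hM] using hc

end

/-- The exponential map `𝔰𝔩₂(ℝ) → PSL₂(ℝ)`: the matrix exponential, modulo the centre `{±1}`. -/
def expG (X : sl2) : PSL(2, ℝ) :=
  QuotientGroup.mk (⟨NormedSpace.exp (X : Matrix (Fin 2) (Fin 2) ℝ), det_exp_sl2 X⟩ : SL(2, ℝ))

/-! ### Unitary representations -/

/-- A (strongly continuous) unitary representation of `PSL₂(ℝ)` on the complex Hilbert space `V`. -/
structure UnitaryRep (V : Type*) [NormedAddCommGroup V] [InnerProductSpace ℂ V] where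
  /-- the homomorphism into the group of unitary operators -/
  toHom : PSL(2, ℝ) →* (V ≃ₗᵢ[ℂ] V)
  /-- strong continuity -/
  continuous_orbit : ∀ u : V, Continuous fun g => toHom g u

namespace UnitaryRep

variable {V : Type*} [NormedAddCommGroup V] [InnerProductSpace ℂ V]

/-- Irreducibility: `V ≠ 0`, and the only closed invariant subspaces are `0` and `V`. -/
def IsIrreducible (π : UnitaryRep V) : Prop :=
  Nontrivial V ∧ ∀ W : Submodule ℂ V, IsClosed (W : Set V) →
    (∀ g, ∀ u ∈ W, π.toHom g u ∈ W) → W = ⊥ ∨ W = ⊤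

/-- `G` acts by the identity. -/
def IsTrivial (π : UnitaryRep V) : Prop := ∀ g u, π.toHom g u = u

/-- The `n` times differentiable vectors: every vector is `0` times differentiable, and `u` is `n+1`
times differentiable if for every `X` in the Lie algebra the derivative of `t ↦ π(exp tX)u` at `0`
exists and is `n` times differentiable. -/
def diffVectors (π : UnitaryRep V) : ℕ → Submodule ℂ V
  | 0 => ⊤
  | n + 1 =>
    { carrier := {u | ∀ X : sl2, ∃ w ∈ diffVectors π n,
        HasDerivAt (fun t : ℝ => π.toHom (expG (t • X)) u) w 0}
      zero_mem' := fun X => ⟨0, Submodule.zero_mem _, by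
        simpa using hasDerivAt_const (0 : ℝ) (0 : V)⟩
      add_mem' := by
        intro a b ha hb X
        obtain ⟨w, hw, h⟩ := ha X
        obtain ⟨w', hw', h'⟩ := hb X
        exact ⟨w + w', Submodule.add_mem _ hw hw', by
          simpa [Pi.add_def] using h.add h'⟩
      smul_mem' := by
        intro c a ha X
        obtain ⟨w, hw, h⟩ := ha X
        exact ⟨c • w, Submodule.smul_mem _ c hw, by
          simpa [Pi.smul_def] using h.const_smul c⟩ }

/-- The space `C^∞(V)` of smooth vectors of `π`. -/
def smooth (π : UnitaryRep V) : Submodule ℂ V := ⨅ n, π.diffVectors n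

lemma hasDerivAt_of_smooth (π : UnitaryRep V) (X : sl2) {u : V} (hu : u ∈ π.smooth) :
    HasDerivAt (fun t : ℝ => π.toHom (expG (t • X)) u)
      (deriv (fun t : ℝ => π.toHom (expG (t • X)) u) 0) 0 := by
  obtain ⟨w, -, h⟩ := (Submodule.mem_iInf _).1 hu 1 X
  exact h.differentiableAt.hasDerivAt

lemma deriv_mem_smooth (π : UnitaryRep V) (X : sl2) {u : V} (hu : u ∈ π.smooth) :
    deriv (fun t : ℝ => π.toHom (expG (t • X)) u) 0 ∈ π.smooth := by
  refine (Submodule.mem_iInf _).2 fun n => ?_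
  obtain ⟨w, hw, h⟩ := (Submodule.mem_iInf _).1 hu (n + 1) X
  rwa [h.deriv]

/-- The derived representation of the Lie algebra on smooth vectors,
`dπ(X) u = d/dt|₀ π(exp tX) u`. -/
def dpi (π : UnitaryRep V) (X : sl2) : Module.End ℂ π.smooth where
  toFun u := ⟨deriv (fun t : ℝ => π.toHom (expG (t • X)) (u : V)) 0, π.deriv_mem_smooth X u.2⟩
  map_add' u v := by
    ext
    simpa [Pi.add_def] using ((π.hasDerivAt_of_smooth X u.2).add (π.hasDerivAt_of_smooth X v.2)).deriv
  map_smul' c u := by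
    ext
    simpa [Pi.smul_def] using ((π.hasDerivAt_of_smooth X u.2).const_smul c).deriv

/-- The Casimir element `Ω = 4Ξ² - 4H² - 4B²` acting on smooth vectors. -/
def casimir (π : UnitaryRep V) : Module.End ℂ π.smooth :=
  (4 : ℂ) • π.dpi Xi ^ 2 - (4 : ℂ) • π.dpi Hg ^ 2 - (4 : ℂ) • π.dpi Bg ^ 2

/-- `Ω` acts as the scalar `lam`; for irreducible `π` this determines the number `λ_π`. -/
def HasCasimirScalar (π : UnitaryRep V) (lam : ℝ) : Prop :=
  π.casimir = (lam : ℂ) • (1 : Module.End ℂ π.smooth)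

/-- `π` is the principal series representation `π_{is}`: it is irreducible with `Ω = 1 + s²`.
(Irreducible unitary representations are classified by the Casimir scalar, up to the choice of sign
in the discrete series and the trivial representation; that all `K`-types `k ∈ ℤ` occur here is a
consequence.) -/
def IsPrincipalSeries (π : UnitaryRep V) (s : ℝ) : Prop :=
  π.IsIrreducible ∧ π.HasCasimirScalar (1 + s ^ 2)

/-- `π` is the complementary series representation `π_s`, `s ∈ (-1,1) \ {0}`: it is irreducible with
`Ω = 1 - s²`. -/
def IsComplementarySeries (π : UnitaryRep V) (s : ℝ) : Prop :=
  s ∈ Set.Ioo (-1 : ℝ) 1 ∧ s ≠ 0 ∧ π.IsIrreducible ∧ π.HasCasimirScalar (1 - s ^ 2)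

/-- `π` is one of the discrete series representations `π^±_{±2n}`, `n ≥ 1`: it is irreducible, not
the trivial representation, and `Ω = 1 - (2n-1)²`. The last two conditions do not follow from each
other only for `n = 1`, where the trivial representation has the same Casimir scalar `0`. -/
def IsDiscreteSeries (π : UnitaryRep V) (n : ℕ) : Prop :=
  1 ≤ n ∧ π.IsIrreducible ∧ ¬ π.IsTrivial ∧ π.HasCasimirScalar (1 - (2 * (n : ℝ) - 1) ^ 2)

/-- The differential expression `-Ξ² + xH` on smooth vectors. -/
def formalT (π : UnitaryRep V) (x : ℂ) : Module.End ℂ π.smooth :=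
  -(π.dpi Xi ^ 2) + x • π.dpi Hg

/-- The same as a partially defined operator on `V` with domain the smooth vectors. -/
def formalTPMap (π : UnitaryRep V) (x : ℂ) : V →ₗ.[ℂ] V where
  domain := π.smooth
  toFun := π.smooth.subtype ∘ₗ π.formalT x

/-- The operator `T_π(x) = -Ξ² + xH` on its maximal domain `{u ∈ V | T_π(x) u ∈ V}`, where
`T_π(x) u` is understood in the sense of distributions, i.e. as a functional on the smooth vectors.
As `Ξ` and `H` are skew-symmetric, the formal adjoint of `-Ξ² + xH` is `-Ξ² - x̄H`. So `u` lies
in the domain with `T_π(x) u = w` iff `⟪w, v⟫ = ⟪u, (-Ξ² - x̄H) v⟫` for all smooth `v`, i.e.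
`T_π(x)` is the Hilbert space adjoint of `-Ξ² - x̄H` on the (dense) space of smooth vectors. -/
def T [CompleteSpace V] (π : UnitaryRep V) (x : ℂ) : V →ₗ.[ℂ] V :=
  (π.formalTPMap (-conj x)).adjoint

end UnitaryRep

/-! ### Spectrum and multiplicity for unbounded operators -/

section Spectrum

variable {V : Type*} [NormedAddCommGroup V] [NormedSpace ℂ V]

/-- The resolvent set: `T - ζ` is a bijection from the domain of `T` onto `V` with bounded
inverse `R`. -/
def resolventSet (T : V →ₗ.[ℂ] V) : Set ℂ :=
  {ζ | ∃ R : V →L[ℂ] V, (∀ w, ∃ h : R w ∈ T.domain, T ⟨R w, h⟩ - ζ • R w = w) ∧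
    ∀ u : T.domain, R (T u - ζ • (u : V)) = u}

/-- The spectrum of an unbounded operator. -/
def spec (T : V →ₗ.[ℂ] V) : Set ℂ := (resolventSet T)ᶜ

/-- `ker (T - ζ)^n`, with the natural domain of `(T - ζ)^n`. -/
def kerPow (T : V →ₗ.[ℂ] V) (ζ : ℂ) : ℕ → Submodule ℂ V
  | 0 => ⊥
  | n + 1 =>
    { carrier := {u | ∃ h : u ∈ T.domain, T ⟨u, h⟩ - ζ • u ∈ kerPow T ζ n}
      zero_mem' := ⟨T.domain.zero_mem, by
        have h0 : T ⟨0, T.domain.zero_mem⟩ = 0 := T.map_zero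
        rw [h0]; simp⟩
      add_mem' := by
        rintro a b ⟨ha, ha'⟩ ⟨hb, hb'⟩
        refine ⟨T.domain.add_mem ha hb, ?_⟩
        have h0 : T ⟨a + b, T.domain.add_mem ha hb⟩ = T ⟨a, ha⟩ + T ⟨b, hb⟩ :=
          T.map_add ⟨a, ha⟩ ⟨b, hb⟩
        rw [h0]
        convert Submodule.add_mem _ ha' hb' using 1
        rw [smul_add]; abel
      smul_mem' := by
        rintro c a ⟨ha, ha'⟩
        refine ⟨T.domain.smul_mem c ha, ?_⟩
        have h0 : T ⟨c • a, T.domain.smul_mem c ha⟩ = c • T ⟨a, ha⟩ := T.map_smul c ⟨a, ha⟩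
        rw [h0]
        convert Submodule.smul_mem _ c ha' using 1
        rw [smul_sub, smul_comm] }

/-- `ζ` is an eigenvalue of `T` of (algebraic, hence also geometric) multiplicity one: it has an
eigenvector, and the generalized eigenspace `⋃ n, ker (T - ζ)^n` is one-dimensional. -/
def IsSimpleEigenvalue (T : V →ₗ.[ℂ] V) (ζ : ℂ) : Prop :=
  (∃ u : T.domain, (u : V) ≠ 0 ∧ T u = ζ • (u : V)) ∧
    Module.finrank ℂ (⨆ n, kerPow T ζ n : Submodule ℂ V) = 1

end Spectrum

end KineticBrownian

end

/-!
Under the compact subgroup `K` generated by `Ξ` the representation decomposes into weight spaces, on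
which `-Ξ²` acts by `k²`, and `H ± i B` are ladder operators between them whose norms are computed
from the Casimir scalar `λ`. Hence, off the `K`-fixed vectors and for small `x`, `x H` is bounded
relative to `-Ξ²` with bound less than one, and as `-Ξ² ≥ 1` there, the half plane `Re ζ ≤ 1/2` lies
in the resolvent set of the compression of `T(x)`.

If `λ ≤ 0` and the representation is not trivial, there are no `K`-fixed vectors and this is all. If
`λ > 0`, the `K`-fixed vectors form a line `ℂ φ`, and elimination of the other components (the
Schur complement) shows that `ζ` with `Re ζ ≤ 1/2` lies in the spectrum iff
`ζ = x² ⟪H φ, R(x, ζ) H φ⟫`, where `R(x, ζ)` is the resolvent of the compression. The right hand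
side is a contraction in `ζ`, whose fixed point `μ(x)` depends holomorphically on `x`. The
coefficient of `x²` in `μ` is `⟪H φ, R(0, 0) H φ⟫ = ‖H φ‖² = λ / 8`, and the Schwarz lemma bounds
the error.
-/

noncomputable section

namespace KineticBrownian

/-! ### Relatively bounded perturbations -/

section RelativeBound

open scoped InnerProductSpace

variable {E D : Type*} [NormedAddCommGroup E] [InnerProductSpace ℂ E]

lemma norm_le_of_denseRange_of_norm_inner_le {α : Type*} {f : α → E} (hf : DenseRange f) {w : E}
    {c : ℝ} (hc : 0 ≤ c) (h : ∀ a, ‖⟪w, f a⟫_ℂ‖ ≤ c * ‖f a‖) : ‖w‖ ≤ c := by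
  rw [← innerSL_apply_norm ℂ w]
  exact ContinuousLinearMap.opNorm_le_bound _ hc fun y =>
    hf.induction_on (p := fun y => ‖⟪w, y⟫_ℂ‖ ≤ c * ‖y‖) y
      (isClosed_le (by fun_prop) (by fun_prop)) h

variable [AddCommGroup D] [Module ℂ D]

/-- `N` is an unbounded operator on `E` with domain `D`, included in `E` by `ι`. Uniformly in the
spectral parameters `ζ ∈ Z`, the translates `N - ζ` have dense range and dominate `N` with constant
`M`, and they dominate the perturbation `H` with relative bound `C`. -/
structure RelBounded (ι N H : D →ₗ[ℂ] E) (Z : Set ℂ) (C M : ℝ) : Prop where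
  nonneg : 0 ≤ C
  zero_mem : 0 ∈ Z
  conj_mem : ∀ ζ ∈ Z, conj ζ ∈ Z
  denseRange_sub : ∀ ζ ∈ Z, DenseRange (N - ζ • ι)
  norm_perturbation_le : ∀ ζ ∈ Z, ∀ v, ‖H v‖ ≤ C * ‖(N - ζ • ι) v‖
  norm_le_sub : ∀ ζ ∈ Z, ∀ v, ‖N v‖ ≤ M * ‖(N - ζ • ι) v‖
  norm_incl_le : ∀ v, ‖ι v‖ ≤ M * ‖N v‖

namespace RelBounded

variable {ι N H : D →ₗ[ℂ] E} {Z : Set ℂ} {C M : ℝ} {x ζ η : ℂ}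

lemma denseRange (h : RelBounded ι N H Z C M) : DenseRange N := by
  simpa using h.denseRange_sub 0 h.zero_mem

variable [CompleteSpace E]

/-- The inverse of `N`, i.e. the bounded extension of `N v ↦ ι v`. -/
def inv (_ : RelBounded ι N H Z C M) : E →L[ℂ] E := ι.extendOfNorm N

/-- The bounded operator `H N⁻¹`, i.e. the bounded extension of `N v ↦ H v`. -/
def rel (_ : RelBounded ι N H Z C M) : E →L[ℂ] E := H.extendOfNorm N

lemma inv_apply (h : RelBounded ι N H Z C M) (v : D) : h.inv (N v) = ι v :=
  LinearMap.extendOfNorm_eq h.denseRange ⟨M, h.norm_incl_le⟩ v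

lemma rel_apply (h : RelBounded ι N H Z C M) (v : D) : h.rel (N v) = H v :=
  LinearMap.extendOfNorm_eq h.denseRange
    ⟨C, fun v => by simpa using h.norm_perturbation_le 0 h.zero_mem v⟩ v

/-- The bounded operator `(N + xH - ζ) N⁻¹`. -/
def pencil (h : RelBounded ι N H Z C M) (x ζ : ℂ) : E →L[ℂ] E := 1 + x • h.rel - ζ • h.inv

lemma pencil_apply (h : RelBounded ι N H Z C M) (x ζ : ℂ) (v : D) :
    h.pencil x ζ (N v) = N v + x • H v - ζ • ι v := by
  simp [pencil, h.inv_apply, h.rel_apply]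

lemma pencil_zero_apply (h : RelBounded ι N H Z C M) (ζ : ℂ) (v : D) :
    h.pencil 0 ζ (N v) = (N - ζ • ι) v := by
  simp [h.pencil_apply]

lemma isUnit_pencil_zero (h : RelBounded ι N H Z C M) (hζ : ζ ∈ Z) :
    IsUnit (h.pencil 0 ζ) := by
  let R : E →L[ℂ] E := N.extendOfNorm (N - ζ • ι)
  have hR (v : D) : R ((N - ζ • ι) v) = N v :=
    LinearMap.extendOfNorm_eq (h.denseRange_sub ζ hζ) ⟨M, h.norm_le_sub ζ hζ⟩ v
  refine isUnit_iff_exists.2 ⟨R, DFunLike.coe_injective ?_, DFunLike.coe_injective ?_⟩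
  · refine (h.denseRange_sub ζ hζ).equalizer (by fun_prop) (by fun_prop) (funext fun v => ?_)
    simp only [Function.comp_apply, mul_apply_eq_comp, one_apply_eq_self, hR, h.pencil_zero_apply]
  · refine h.denseRange.equalizer (by fun_prop) (by fun_prop) (funext fun v => ?_)
    simp only [Function.comp_apply, mul_apply_eq_comp, one_apply_eq_self, hR, h.pencil_zero_apply]

/-- By the factorization `(N + xH - ζ) N⁻¹ = (1 + x H (N - ζ)⁻¹) ((N - ζ) N⁻¹)`, in which the first
factor is inverted by a Neumann series. -/
lemma isUnit_pencil (h : RelBounded ι N H Z C M) (hx : ‖x‖ * C < 1) (hζ : ζ ∈ Z) :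
    IsUnit (h.pencil x ζ) := by
  let K : E →L[ℂ] E := H.extendOfNorm (N - ζ • ι)
  have hK (v : D) : K ((N - ζ • ι) v) = H v :=
    LinearMap.extendOfNorm_eq (h.denseRange_sub ζ hζ) ⟨C, h.norm_perturbation_le ζ hζ⟩ v
  have hfactor : h.pencil x ζ = (1 - -(x • K)) * h.pencil 0 ζ := by
    refine DFunLike.coe_injective (h.denseRange.equalizer (by fun_prop) (by fun_prop) ?_)
    funext v
    simp only [Function.comp_apply, mul_apply_eq_comp, h.pencil_zero_apply, sub_neg_eq_add,
      add_apply, one_apply_eq_self, smul_apply, hK, h.pencil_apply]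
    rw [LinearMap.sub_apply, LinearMap.smul_apply]
    abel
  have hnorm : ‖-(x • K)‖ < 1 := by
    rw [norm_neg, norm_smul]
    refine lt_of_le_of_lt (mul_le_mul_of_nonneg_left ?_ (norm_nonneg x)) hx
    exact LinearMap.opNorm_extendOfNorm_le (h.denseRange_sub ζ hζ) h.nonneg
      (h.norm_perturbation_le ζ hζ)
  rw [hfactor]
  exact (isUnit_one_sub_of_norm_lt_one hnorm).mul (h.isUnit_pencil_zero hζ)

/-- The bounded inverse of `N + xH - ζ` on its maximal domain, for symmetric `N` and skew-symmetric
`H`: that operator is the adjoint of `N - x̄H - ζ̄`, so the inverse is assembled from adjoints; see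
`inner_eq_iff_eq_resolvent`. -/
def resolvent (h : RelBounded ι N H Z C M) (x ζ : ℂ) : E →L[ℂ] E :=
  Ring.inverse (star (h.pencil (-conj x) (conj ζ))) * star h.inv

lemma star_pencil (h : RelBounded ι N H Z C M) (x ζ : ℂ) :
    star (h.pencil (-conj x) (conj ζ)) = 1 - x • star h.rel - ζ • star h.inv := by
  simp [pencil, sub_eq_add_neg]

lemma isUnit_pencil_conj (h : RelBounded ι N H Z C M) (hx : ‖x‖ * C < 1) (hζ : ζ ∈ Z) :
    IsUnit (h.pencil (-conj x) (conj ζ)) :=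
  h.isUnit_pencil (by simpa using hx) (h.conj_mem ζ hζ)

lemma pencil_conj_apply (h : RelBounded ι N H Z C M) (x ζ : ℂ) (v : D) :
    h.pencil (-conj x) (conj ζ) (N v) = N v - conj x • H v - conj ζ • ι v := by
  rw [h.pencil_apply, neg_smul, ← sub_eq_add_neg]

lemma inner_eq_iff_eq_resolvent (h : RelBounded ι N H Z C M) (hx : ‖x‖ * C < 1) (hζ : ζ ∈ Z)
    (u w : E) :
    (∀ v, ⟪w, ι v⟫_ℂ = ⟪u, N v - conj x • H v - conj ζ • ι v⟫_ℂ) ↔ u = h.resolvent x ζ w := by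
  have hunit := (h.isUnit_pencil_conj hx hζ).star
  set P := h.pencil (-conj x) (conj ζ) with hP
  have hadjoint (v : D) : ⟪w, ι v⟫_ℂ = ⟪u, N v - conj x • H v - conj ζ • ι v⟫_ℂ ↔
      ⟪star h.inv w, N v⟫_ℂ = ⟪star P u, N v⟫_ℂ := by
    simp only [ContinuousLinearMap.star_eq_adjoint, ContinuousLinearMap.adjoint_inner_left,
      h.inv_apply, hP, h.pencil_conj_apply]
  have hdense : (∀ v, ⟪star h.inv w, N v⟫_ℂ = ⟪star P u, N v⟫_ℂ) ↔ star h.inv w = star P u := by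
    refine ⟨fun heq => ext_inner_right ℂ fun y => ?_, fun heq v => by rw [heq]⟩
    exact h.denseRange.induction_on (p := fun y => ⟪star h.inv w, y⟫_ℂ = ⟪star P u, y⟫_ℂ) y
      (isClosed_eq (by fun_prop) (by fun_prop)) heq
  simp_rw [hadjoint, hdense, resolvent, mul_apply_eq_comp]
  constructor
  · intro heq
    rw [heq, ← mul_apply_eq_comp, Ring.inverse_mul_cancel _ hunit, one_apply_eq_self]
  · rintro rfl
    rw [← mul_apply_eq_comp, Ring.mul_inverse_cancel _ hunit, one_apply_eq_self]

lemma inner_resolvent (h : RelBounded ι N H Z C M) (hx : ‖x‖ * C < 1) (hζ : ζ ∈ Z) (w : E)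
    (v : D) :
    ⟪h.resolvent x ζ w, N v - conj x • H v - conj ζ • ι v⟫_ℂ = ⟪w, ι v⟫_ℂ :=
  ((h.inner_eq_iff_eq_resolvent hx hζ _ w).2 rfl v).symm

lemma differentiableOn_resolvent (h : RelBounded ι N H Z C M) {U : Set ℂ} {f : ℂ → ℂ}
    (hf : DifferentiableOn ℂ f U) (hU : ∀ x ∈ U, ‖x‖ * C < 1) (hfZ : Set.MapsTo f U Z) :
    DifferentiableOn ℂ (fun x => h.resolvent x (f x)) U := by
  intro x hx
  have hunit := (h.isUnit_pencil_conj (hU x hx) (hfZ hx)).star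
  simp only [resolvent, star_pencil] at hunit ⊢
  refine DifferentiableWithinAt.mul ?_ (differentiableWithinAt_const _)
  refine DifferentiableWithinAt.inverse ?_ hunit
  exact ((differentiableWithinAt_const _).sub (differentiableWithinAt_id.smul_const _)).sub
    ((hf x hx).smul_const _)

lemma resolvent_sub_resolvent (h : RelBounded ι N H Z C M) (hx : ‖x‖ * C < 1) (hζ : ζ ∈ Z)
    (hη : η ∈ Z) (w : E) :
    h.resolvent x ζ w - h.resolvent x η w = (ζ - η) • h.resolvent x ζ (h.resolvent x η w) := by
  have hres : h.resolvent x η w = h.resolvent x ζ (w - (ζ - η) • h.resolvent x η w) := by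
    rw [← h.inner_eq_iff_eq_resolvent hx hζ]
    intro v
    have hshift : N v - conj x • H v - conj ζ • ι v
        = (N v - conj x • H v - conj η • ι v) - (conj ζ - conj η) • ι v := by
      rw [sub_smul]
      abel
    rw [hshift, inner_sub_right, h.inner_resolvent hx hη, inner_sub_left, inner_smul_left,
      inner_smul_right, map_sub]
  rw [map_sub, map_smul] at hres
  rw [sub_eq_iff_eq_add, add_comm, ← sub_eq_iff_eq_add, ← hres]

lemma norm_resolvent_le (h : RelBounded ι N H Z C M) (hx : ‖x‖ * C < 1) (hζ : ζ ∈ Z) {δ : ℝ}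
    (hδ : 0 < δ)
    (hcoercive : ∀ v, δ * ‖ι v‖ ^ 2 ≤ (⟪ι v, N v - conj x • H v - conj ζ • ι v⟫_ℂ).re) (w : E) :
    ‖h.resolvent x ζ w‖ ≤ δ⁻¹ * ‖w‖ := by
  have hincl (v : D) : ‖ι v‖ ≤ δ⁻¹ * ‖N v - conj x • H v - conj ζ • ι v‖ := by
    rcases (norm_nonneg (ι v)).eq_or_lt with h0 | h0
    · rw [← h0]
      positivity
    · have hCS := (hcoercive v).trans ((Complex.re_le_norm _).trans (norm_inner_le_norm _ _))
      rw [inv_mul_eq_div, le_div_iff₀ hδ]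
      nlinarith only [hCS, h0]
  have hdense : DenseRange fun v => N v - conj x • H v - conj ζ • ι v := by
    simp_rw [← h.pencil_conj_apply]
    have hbij := ContinuousLinearMap.isUnit_iff_bijective.1 (h.isUnit_pencil_conj hx hζ)
    exact hbij.surjective.denseRange.comp h.denseRange (ContinuousLinearMap.continuous _)
  refine norm_le_of_denseRange_of_norm_inner_le hdense (by positivity) fun v => ?_
  rw [h.inner_resolvent hx hζ]
  calc ‖⟪w, ι v⟫_ℂ‖ ≤ ‖w‖ * ‖ι v‖ := norm_inner_le_norm _ _
    _ ≤ ‖w‖ * (δ⁻¹ * ‖N v - conj x • H v - conj ζ • ι v‖) := by gcongr; exact hincl v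
    _ = δ⁻¹ * ‖w‖ * ‖N v - conj x • H v - conj ζ • ι v‖ := by ring

end RelBounded

end RelativeBound

/-! ### Holomorphic fixed points of contractions -/

section FixedPoint

open Filter Function Set Topology
open scoped NNReal

variable {E : Type*} [NormedAddCommGroup E]

lemma norm_iterate_sub_fixedPoint_le {f : E → E} {Z : Set E} {κ : ℝ≥0}
    (hlip : LipschitzOnWith κ f Z)
    (hmaps : MapsTo f Z Z) {y z : E} (hy : y ∈ Z) (hfix : IsFixedPt f y) (hz : z ∈ Z) (n : ℕ) :
    ‖f^[n] z - y‖ ≤ κ ^ n * ‖z - y‖ := by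
  induction n with
  | zero => simp
  | succ n ih =>
    calc ‖f^[n + 1] z - y‖ = ‖f (f^[n] z) - f y‖ := by rw [iterate_succ_apply', hfix]
      _ ≤ κ * ‖f^[n] z - y‖ := hlip.norm_sub_le (hmaps.iterate n hz) hy
      _ ≤ κ * (κ ^ n * ‖z - y‖) := by gcongr
      _ = κ ^ (n + 1) * ‖z - y‖ := by ring

variable [CompleteSpace E]

lemma existsUnique_fixedPoint_of_lipschitzOnWith {f : E → E} {Z : Set E} (hZ : IsClosed Z)
    (hne : Z.Nonempty) {κ : ℝ≥0} (hκ : κ < 1) (hmaps : MapsTo f Z Z)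
    (hlip : LipschitzOnWith κ f Z) :
    ∃ y ∈ Z, IsFixedPt f y ∧ ∀ z ∈ Z, IsFixedPt f z → z = y := by
  obtain ⟨z₀, hz₀⟩ := hne
  have hcontr : ContractingWith κ (hmaps.restrict f Z Z) := ⟨hκ, hlip.mapsToRestrict hmaps⟩
  obtain ⟨y, hyZ, hy, -⟩ := hcontr.exists_fixedPoint' hZ.isComplete hmaps hz₀ (edist_ne_top _ _)
  refine ⟨y, hyZ, hy, fun z hz hfz => ?_⟩
  exact congrArg Subtype.val (hcontr.fixedPoint_unique' (x := ⟨z, hz⟩) (y := ⟨y, hyZ⟩)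
    (Subtype.ext hfz) (Subtype.ext hy))

lemma exists_differentiableOn_fixedPoint [NormedSpace ℂ E] {U : Set ℂ} (hU : IsOpen U)
    (F : ℂ → E → E) {Z : Set E} (hZ : IsClosed Z) {ρ : ℝ} (hρ : 0 ≤ ρ)
    (hρZ : Metric.closedBall 0 ρ ⊆ Z) {κ : ℝ≥0} (hκ : κ < 1)
    (hmaps : ∀ x ∈ U, MapsTo (F x) Z (Metric.closedBall 0 ρ))
    (hlip : ∀ x ∈ U, LipschitzOnWith κ (F x) Z)
    (hdiff : ∀ f : ℂ → E, DifferentiableOn ℂ f U → MapsTo f U Z →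
      DifferentiableOn ℂ (fun x => F x (f x)) U) :
    ∃ μ : ℂ → E, DifferentiableOn ℂ μ U ∧ ∀ x ∈ U, ‖μ x‖ ≤ ρ ∧ F x (μ x) = μ x ∧
      ∀ z ∈ Z, F x z = z → z = μ x := by
  have h0Z : (0 : E) ∈ Z := hρZ (Metric.mem_closedBall_self hρ)
  have hmapsZ (x) (hx : x ∈ U) : MapsTo (F x) Z Z := (hmaps x hx).mono_right hρZ
  choose! μ hμZ hμ hunique using fun x (hx : x ∈ U) =>
    existsUnique_fixedPoint_of_lipschitzOnWith hZ ⟨0, h0Z⟩ hκ (hmapsZ x hx) (hlip x hx)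
  have hnorm (x) (hx : x ∈ U) : ‖μ x‖ ≤ ρ := by
    rw [← mem_closedBall_zero_iff, ← (hμ x hx).eq]
    exact hmaps x hx (hμZ x hx)
  have hiterate (n : ℕ) : DifferentiableOn ℂ (fun x => (F x)^[n] 0) U := by
    induction n with
    | zero => exact differentiableOn_const _
    | succ n ih =>
      simp_rw [iterate_succ_apply']
      exact hdiff _ ih fun x hx => (hmapsZ x hx).iterate n h0Z
  have hunif : TendstoUniformlyOn (fun n x => (F x)^[n] 0) μ atTop U := by
    rw [Metric.tendstoUniformlyOn_iff]
    intro ε hε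
    have hgeom : Tendsto (fun n => (κ : ℝ) ^ n * ρ) atTop (𝓝 0) := by
      simpa using (tendsto_pow_atTop_nhds_zero_of_lt_one κ.2 (by exact_mod_cast hκ)).mul_const ρ
    filter_upwards [hgeom.eventually_lt_const hε] with n hn x hx
    rw [dist_comm, dist_eq_norm]
    calc ‖(F x)^[n] 0 - μ x‖ ≤ κ ^ n * ‖0 - μ x‖ :=
          norm_iterate_sub_fixedPoint_le (hlip x hx) (hmapsZ x hx) (hμZ x hx) (hμ x hx) h0Z n
      _ ≤ κ ^ n * ρ := by rw [zero_sub, norm_neg]; gcongr; exact hnorm x hx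
      _ < ε := hn
  have hμdiff : DifferentiableOn ℂ μ U :=
    hunif.tendstoLocallyUniformlyOn.differentiableOn (Eventually.of_forall hiterate) hU
  exact ⟨μ, hμdiff, fun x hx => ⟨hnorm x hx, hμ x hx, hunique x hx⟩⟩

end FixedPoint

/-! ### The exponential map and the Cartan decomposition -/

section Group

open scoped Matrix.Norms.Operator
open Matrix

/-- The exponential map `𝔰𝔩₂(ℝ) → SL₂(ℝ)`, which lifts `expG`. -/
def expS (X : sl2) : SL(2, ℝ) := ⟨NormedSpace.exp (X : Matrix (Fin 2) (Fin 2) ℝ), det_exp_sl2 X⟩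

/-- The projection `SL₂(ℝ) → PSL₂(ℝ)`. -/
def proj : SL(2, ℝ) →* PSL(2, ℝ) := QuotientGroup.mk' _

lemma expG_eq_proj_expS (X : sl2) : expG X = proj (expS X) := rfl

lemma continuous_proj : Continuous proj := continuous_quotient_mk'

lemma proj_surjective : Function.Surjective proj := QuotientGroup.mk'_surjective _

lemma coe_expS (X : sl2) :
    (expS X : Matrix (Fin 2) (Fin 2) ℝ) = NormedSpace.exp (X : Matrix (Fin 2) (Fin 2) ℝ) := rfl

lemma expS_add_smul (X : sl2) (s t : ℝ) : expS ((s + t) • X) = expS (s • X) * expS (t • X) := by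
  refine Subtype.ext ?_
  rw [Matrix.SpecialLinearGroup.coe_mul, coe_expS, coe_expS, coe_expS, add_smul]
  push_cast
  exact Matrix.exp_add_of_commute _ _ (((Commute.refl _).smul_left s).smul_right t)

lemma expS_zero : expS 0 = 1 := by
  refine Subtype.ext ?_
  simp [coe_expS]

lemma expS_neg (X : sl2) : expS (-X) = (expS X)⁻¹ := by
  have hmul := expS_add_smul X (-1) 1
  rw [neg_add_cancel, zero_smul, expS_zero, one_smul, neg_one_smul] at hmul
  exact eq_inv_of_mul_eq_one_left hmul.symm

lemma continuous_expS_smul (X : sl2) : Continuous fun t : ℝ => expS (t • X) := by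
  refine Continuous.subtype_mk ?_ _
  push_cast
  exact (NormedSpace.exp_continuous (𝔸 := Matrix (Fin 2) (Fin 2) ℝ)).comp (by fun_prop)

lemma expG_add_smul (X : sl2) (s t : ℝ) : expG ((s + t) • X) = expG (s • X) * expG (t • X) := by
  simp only [expG_eq_proj_expS, expS_add_smul, map_mul]

lemma expG_zero : expG 0 = 1 := by rw [expG_eq_proj_expS, expS_zero, map_one]

lemma expG_neg (X : sl2) : expG (-X) = (expG X)⁻¹ := by
  rw [expG_eq_proj_expS, expS_neg, map_inv, expG_eq_proj_expS]

lemma continuous_expG_smul (X : sl2) : Continuous fun t : ℝ => expG (t • X) :=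
  continuous_proj.comp (continuous_expS_smul X)

lemma exp_smul_eq_of_hasDerivAt {𝔸 : Type*} [NormedRing 𝔸] [NormedAlgebra ℝ 𝔸] [CompleteSpace 𝔸]
    (X : 𝔸) (c : ℝ → 𝔸) (hc : ∀ t, HasDerivAt c (X * c t) t) (h0 : c 0 = 1) (t : ℝ) :
    NormedSpace.exp (t • X) = c t := by
  let _ : NormedAlgebra ℚ 𝔸 := NormedAlgebra.restrictScalars ℚ ℝ 𝔸
  have hderiv (s : ℝ) : HasDerivAt (fun s => NormedSpace.exp (s • -X) * c s) 0 s := by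
    refine ((hasDerivAt_exp_smul_const (-X) s).mul (hc s)).congr_deriv ?_
    rw [mul_assoc, neg_mul, mul_neg, neg_add_cancel]
  have hconst : NormedSpace.exp (t • -X) * c t = 1 := by
    rw [is_const_of_deriv_eq_zero (fun s => (hderiv s).differentiableAt)
      (fun s => (hderiv s).deriv) t 0, h0, zero_smul, NormedSpace.exp_zero, mul_one]
  have hinv : NormedSpace.exp (t • X) * NormedSpace.exp (t • -X) = 1 := by
    rw [← NormedSpace.exp_add_of_commute (((Commute.refl X).neg_right.smul_left t).smul_right t),
      smul_neg, add_neg_cancel, NormedSpace.exp_zero]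
  exact left_inv_eq_right_inv hinv hconst

lemma coe_expS_smul_Xi (t : ℝ) : (expS (t • Xi) : Matrix (Fin 2) (Fin 2) ℝ) =
    !![Real.cos (t / 2), Real.sin (t / 2); -Real.sin (t / 2), Real.cos (t / 2)] := by
  rw [coe_expS]
  push_cast
  refine exp_smul_eq_of_hasDerivAt _
    (fun t => !![Real.cos (t / 2), Real.sin (t / 2); -Real.sin (t / 2), Real.cos (t / 2)])
    (fun t => ?_) ?_ t
  · have hsin : HasDerivAt (fun t : ℝ => Real.sin (t / 2)) (Real.cos (t / 2) * (1 / 2)) t :=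
      ((hasDerivAt_id t).div_const 2).sin
    have hcos : HasDerivAt (fun t : ℝ => Real.cos (t / 2)) (-Real.sin (t / 2) * (1 / 2)) t :=
      ((hasDerivAt_id t).div_const 2).cos
    refine hasDerivAt_pi.2 fun i => hasDerivAt_pi.2 fun j => ?_
    fin_cases i <;> fin_cases j
    · exact hcos.congr_deriv (by simp [Xi, Matrix.mul_apply]; ring)
    · exact hsin.congr_deriv (by simp [Xi, Matrix.mul_apply]; ring)
    · exact hsin.neg.congr_deriv (by simp [Xi, Matrix.mul_apply]; ring)
    · exact hcos.congr_deriv (by simp [Xi, Matrix.mul_apply]; ring)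
  · ext i j
    fin_cases i <;> fin_cases j <;> simp

lemma coe_expS_smul_Hg (t : ℝ) : (expS (t • Hg) : Matrix (Fin 2) (Fin 2) ℝ) =
    !![Real.exp (t / 2), 0; 0, Real.exp (-(t / 2))] := by
  rw [coe_expS]
  push_cast
  refine exp_smul_eq_of_hasDerivAt _
    (fun t => !![Real.exp (t / 2), 0; 0, Real.exp (-(t / 2))]) (fun t => ?_) ?_ t
  · have hpos : HasDerivAt (fun t : ℝ => Real.exp (t / 2)) (Real.exp (t / 2) * (1 / 2)) t :=
      ((hasDerivAt_id t).div_const 2).exp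
    have hneg : HasDerivAt (fun t : ℝ => Real.exp (-(t / 2)))
        (Real.exp (-(t / 2)) * -(1 / 2)) t :=
      ((hasDerivAt_id t).div_const 2).neg.exp
    refine hasDerivAt_pi.2 fun i => hasDerivAt_pi.2 fun j => ?_
    fin_cases i <;> fin_cases j
    · exact hpos.congr_deriv (by simp [Hg, Matrix.mul_apply]; ring)
    · exact (hasDerivAt_const t (0 : ℝ)).congr_deriv (by simp [Hg, Matrix.mul_apply])
    · exact (hasDerivAt_const t (0 : ℝ)).congr_deriv (by simp [Hg, Matrix.mul_apply])
    · exact hneg.congr_deriv (by simp [Hg, Matrix.mul_apply]; ring)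
  · ext i j
    fin_cases i <;> fin_cases j <;> simp

lemma expG_two_pi_smul_Xi : expG ((2 * Real.pi) • Xi) = 1 := by
  have hneg : expS ((2 * Real.pi) • Xi) = -1 := by
    refine Subtype.ext ?_
    rw [coe_expS_smul_Xi]
    ext i j
    fin_cases i <;> fin_cases j <;> simp
  refine (QuotientGroup.eq_one_iff (expS _)).2 ?_
  rw [hneg, Subgroup.mem_center_iff]
  simp

/-- The adjoint action of `SL₂(ℝ)` on its Lie algebra. -/
def Ad (h : SL(2, ℝ)) (X : sl2) : sl2 :=
  ⟨h * X * (h⁻¹ : SL(2, ℝ)), by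
    rw [mem_sl2_iff, ← trace_fin_two, trace_mul_cycle, ← Matrix.SpecialLinearGroup.coe_mul,
      inv_mul_cancel, Matrix.SpecialLinearGroup.coe_one, one_mul, trace_fin_two]
    exact (mem_sl2_iff _).1 X.2⟩

lemma coe_Ad (h : SL(2, ℝ)) (X : sl2) :
    (Ad h X : Matrix (Fin 2) (Fin 2) ℝ) = h * X * (h⁻¹ : SL(2, ℝ)) := rfl

lemma Ad_smul (h : SL(2, ℝ)) (t : ℝ) (X : sl2) : Ad h (t • X) = t • Ad h X := by
  refine Subtype.ext ?_
  simp [coe_Ad]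

lemma expS_Ad (h : SL(2, ℝ)) (X : sl2) : expS (Ad h X) = h * expS X * h⁻¹ := by
  have hinv : ((h⁻¹ : SL(2, ℝ)) : Matrix (Fin 2) (Fin 2) ℝ) = (h : Matrix (Fin 2) (Fin 2) ℝ)⁻¹ := by
    rw [Matrix.SpecialLinearGroup.coe_inv, Matrix.inv_def, Matrix.SpecialLinearGroup.det_coe,
      Ring.inverse_one, one_smul]
  have hunit : IsUnit (h : Matrix (Fin 2) (Fin 2) ℝ) := by
    simp [Matrix.isUnit_iff_isUnit_det]
  refine Subtype.ext ?_
  rw [Matrix.SpecialLinearGroup.coe_mul, Matrix.SpecialLinearGroup.coe_mul, coe_expS, coe_expS,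
    coe_Ad, hinv, Matrix.exp_conj _ _ hunit]

lemma proj_mul_expG_smul (h : SL(2, ℝ)) (t : ℝ) (X : sl2) :
    proj h * expG (t • X) = expG (t • Ad h X) * proj h := by
  rw [← Ad_smul, expG_eq_proj_expS, expG_eq_proj_expS, expS_Ad, map_mul, map_mul, map_inv,
    inv_mul_cancel_right]

lemma Ad_Xi_Hg (t : ℝ) : Ad (expS (t • Xi)) Hg = Real.cos t • Hg - Real.sin t • Bg := by
  have hcos : Real.cos t = Real.cos (t / 2) ^ 2 - Real.sin (t / 2) ^ 2 := by
    rw [← Real.cos_two_mul', mul_div_cancel₀ t two_ne_zero]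
  have hsin : Real.sin t = 2 * Real.sin (t / 2) * Real.cos (t / 2) := by
    rw [← Real.sin_two_mul, mul_div_cancel₀ t two_ne_zero]
  refine Subtype.ext ?_
  rw [coe_Ad, Matrix.SpecialLinearGroup.coe_inv, coe_expS_smul_Xi, Matrix.adjugate_fin_two_of,
    hcos, hsin]
  ext i j
  fin_cases i <;> fin_cases j <;> simp [Hg, Bg, Matrix.mul_apply] <;> ring

lemma Ad_Xi_Bg (t : ℝ) : Ad (expS (t • Xi)) Bg = Real.sin t • Hg + Real.cos t • Bg := by
  have hcos : Real.cos t = Real.cos (t / 2) ^ 2 - Real.sin (t / 2) ^ 2 := by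
    rw [← Real.cos_two_mul', mul_div_cancel₀ t two_ne_zero]
  have hsin : Real.sin t = 2 * Real.sin (t / 2) * Real.cos (t / 2) := by
    rw [← Real.sin_two_mul, mul_div_cancel₀ t two_ne_zero]
  refine Subtype.ext ?_
  rw [coe_Ad, Matrix.SpecialLinearGroup.coe_inv, coe_expS_smul_Xi, Matrix.adjugate_fin_two_of,
    hcos, hsin]
  ext i j
  fin_cases i <;> fin_cases j <;> simp [Hg, Bg, Matrix.mul_apply] <;> ring

lemma Ad_Hg_Xi (t : ℝ) : Ad (expS (t • Hg)) Xi = Real.cosh t • Xi + Real.sinh t • Bg := by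
  have hpos : Real.exp (t / 2) * Real.exp (t / 2) = Real.cosh t + Real.sinh t := by
    rw [← Real.exp_add, Real.cosh_add_sinh, add_halves]
  have hneg : Real.exp (-(t / 2)) * Real.exp (-(t / 2)) = Real.cosh t - Real.sinh t := by
    rw [← Real.exp_add, Real.cosh_sub_sinh, ← neg_add, add_halves]
  refine Subtype.ext ?_
  rw [coe_Ad, Matrix.SpecialLinearGroup.coe_inv, coe_expS_smul_Hg, Matrix.adjugate_fin_two_of]
  ext i j
  fin_cases i <;> fin_cases j <;> simp [Xi, Bg, Matrix.mul_apply] <;> linarith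

lemma exists_orthogonal_columns_mul_expS_Xi (h : SL(2, ℝ)) :
    ∃ t : ℝ, (h * expS (t • Xi)) 0 0 * (h * expS (t • Xi)) 0 1 +
      (h * expS (t • Xi)) 1 0 * (h * expS (t • Xi)) 1 1 = 0 := by
  set p : ℝ := h 0 0 * h 0 1 + h 1 0 * h 1 1 with hp
  set q : ℝ := (h 0 1 ^ 2 + h 1 1 ^ 2 - h 0 0 ^ 2 - h 1 0 ^ 2) / 2 with hq
  set z : ℂ := ⟨q, p⟩
  have hangle : p * Real.cos z.arg = q * Real.sin z.arg := by
    rw [← show ‖z‖ * Real.sin z.arg = p from Complex.norm_mul_sin_arg z,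
      ← show ‖z‖ * Real.cos z.arg = q from Complex.norm_mul_cos_arg z]
    ring
  have hcos : Real.cos z.arg = Real.cos (z.arg / 2) ^ 2 - Real.sin (z.arg / 2) ^ 2 := by
    rw [← Real.cos_two_mul', mul_div_cancel₀ _ two_ne_zero]
  have hsin : Real.sin z.arg = 2 * Real.sin (z.arg / 2) * Real.cos (z.arg / 2) := by
    rw [← Real.sin_two_mul, mul_div_cancel₀ _ two_ne_zero]
  refine ⟨z.arg, ?_⟩
  rw [hcos, hsin, hp, hq] at hangle
  simp only [Matrix.SpecialLinearGroup.coe_mul, coe_expS_smul_Xi, Matrix.mul_apply,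
    Fin.sum_univ_two, Matrix.of_apply, Matrix.cons_val', Matrix.cons_val_zero,
    Matrix.cons_val_one, Matrix.cons_val_fin_one]
  linear_combination hangle

lemma exists_eq_expS_Xi_mul_expS_Hg {m : SL(2, ℝ)}
    (horth : m 0 0 * m 0 1 + m 1 0 * m 1 1 = 0) :
    ∃ a t : ℝ, m = expS (a • Xi) * expS (t • Hg) := by
  have hdet : m 0 0 * m 1 1 - m 0 1 * m 1 0 = 1 := by
    rw [← Matrix.det_fin_two, Matrix.SpecialLinearGroup.det_coe]
  set z : ℂ := ⟨m 0 0, -m 1 0⟩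
  set r : ℝ := ‖z‖ with hr
  have h00 : m 0 0 = r * Real.cos z.arg := Eq.symm <| Complex.norm_mul_cos_arg z
  have h10 : m 1 0 = -(r * Real.sin z.arg) := by
    rw [show r * Real.sin z.arg = -m 1 0 from Complex.norm_mul_sin_arg z, neg_neg]
  have hr2 : r ^ 2 = m 0 0 ^ 2 + m 1 0 ^ 2 := by
    rw [hr, Complex.sq_norm, Complex.normSq_mk]
    ring
  have hrpos : 0 < r := by
    refine norm_pos_iff.2 fun h0 => ?_
    simp [h00, h10, show r = 0 from congrArg norm h0 |>.trans norm_zero] at hdet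
  have h01 : m 0 1 = Real.sin z.arg * r⁻¹ := by
    rw [eq_mul_inv_iff_mul_eq₀ hrpos.ne']
    refine mul_left_cancel₀ hrpos.ne' ?_
    linear_combination m 0 1 * hr2 + m 0 0 * horth - m 1 0 * hdet - h10
  have h11 : m 1 1 = Real.cos z.arg * r⁻¹ := by
    rw [eq_mul_inv_iff_mul_eq₀ hrpos.ne']
    refine mul_left_cancel₀ hrpos.ne' ?_
    linear_combination m 1 1 * hr2 + m 1 0 * horth + m 0 0 * hdet + h00
  refine ⟨2 * z.arg, 2 * Real.log r, ?_⟩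
  refine Subtype.ext ?_
  rw [Matrix.SpecialLinearGroup.coe_mul, coe_expS_smul_Xi, coe_expS_smul_Hg,
    mul_div_cancel_left₀ _ two_ne_zero, mul_div_cancel_left₀ _ two_ne_zero, Real.exp_neg,
    Real.exp_log hrpos]
  ext i j
  fin_cases i <;> fin_cases j <;> simp [Matrix.mul_apply, h00, h01, h10, h11, mul_comm]

/-- The Cartan decomposition of `PSL₂(ℝ)`: rotate the columns of a matrix into orthogonal ones. -/
lemma exists_cartan (g : PSL(2, ℝ)) :
    ∃ a t b : ℝ, g = expG (a • Xi) * expG (t • Hg) * expG (b • Xi) := by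
  obtain ⟨h, rfl⟩ := proj_surjective g
  obtain ⟨b, horth⟩ := exists_orthogonal_columns_mul_expS_Xi h
  obtain ⟨a, t, hcartan⟩ := exists_eq_expS_Xi_mul_expS_Hg horth
  refine ⟨a, t, -b, ?_⟩
  rw [neg_smul, expG_neg, eq_mul_inv_iff_mul_eq, expG_eq_proj_expS, expG_eq_proj_expS,
    expG_eq_proj_expS, ← map_mul, ← map_mul, hcartan]

end Group

/-! ### Density of the smooth vectors -/

section Garding

open scoped Matrix.Norms.Operator ContDiff Topology
open Matrix MeasureTheory

/-- The space of real `2 × 2` matrices, as pairs of columns. It carries the test functions against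
which a representation is integrated. -/
abbrev Cols : Type := (Fin 2 → ℝ) × (Fin 2 → ℝ)

/-- Left multiplication by a matrix, acting on pairs of columns. -/
def act : Matrix (Fin 2) (Fin 2) ℝ →ₐ[ℝ] Cols →L[ℝ] Cols :=
  AlgHom.ofLinearMap
    { toFun M := M.mulVecLin.toContinuousLinearMap.prodMap M.mulVecLin.toContinuousLinearMap
      map_add' M N := by ext p i <;> simp
      map_smul' c M := by ext p i <;> simp }
    (by ext p i <;> simp)
    (fun M N => by ext p i <;> simp)

lemma act_apply (M : Matrix (Fin 2) (Fin 2) ℝ) (p : Cols) : act M p = (M *ᵥ p.1, M *ᵥ p.2) := rfl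

lemma act_mul (M N : Matrix (Fin 2) (Fin 2) ℝ) (p : Cols) : act (M * N) p = act M (act N p) := by
  rw [map_mul, mul_apply_eq_comp]

lemma act_inv_act (h : SL(2, ℝ)) (p : Cols) : act (h⁻¹ : SL(2, ℝ)) (act h p) = p := by
  rw [← act_mul, ← Matrix.SpecialLinearGroup.coe_mul, inv_mul_cancel,
    Matrix.SpecialLinearGroup.coe_one, map_one, one_apply_eq_self]

lemma hasDerivAt_act_expS (X : sl2) (p : Cols) (t : ℝ) :
    HasDerivAt (fun t : ℝ => act (expS (-(t • X))) p) (-act X (act (expS (-(t • X))) p)) t := by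
  have hexp (s : ℝ) : (expS (-(s • X)) : Matrix (Fin 2) (Fin 2) ℝ) =
      NormedSpace.exp (s • (-X : Matrix (Fin 2) (Fin 2) ℝ)) := by
    rw [coe_expS, ← smul_neg]
    push_cast
    rfl
  have hact := (LinearMap.toContinuousLinearMap act.toLinearMap).hasFDerivAt.comp_hasDerivAt t
    (hasDerivAt_exp_smul_const' (-X : Matrix (Fin 2) (Fin 2) ℝ) t)
  simp_rw [hexp]
  refine (hact.clm_apply (hasDerivAt_const t p)).congr_deriv ?_
  rw [map_zero, add_zero, ← act_mul, ← _root_.neg_apply, ← map_neg, ← neg_mul]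
  rfl

lemma continuous_act_expS (X : sl2) :
    Continuous fun q : ℝ × Cols => act (expS (q.1 • X)) q.2 := by
  have hact : Continuous act := act.toLinearMap.continuous_of_finiteDimensional
  exact (hact.comp (continuous_subtype_val.comp
    ((continuous_expS_smul X).comp continuous_fst))).clm_apply continuous_snd

/-- The matrix with given columns. -/
def colsMatrix (p : Cols) : Matrix (Fin 2) (Fin 2) ℝ := !![p.1 0, p.2 0; p.1 1, p.2 1]

lemma colsMatrix_act (M : Matrix (Fin 2) (Fin 2) ℝ) (p : Cols) :
    colsMatrix (act M p) = M * colsMatrix p := by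
  ext i j
  fin_cases i <;> fin_cases j <;>
    simp [colsMatrix, act_apply, Matrix.mul_apply, Matrix.mulVec_eq_sum, mul_comm]

lemma continuous_colsMatrix : Continuous colsMatrix := by
  refine continuous_matrix fun i j => ?_
  fin_cases i <;> fin_cases j <;> simp only [colsMatrix] <;> fun_prop

/-- The determinant of the matrix with given columns. -/
def colsDet (p : Cols) : ℝ := (colsMatrix p).det

lemma continuous_colsDet : Continuous colsDet := continuous_colsMatrix.matrix_det

lemma colsDet_act (h : SL(2, ℝ)) (p : Cols) : colsDet (act h p) = colsDet p := by
  rw [colsDet, colsMatrix_act, Matrix.det_mul, Matrix.SpecialLinearGroup.det_coe, one_mul, colsDet]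

lemma measurePreserving_act (h : SL(2, ℝ)) :
    MeasurePreserving (act h) (volume : Measure Cols) volume := by
  have hcol : MeasurePreserving (Matrix.toLin' (h : Matrix (Fin 2) (Fin 2) ℝ)) volume volume := by
    refine ⟨(LinearMap.continuous_of_finiteDimensional _).measurable, ?_⟩
    rw [Real.map_matrix_volume_pi_eq_smul_volume_pi] <;> simp
  exact hcol.prod hcol

lemma measurableEmbedding_act (h : SL(2, ℝ)) : MeasurableEmbedding (act h) :=
  (act h).continuous.measurableEmbedding (Function.LeftInverse.injective (act_inv_act h))

/-- The matrix of given columns, scaled to determinant one. -/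
def normalize (p : Cols) (hp : 0 < colsDet p) : SL(2, ℝ) :=
  ⟨(√(colsDet p))⁻¹ • colsMatrix p, by
    rw [Matrix.det_smul, Fintype.card_fin, inv_pow, Real.sq_sqrt hp.le]
    exact inv_mul_cancel₀ hp.ne'⟩

lemma coe_normalize (p : Cols) (hp : 0 < colsDet p) :
    (normalize p hp : Matrix (Fin 2) (Fin 2) ℝ) = (√(colsDet p))⁻¹ • colsMatrix p := rfl

lemma normalize_act (h : SL(2, ℝ)) {p : Cols} (hp : 0 < colsDet p)
    (hp' : 0 < colsDet (act h p)) : normalize (act h p) hp' = h * normalize p hp := by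
  refine Subtype.ext ?_
  simp only [coe_normalize, colsDet_act, colsMatrix_act, Matrix.SpecialLinearGroup.coe_mul,
    Matrix.mul_smul]

/-- The class in `PSL₂(ℝ)` of a matrix of positive determinant, with the junk value `1` at the
other matrices. -/
def toPSL (p : Cols) : PSL(2, ℝ) := if hp : 0 < colsDet p then proj (normalize p hp) else 1

lemma toPSL_act (h : SL(2, ℝ)) {p : Cols} (hp : 0 < colsDet p) :
    toPSL (act h p) = proj h * toPSL p := by
  have hp' : 0 < colsDet (act h p) := by rwa [colsDet_act]
  rw [toPSL, toPSL, dif_pos hp, dif_pos hp', normalize_act h hp, map_mul]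

lemma continuousAt_toPSL {p : Cols} (hp : 0 < colsDet p) : ContinuousAt toPSL p := by
  have hopen : IsOpen {q : Cols | 0 < colsDet q} := isOpen_lt continuous_const continuous_colsDet
  suffices ContinuousOn toPSL {q : Cols | 0 < colsDet q} from
    this.continuousAt (hopen.mem_nhds hp)
  have hnormalize : Continuous fun q : {q : Cols | 0 < colsDet q} => normalize q q.2 :=
    Continuous.subtype_mk
      (((continuous_colsDet.comp continuous_subtype_val).sqrt.inv₀
        fun q => (Real.sqrt_pos.2 q.2).ne').smul
        (continuous_colsMatrix.comp continuous_subtype_val)) _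
  rw [continuousOn_iff_continuous_domRestrict]
  exact (continuous_proj.comp hnormalize).congr fun q => by
    rw [Function.comp_apply, Set.domRestrict_apply, toPSL, dif_pos]

/-- Test functions on the matrices of positive determinant. -/
structure IsTest (f : Cols → ℝ) : Prop where
  contDiff : ContDiff ℝ ∞ f
  hasCompactSupport : HasCompactSupport f
  tsupport_subset : tsupport f ⊆ {p | 0 < colsDet p}

lemma IsTest.colsDet_pos {f : Cols → ℝ} (hf : IsTest f) {p : Cols} (hp : f p ≠ 0) :
    0 < colsDet p := hf.tsupport_subset (subset_tsupport f hp)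

lemma IsTest.integrable {f : Cols → ℝ} (hf : IsTest f) : Integrable f :=
  hf.contDiff.continuous.integrable_of_hasCompactSupport hf.hasCompactSupport

/-- The derivative of a function of a matrix along infinitesimal left translation by `X`. -/
def lieDeriv (X : sl2) (f : Cols → ℝ) (p : Cols) : ℝ := -fderiv ℝ f p (act X p)

lemma lieDeriv_eq_zero (X : sl2) {f : Cols → ℝ} {p : Cols} (hp : p ∉ tsupport f) :
    lieDeriv X f p = 0 := by
  have hfderiv : fderiv ℝ f p = 0 :=
    image_eq_zero_of_notMem_tsupport fun h => hp (tsupport_fderiv_subset ℝ h)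
  rw [lieDeriv, hfderiv, _root_.zero_apply, neg_zero]

lemma tsupport_lieDeriv_subset (X : sl2) (f : Cols → ℝ) : tsupport (lieDeriv X f) ⊆ tsupport f :=
  closure_minimal (fun _ hp => not_imp_comm.1 (lieDeriv_eq_zero X) hp) (isClosed_tsupport f)

lemma IsTest.lieDeriv {f : Cols → ℝ} (hf : IsTest f) (X : sl2) : IsTest (lieDeriv X f) where
  contDiff := ((hf.contDiff.fderiv_right (m := ∞) (by simp)).clm_apply (act X).contDiff).neg
  hasCompactSupport :=
    hf.hasCompactSupport.of_isClosed_subset (isClosed_tsupport _) (tsupport_lieDeriv_subset X f)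
  tsupport_subset := (tsupport_lieDeriv_subset X f).trans hf.tsupport_subset

lemma lieDeriv_add_smul (a b : ℝ) (X Y : sl2) (f : Cols → ℝ) :
    lieDeriv (a • X + b • Y) f = a • lieDeriv X f + b • lieDeriv Y f := by
  funext p
  simp only [lieDeriv, Pi.add_apply, Pi.smul_apply, smul_eq_mul]
  push_cast
  simp only [map_add, map_smul, _root_.add_apply, _root_.smul_apply,
    smul_eq_mul]
  ring

lemma lieDeriv_lieDeriv {f : Cols → ℝ} (hf : ContDiff ℝ 2 f) (X Y : sl2) (p : Cols) :
    lieDeriv X (lieDeriv Y f) p =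
      fderiv ℝ (fderiv ℝ f) p (act X p) (act Y p) + fderiv ℝ f p (act Y (act X p)) := by
  have hdiff : Differentiable ℝ (fderiv ℝ f) :=
    (hf.fderiv_right (m := 1) (by norm_num)).differentiable one_ne_zero
  have hfderiv : HasFDerivAt (lieDeriv Y f) _ p :=
    ((hdiff p).hasFDerivAt.clm_apply (act (Y : Matrix (Fin 2) (Fin 2) ℝ)).hasFDerivAt).neg
  rw [lieDeriv, hfderiv.fderiv]
  simp only [_root_.neg_apply, _root_.add_apply, neg_neg,
    ContinuousLinearMap.comp_apply, ContinuousLinearMap.flip_apply]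
  exact add_comm _ _

lemma lieDeriv_lie {f : Cols → ℝ} (hf : ContDiff ℝ 2 f) (X Y : sl2) :
    lieDeriv ⁅X, Y⁆ f = lieDeriv X (lieDeriv Y f) - lieDeriv Y (lieDeriv X f) := by
  funext p
  have hsymm : IsSymmSndFDerivAt ℝ f p :=
    hf.contDiffAt.isSymmSndFDerivAt minSmoothness_of_isRCLikeNormedField.le
  rw [Pi.sub_apply, lieDeriv_lieDeriv hf, lieDeriv_lieDeriv hf, hsymm.eq, lieDeriv,
    LieAlgebra.SpecialLinear.sl_bracket, map_sub, _root_.sub_apply, act_mul,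
    act_mul, map_sub]
  ring

lemma hasDerivAt_comp_act_expS {f : Cols → ℝ} (hf : Differentiable ℝ f) (X : sl2) (p : Cols)
    (t : ℝ) : HasDerivAt (fun t => f (act (expS (-(t • X))) p))
      (lieDeriv X f (act (expS (-(t • X))) p)) t := by
  refine ((hf _).hasFDerivAt.comp_hasDerivAt t (hasDerivAt_act_expS X p t)).congr_deriv ?_
  rw [map_neg, lieDeriv]

lemma exists_isCompact_of_act_expS_mem {K : Set Cols} (hK : IsCompact K) (X : sl2) :
    ∃ L, IsCompact L ∧ ∀ t ∈ Set.Icc (-1 : ℝ) 1, ∀ p, act (expS (-(t • X))) p ∈ K → p ∈ L := by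
  refine ⟨(fun q : ℝ × Cols => act (expS (q.1 • X)) q.2) '' (Set.Icc (-1) 1 ×ˢ K),
    (isCompact_Icc.prod hK).image (continuous_act_expS X),
    fun t ht p hp => ⟨(t, act (expS (-(t • X))) p), ⟨ht, hp⟩, ?_⟩⟩
  have hinv := act_inv_act (expS (-(t • X))) p
  rwa [← expS_neg, neg_neg] at hinv

variable {V : Type*} [NormedAddCommGroup V] [InnerProductSpace ℂ V]

namespace UnitaryRep

lemma toHom_mul (π : UnitaryRep V) (g h : PSL(2, ℝ)) (u : V) :
    π.toHom (g * h) u = π.toHom g (π.toHom h u) := by rw [map_mul]; rfl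

lemma toHom_one (π : UnitaryRep V) (u : V) : π.toHom 1 u = u := by rw [map_one]; rfl

lemma toHom_inv_toHom (π : UnitaryRep V) (g : PSL(2, ℝ)) (u : V) :
    π.toHom g⁻¹ (π.toHom g u) = u := by rw [← toHom_mul, inv_mul_cancel, toHom_one]

lemma toHom_toHom_inv (π : UnitaryRep V) (g : PSL(2, ℝ)) (u : V) :
    π.toHom g (π.toHom g⁻¹ u) = u := by rw [← toHom_mul, mul_inv_cancel, toHom_one]

lemma toHom_real_smul (π : UnitaryRep V) (g : PSL(2, ℝ)) (c : ℝ) (u : V) :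
    π.toHom g (c • u) = c • π.toHom g u := by
  rw [← Complex.coe_smul, map_smul, Complex.coe_smul]

/-- The integrand `f(p) π(p) u` of a Gårding vector. -/
def weighted (π : UnitaryRep V) (f : Cols → ℝ) (u : V) (p : Cols) : V :=
  f p • π.toHom (toPSL p) u

/-- The Gårding vector `∫ f(p) π(p) u dp`. -/
def garding (π : UnitaryRep V) (f : Cols → ℝ) (u : V) : V := ∫ p, π.weighted f u p

lemma continuous_weighted (π : UnitaryRep V) {f : Cols → ℝ} (hf : IsTest f) (u : V) :
    Continuous (π.weighted f u) := by
  refine continuous_of_tsupport fun p hp => ?_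
  have hpos : 0 < colsDet p := hf.tsupport_subset (tsupport_smul_subset_left f _ hp)
  exact hf.contDiff.continuous.continuousAt.smul
    ((π.continuous_orbit u).continuousAt.comp (continuousAt_toPSL hpos))

lemma integrable_weighted (π : UnitaryRep V) {f : Cols → ℝ} (hf : IsTest f) (u : V) :
    Integrable (π.weighted f u) :=
  (π.continuous_weighted hf u).integrable_of_hasCompactSupport hf.hasCompactSupport.smul_right

lemma garding_add_smul (π : UnitaryRep V) {f g : Cols → ℝ} (hf : IsTest f) (hg : IsTest g)
    (a b : ℝ) (u : V) :
    π.garding (a • f + b • g) u = a • π.garding f u + b • π.garding g u := by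
  have hweighted : π.weighted (a • f + b • g) u = a • π.weighted f u + b • π.weighted g u := by
    funext p
    simp only [weighted, Pi.add_apply, Pi.smul_apply, smul_eq_mul, add_smul, mul_smul]
  rw [garding, hweighted, integral_add' ((π.integrable_weighted hf u).smul a)
    ((π.integrable_weighted hg u).smul b)]
  simp only [Pi.smul_apply]
  rw [integral_smul, integral_smul, garding, garding]

lemma smul_toHom_toPSL (π : UnitaryRep V) {f : Cols → ℝ} (hf : IsTest f) (u : V) (h : SL(2, ℝ))
    (p : Cols) : f (act h p) • π.toHom (toPSL p) u
      = π.toHom (proj h⁻¹) (π.weighted f u (act h p)) := by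
  rcases eq_or_ne (f (act h p)) 0 with h0 | h0
  · rw [weighted, h0, zero_smul, zero_smul, map_zero]
  · have hp : 0 < colsDet p := by
      rw [← colsDet_act h]
      exact hf.colsDet_pos h0
    rw [weighted, toPSL_act h hp, map_inv, toHom_real_smul, ← toHom_mul, inv_mul_cancel_left]

lemma continuous_comp_act_smul (π : UnitaryRep V) {f : Cols → ℝ} (hf : IsTest f) (u : V)
    (h : SL(2, ℝ)) : Continuous fun p => f (act h p) • π.toHom (toPSL p) u := by
  simp_rw [π.smul_toHom_toPSL hf u h]
  exact (π.toHom _).continuous.comp ((π.continuous_weighted hf u).comp (act _).continuous)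

variable [CompleteSpace V]

lemma toHom_inv_garding (π : UnitaryRep V) {f : Cols → ℝ} (hf : IsTest f) (u : V) (h : SL(2, ℝ)) :
    π.toHom (proj h⁻¹) (π.garding f u) = ∫ p, f (act h p) • π.toHom (toPSL p) u := by
  simp_rw [π.smul_toHom_toPSL hf u h]
  rw [garding, ← (measurePreserving_act h).integral_comp (measurableEmbedding_act h)]
  exact ((π.toHom (proj h⁻¹)).toContinuousLinearEquiv.toContinuousLinearMap.integral_comp_comm
    ((measurePreserving_act h).integrable_comp_of_integrable (π.integrable_weighted hf u))).symm

lemma toHom_expG_garding (π : UnitaryRep V) {f : Cols → ℝ} (hf : IsTest f) (u : V) (X : sl2) :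
    π.toHom (expG X) (π.garding f u) = ∫ p, f (act (expS (-X)) p) • π.toHom (toPSL p) u := by
  rw [← π.toHom_inv_garding hf, ← expS_neg, neg_neg, expG_eq_proj_expS]

lemma hasDerivAt_garding (π : UnitaryRep V) {f : Cols → ℝ} (hf : IsTest f) (u : V) (X : sl2) :
    HasDerivAt (fun t : ℝ => π.toHom (expG (t • X)) (π.garding f u))
      (π.garding (lieDeriv X f) u) 0 := by
  obtain ⟨C, hC⟩ := (hf.lieDeriv X).contDiff.continuous.bounded_above_of_compact_support
    (hf.lieDeriv X).hasCompactSupport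
  obtain ⟨L, hL, hmem⟩ := exists_isCompact_of_act_expS_mem hf.hasCompactSupport.isCompact X
  have hact (p : Cols) : act (expS (-((0 : ℝ) • X))) p = p := by
    rw [zero_smul, neg_zero, expS_zero, Matrix.SpecialLinearGroup.coe_one, map_one,
      one_apply_eq_self]
  have hbound (p : Cols) (t : ℝ) (ht : t ∈ Metric.ball (0 : ℝ) 1) :
      ‖lieDeriv X f (act (expS (-(t • X))) p) • π.toHom (toPSL p) u‖
        ≤ L.indicator (fun _ => C * ‖u‖) p := by
    rw [norm_smul, LinearIsometryEquiv.norm_map]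
    by_cases hp : p ∈ L
    · rw [Set.indicator_of_mem hp]
      gcongr
      exact hC _
    · rw [Real.ball_eq_Ioo, zero_sub, zero_add] at ht
      rw [Set.indicator_of_notMem hp, lieDeriv_eq_zero X
        fun h => hp (hmem t (Set.Ioo_subset_Icc_self ht) p h), norm_zero, zero_mul]
  have hderiv := (hasDerivAt_integral_of_dominated_loc_of_deriv_le (μ := volume)
    (Metric.ball_mem_nhds (0 : ℝ) one_pos)
    (.of_forall fun t => (π.continuous_comp_act_smul hf u (expS (-(t • X)))).aestronglyMeasurable)
    (by simpa only [hact] using! π.integrable_weighted hf u)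
    (π.continuous_comp_act_smul (hf.lieDeriv X) u (expS (-((0 : ℝ) • X)))).aestronglyMeasurable
    (.of_forall hbound)
    ((integrable_indicator_iff hL.measurableSet).2 (integrableOn_const hL.measure_lt_top.ne))
    (.of_forall fun p t _ => (hasDerivAt_comp_act_expS
      (hf.contDiff.differentiable (by simp)) X p t).smul_const (π.toHom (toPSL p) u))).2
  simp only [hact, ← π.toHom_expG_garding hf] at hderiv
  exact hderiv

lemma garding_mem_smooth (π : UnitaryRep V) {f : Cols → ℝ} (hf : IsTest f) (u : V) :
    π.garding f u ∈ π.smooth := by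
  refine (Submodule.mem_iInf _).2 fun n => ?_
  induction n generalizing f with
  | zero => exact Submodule.mem_top
  | succ n ih => exact fun X => ⟨_, ih (hf.lieDeriv X), π.hasDerivAt_garding hf u X⟩

/-- A Gårding vector as a smooth vector. -/
def smoothGarding (π : UnitaryRep V) {f : Cols → ℝ} (hf : IsTest f) (u : V) : π.smooth :=
  ⟨π.garding f u, π.garding_mem_smooth hf u⟩

lemma coe_smoothGarding (π : UnitaryRep V) {f : Cols → ℝ} (hf : IsTest f) (u : V) :
    (π.smoothGarding hf u : V) = π.garding f u := rfl

lemma dpi_smoothGarding (π : UnitaryRep V) {f : Cols → ℝ} (hf : IsTest f) (u : V) (X : sl2) :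
    π.dpi X (π.smoothGarding hf u) = π.smoothGarding (hf.lieDeriv X) u :=
  Subtype.ext (π.hasDerivAt_garding hf u X).deriv

lemma norm_garding_sub_le (π : UnitaryRep V) {f : Cols → ℝ} (hf : IsTest f) (hf0 : 0 ≤ f)
    (hint : ∫ p, f p = 1) {u : V} {ε : ℝ}
    (hnear : ∀ p ∈ tsupport f, ‖π.toHom (toPSL p) u - u‖ ≤ ε) : ‖π.garding f u - u‖ ≤ ε := by
  have hsub : π.garding f u - u = ∫ p, (π.weighted f u p - f p • u) := by
    rw [integral_sub (π.integrable_weighted hf u) (hf.integrable.smul_const u), integral_smul_const,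
      hint, one_smul, garding]
  have hε : ∫ p, f p * ε = ε := by rw [integral_mul_const, hint, one_mul]
  rw [hsub, ← hε]
  refine norm_integral_le_of_norm_le (hf.integrable.mul_const ε) (.of_forall fun p => ?_)
  rw [weighted, ← smul_sub, norm_smul, Real.norm_of_nonneg (hf0 p)]
  by_cases hp : p ∈ tsupport f
  · exact mul_le_mul_of_nonneg_left (hnear p hp) (hf0 p)
  · rw [image_eq_zero_of_notMem_tsupport hp, zero_mul, zero_mul]

lemma exists_norm_garding_sub_le (π : UnitaryRep V) (u : V) {ε : ℝ} (hε : 0 < ε) :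
    ∃ f, IsTest f ∧ ‖π.garding f u - u‖ ≤ ε := by
  set e : Cols := (![1, 0], ![0, 1]) with he
  have hmatrix : colsMatrix e = 1 := by simp [colsMatrix, he, Matrix.one_fin_two]
  have hdet : colsDet e = 1 := by rw [colsDet, hmatrix, Matrix.det_one]
  have hdet_pos : 0 < colsDet e := hdet ▸ one_pos
  have hone : toPSL e = 1 := by
    rw [toPSL, dif_pos hdet_pos, ← map_one proj]
    exact congrArg proj (Subtype.ext (by simp [coe_normalize, hdet, hmatrix]))
  have hpos : ∀ᶠ p in 𝓝 e, 0 < colsDet p :=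
    continuous_colsDet.continuousAt.eventually_const_lt hdet_pos
  have hnear : ∀ᶠ p in 𝓝 e, ‖π.toHom (toPSL p) u - u‖ < ε := by
    have hcont : ContinuousAt (fun p => π.toHom (toPSL p) u) e :=
      (π.continuous_orbit u).continuousAt.comp (continuousAt_toPSL hdet_pos)
    simpa only [hone, toHom_one, dist_eq_norm] using Metric.continuousAt_iff'.1 hcont ε hε
  obtain ⟨δ, hδ, hball⟩ := Metric.eventually_nhds_iff_ball.1 (hpos.and hnear)
  let b : ContDiffBump e := ⟨δ / 4, δ / 2, by positivity, by linarith⟩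
  have hsupport : tsupport (b.normed volume) ⊆ Metric.ball e δ := by
    rw [b.tsupport_normed_eq]
    exact Metric.closedBall_subset_ball (half_lt_self hδ)
  have hb : IsTest (b.normed volume) :=
    ⟨b.contDiff_normed, b.hasCompactSupport_normed, fun p hp => (hball p (hsupport hp)).1⟩
  exact ⟨_, hb, π.norm_garding_sub_le hb b.nonneg_normed b.integral_normed
    fun p hp => (hball p (hsupport hp)).2.le⟩

lemma dense_range_garding (π : UnitaryRep V) :
    Dense {u | ∃ f, IsTest f ∧ ∃ y, π.garding f y = u} := by
  intro u
  refine Metric.mem_closure_iff.2 fun ε hε => ?_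
  obtain ⟨f, hf, hle⟩ := π.exists_norm_garding_sub_le u (half_pos hε)
  refine ⟨π.garding f u, ⟨f, hf, u, rfl⟩, ?_⟩
  rw [dist_comm, dist_eq_norm]
  exact hle.trans_lt (half_lt_self hε)

lemma dense_smooth (π : UnitaryRep V) : Dense (π.smooth : Set V) :=
  π.dense_range_garding.mono (by rintro _ ⟨f, hf, y, rfl⟩; exact π.garding_mem_smooth hf y)

lemma ext_inner_garding (π : UnitaryRep V) {u v : V}
    (h : ∀ f, IsTest f → ∀ y, inner ℂ u (π.garding f y) = inner ℂ v (π.garding f y)) : u = v := by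
  refine ext_inner_right ℂ fun w => ?_
  refine congrFun (Continuous.ext_on π.dense_range_garding (f := fun w => inner ℂ u w)
    (g := fun w => inner ℂ v w) (by fun_prop) (by fun_prop) ?_) w
  rintro _ ⟨f, hf, y, rfl⟩
  exact h f hf y

end UnitaryRep

end Garding

/-! ### Commutation relations -/

section Relations

open scoped InnerProductSpace
open MeasureTheory

lemma lie_Xi_Bg : ⁅Xi, Bg⁆ = Hg := by
  refine Subtype.ext ?_
  rw [LieAlgebra.SpecialLinear.sl_bracket]
  ext i j
  fin_cases i <;> fin_cases j <;> norm_num [Xi, Hg, Bg]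

lemma lie_Hg_Bg : ⁅Hg, Bg⁆ = Xi := by
  refine Subtype.ext ?_
  rw [LieAlgebra.SpecialLinear.sl_bracket]
  ext i j
  fin_cases i <;> fin_cases j <;> norm_num [Xi, Hg, Bg]

lemma exists_eq_smul_add_smul_add_smul (X : sl2) :
    ∃ a b c : ℝ, X = a • Xi + (b • Hg + c • Bg) := by
  obtain ⟨X, hX⟩ := X
  have htrace := (mem_sl2_iff X).1 hX
  refine ⟨X 0 1 - X 1 0, 2 * X 0 0, X 0 1 + X 1 0, ?_⟩
  ext i j
  fin_cases i <;> fin_cases j <;> simp [Xi, Hg, Bg] <;> linarith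

namespace UnitaryRep

variable {V : Type*} [NormedAddCommGroup V] [InnerProductSpace ℂ V]

lemma inner_toHom_left (π : UnitaryRep V) (g : PSL(2, ℝ)) (u v : V) :
    ⟪π.toHom g u, v⟫_ℂ = ⟪u, π.toHom g⁻¹ v⟫_ℂ := by
  conv_lhs => rw [← π.toHom_toHom_inv g v, LinearIsometryEquiv.inner_map_map]

lemma hasDerivAt_dpi (π : UnitaryRep V) (X : sl2) (u : π.smooth) :
    HasDerivAt (fun t : ℝ => π.toHom (expG (t • X)) (u : V)) (π.dpi X u) 0 :=
  π.hasDerivAt_of_smooth X u.2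

lemma dpi_eq_of_hasDerivAt (π : UnitaryRep V) {X : sl2} {u w : π.smooth}
    (h : HasDerivAt (fun t : ℝ => π.toHom (expG (t • X)) (u : V)) w 0) : π.dpi X u = w :=
  Subtype.ext h.deriv

lemma hasDerivAt_toHom_comp (π : UnitaryRep V) (g : PSL(2, ℝ)) {f : ℝ → V} {w : V} {t : ℝ}
    (h : HasDerivAt f w t) : HasDerivAt (fun s => π.toHom g (f s)) (π.toHom g w) t :=
  ((π.toHom g).toContinuousLinearEquiv.toContinuousLinearMap.restrictScalars
    ℝ).hasFDerivAt.comp_hasDerivAt t h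

lemma hasDerivAt_orbit (π : UnitaryRep V) (X : sl2) (u : π.smooth) (t : ℝ) :
    HasDerivAt (fun t : ℝ => π.toHom (expG (t • X)) (u : V))
      (π.toHom (expG (t • X)) (π.dpi X u)) t := by
  have hzero : HasDerivAt (fun s : ℝ => π.toHom (expG (s • X)) (u : V)) (π.dpi X u) (t - t) :=
    (sub_self t).symm ▸ π.hasDerivAt_dpi X u
  have htranslate := π.hasDerivAt_toHom_comp (expG (t • X)) (hzero.comp_sub_const t t)
  refine htranslate.congr_of_eventuallyEq (.of_forall fun s => ?_)
  simp only [← toHom_mul, ← expG_add_smul, add_sub_cancel]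

lemma toHom_mem_diffVectors (π : UnitaryRep V) (h : SL(2, ℝ)) (n : ℕ) {u : V}
    (hu : u ∈ π.diffVectors n) : π.toHom (proj h) u ∈ π.diffVectors n := by
  induction n generalizing u with
  | zero => exact Submodule.mem_top
  | succ n ih =>
    intro X
    obtain ⟨w, hw, hderiv⟩ := hu (Ad h⁻¹ X)
    refine ⟨_, ih hw, (π.hasDerivAt_toHom_comp (proj h) hderiv).congr_of_eventuallyEq
      (.of_forall fun t => ?_)⟩
    have hconj : expG (t • X) * proj h = proj h * expG (t • Ad h⁻¹ X) := by
      have := proj_mul_expG_smul h⁻¹ t X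
      rw [map_inv] at this
      rw [← inv_mul_eq_iff_eq_mul, ← mul_assoc, this, inv_mul_cancel_right]
    simp only [← toHom_mul, hconj]

lemma toHom_mem_smooth (π : UnitaryRep V) (h : SL(2, ℝ)) {u : V} (hu : u ∈ π.smooth) :
    π.toHom (proj h) u ∈ π.smooth :=
  (Submodule.mem_iInf _).2 fun n => π.toHom_mem_diffVectors h n ((Submodule.mem_iInf _).1 hu n)

/-- The action of a lift to `SL₂(ℝ)` of a group element on the smooth vectors. -/
def toHomS (π : UnitaryRep V) (h : SL(2, ℝ)) (u : π.smooth) : π.smooth :=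
  ⟨π.toHom (proj h) u, π.toHom_mem_smooth h u.2⟩

lemma coe_toHomS (π : UnitaryRep V) (h : SL(2, ℝ)) (u : π.smooth) :
    (π.toHomS h u : V) = π.toHom (proj h) u := rfl

lemma dpi_Ad (π : UnitaryRep V) (h : SL(2, ℝ)) (X : sl2) (u : π.smooth) :
    π.dpi (Ad h X) (π.toHomS h u) = π.toHomS h (π.dpi X u) := by
  refine π.dpi_eq_of_hasDerivAt <|
    (π.hasDerivAt_toHom_comp (proj h) (π.hasDerivAt_dpi X u)).congr_of_eventuallyEq
      (.of_forall fun t => ?_)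
  simp only [coe_toHomS, ← toHom_mul, proj_mul_expG_smul]

lemma dpi_toHomS_expS (π : UnitaryRep V) (X : sl2) (t : ℝ) (u : π.smooth) :
    π.dpi X (π.toHomS (expS (t • X)) u) = π.toHomS (expS (t • X)) (π.dpi X u) := by
  refine π.dpi_eq_of_hasDerivAt <|
    (π.hasDerivAt_toHom_comp (expG (t • X)) (π.hasDerivAt_dpi X u)).congr_of_eventuallyEq
      (.of_forall fun s => ?_)
  simp only [coe_toHomS, ← expG_eq_proj_expS, ← toHom_mul, ← expG_add_smul, add_comm]

lemma inner_dpi_left (π : UnitaryRep V) (X : sl2) (u v : π.smooth) :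
    ⟪(π.dpi X u : V), v⟫_ℂ = -⟪(u : V), π.dpi X v⟫_ℂ := by
  have hderiv := (π.hasDerivAt_dpi X u).inner ℂ (π.hasDerivAt_dpi X v)
  simp only [LinearIsometryEquiv.inner_map_map, zero_smul, expG_zero, toHom_one] at hderiv
  have hsum := hderiv.unique (hasDerivAt_const (0 : ℝ) (⟪(u : V), v⟫_ℂ))
  exact eq_neg_of_add_eq_zero_right hsum

lemma inner_dpi_right (π : UnitaryRep V) (X : sl2) (u v : π.smooth) :
    ⟪(u : V), π.dpi X v⟫_ℂ = -⟪(π.dpi X u : V), v⟫_ℂ := by rw [inner_dpi_left, neg_neg]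

lemma hasDerivAt_inner_orbit_of_weak (π : UnitaryRep V) (X : sl2) {u w : V}
    (h : ∀ v : π.smooth, ⟪w, v⟫_ℂ = -⟪u, π.dpi X v⟫_ℂ) (v : π.smooth) (t : ℝ) :
    HasDerivAt (fun t : ℝ => ⟪π.toHom (expG (t • X)) u, v⟫_ℂ)
      ⟪π.toHom (expG (t • X)) w, v⟫_ℂ t := by
  have hinv : ∀ (s : ℝ) (y z : V),
      ⟪π.toHom (expG (s • X)) y, z⟫_ℂ = ⟪y, π.toHom (expG ((-s) • X)) z⟫_ℂ := fun s y z => by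
    rw [inner_toHom_left, ← expG_neg, neg_smul]
  have horbit : HasDerivAt (fun s : ℝ => π.toHom (expG ((-s) • X)) (v : V))
      (-π.toHom (expG ((-t) • X)) (π.dpi X v)) t := by
    simpa only [neg_one_smul] using! (π.hasDerivAt_orbit X v (-t)).scomp t (hasDerivAt_neg t)
  have hweak := h (π.toHomS (expS ((-t) • X)) v)
  rw [dpi_toHomS_expS, coe_toHomS, coe_toHomS, ← expG_eq_proj_expS] at hweak
  simp only [hinv]
  simpa only [hweak, inner_zero_left, add_zero, inner_neg_right]
    using (hasDerivAt_const t u).inner ℂ horbit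

variable [CompleteSpace V]

lemma ext_inner_smoothGarding (π : UnitaryRep V) {u v : π.smooth}
    (h : ∀ f (hf : IsTest f) (y : V),
      ⟪(u : V), π.smoothGarding hf y⟫_ℂ = ⟪(v : V), π.smoothGarding hf y⟫_ℂ) : u = v :=
  Subtype.ext (π.ext_inner_garding h)

lemma inner_dpi_smoothGarding (π : UnitaryRep V) (X : sl2) (u : π.smooth) {f : Cols → ℝ}
    (hf : IsTest f) (y : V) :
    ⟪(π.dpi X u : V), π.smoothGarding hf y⟫_ℂ
      = -⟪(u : V), π.smoothGarding (hf.lieDeriv X) y⟫_ℂ := by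
  rw [inner_dpi_left, dpi_smoothGarding]

lemma dpi_add_smul (π : UnitaryRep V) (a b : ℝ) (X Y : sl2) (u : π.smooth) :
    π.dpi (a • X + b • Y) u = (a : ℂ) • π.dpi X u + (b : ℂ) • π.dpi Y u := by
  refine π.ext_inner_smoothGarding fun f hf y => ?_
  simp only [Submodule.coe_add, Submodule.coe_smul, inner_add_left, inner_smul_left,
    Complex.conj_ofReal, inner_dpi_smoothGarding]
  simp only [coe_smoothGarding, lieDeriv_add_smul,
    π.garding_add_smul (hf.lieDeriv X) (hf.lieDeriv Y), inner_add_right, ← Complex.coe_smul,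
    inner_smul_right]
  ring

lemma dpi_lie (π : UnitaryRep V) (X Y : sl2) (u : π.smooth) :
    π.dpi ⁅X, Y⁆ u = π.dpi X (π.dpi Y u) - π.dpi Y (π.dpi X u) := by
  refine π.ext_inner_smoothGarding fun f hf y => ?_
  have hlie : lieDeriv ⁅X, Y⁆ f
      = (1 : ℝ) • lieDeriv X (lieDeriv Y f) + (-1 : ℝ) • lieDeriv Y (lieDeriv X f) := by
    rw [lieDeriv_lie (contDiff_infty.1 hf.contDiff 2), one_smul, neg_one_smul, sub_eq_add_neg]
  simp only [Submodule.coe_sub, inner_sub_left, inner_dpi_smoothGarding]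
  rw [coe_smoothGarding, coe_smoothGarding, coe_smoothGarding, hlie,
    π.garding_add_smul ((hf.lieDeriv Y).lieDeriv X) ((hf.lieDeriv X).lieDeriv Y), one_smul,
    neg_one_smul, inner_add_right, inner_neg_right]
  ring

lemma orbit_eq_integral_add_of_weak (π : UnitaryRep V) (X : sl2) {u w : V}
    (h : ∀ v : π.smooth, ⟪w, v⟫_ℂ = -⟪u, π.dpi X v⟫_ℂ) (t : ℝ) :
    π.toHom (expG (t • X)) u = (∫ s in (0 : ℝ)..t, π.toHom (expG (s • X)) w) + u := by
  have hcont : Continuous fun t : ℝ => π.toHom (expG (t • X)) w :=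
    (π.continuous_orbit w).comp (continuous_expG_smul X)
  refine π.dense_smooth.eq_of_inner_left (𝕜 := ℂ) fun v hv => ?_
  have hderiv (s : ℝ) : HasDerivAt (fun s : ℝ => ⟪π.toHom (expG (s • X)) u, v⟫_ℂ
      - ⟪∫ r in (0 : ℝ)..s, π.toHom (expG (r • X)) w, v⟫_ℂ) 0 s := by
    simpa only [inner_zero_right, zero_add, sub_self] using!
      (π.hasDerivAt_inner_orbit_of_weak X h ⟨v, hv⟩ s).sub
        ((hcont.integral_hasStrictDerivAt 0 s).hasDerivAt.inner ℂ (hasDerivAt_const s v))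
  have hconst := is_const_of_deriv_eq_zero (fun s => (hderiv s).differentiableAt)
    (fun s => (hderiv s).deriv) t 0
  simp only [intervalIntegral.integral_same, zero_smul, expG_zero, toHom_one,
    inner_zero_left, sub_zero] at hconst
  rw [inner_add_left, ← hconst, add_sub_cancel]

lemma hasDerivAt_of_weak (π : UnitaryRep V) (X : sl2) {u w : V}
    (h : ∀ v : π.smooth, ⟪w, v⟫_ℂ = -⟪u, π.dpi X v⟫_ℂ) :
    HasDerivAt (fun t : ℝ => π.toHom (expG (t • X)) u) w 0 := by
  have hcont : Continuous fun t : ℝ => π.toHom (expG (t • X)) w :=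
    (π.continuous_orbit w).comp (continuous_expG_smul X)
  have hderiv := (hcont.integral_hasStrictDerivAt 0 0).hasDerivAt.add_const u
  rw [zero_smul, expG_zero, toHom_one] at hderiv
  exact hderiv.congr_of_eventuallyEq (.of_forall (π.orbit_eq_integral_add_of_weak X h))

end UnitaryRep

end Relations

/-! ### Weight spaces -/

section KTypes

open scoped InnerProductSpace
open MeasureTheory Complex

lemma eq_zero_of_fourierCoeff_eq_zero {T : ℝ} [Fact (0 < T)] {f : C(AddCircle T, ℂ)}
    (hf : ∀ k, fourierCoeff f k = 0) : f = 0 := by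
  have hsummable : Summable (fourierCoeff f) := summable_zero.congr fun k => (hf k).symm
  have hsum := hasSum_fourier_series_of_summable hsummable
  simp only [hf, zero_smul] at hsum
  exact hsum.unique hasSum_zero

lemma eq_zero_of_periodic_of_integral_eq_zero {f : ℝ → ℂ} (hf : Continuous f)
    (hperiodic : Function.Periodic f (2 * Real.pi))
    (h : ∀ k : ℤ, ∫ t in (0 : ℝ)..2 * Real.pi, exp (-(k * t) * I) * f t = 0) : f = 0 := by
  have : Fact (0 < 2 * Real.pi) := ⟨Real.two_pi_pos⟩
  let F : C(AddCircle (2 * Real.pi), ℂ) := ⟨hperiodic.lift, continuous_coinduced_dom.2 hf⟩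
  have hF (t : ℝ) : F (t : AddCircle (2 * Real.pi)) = f t := rfl
  have hcoeff (k : ℤ) : fourierCoeff F k = 0 := by
    have hintegrand (t : ℝ) : fourier (-k) (t : AddCircle (2 * Real.pi)) • F t
        = exp (-(k * t) * I) * f t := by
      rw [fourier_coe_apply, smul_eq_mul, hF]
      congr 2
      have : (Real.pi : ℂ) ≠ 0 := mod_cast Real.pi_ne_zero
      push_cast
      field_simp
    simp_rw [fourierCoeff_eq_intervalIntegral _ k 0, zero_add, hintegrand, h k, smul_zero]
  funext t
  rw [← hF, eq_zero_of_fourierCoeff_eq_zero hcoeff, ContinuousMap.zero_apply, Pi.zero_apply]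

namespace UnitaryRep

variable {V : Type*} [NormedAddCommGroup V] [InnerProductSpace ℂ V]

/-- The action `π(exp tΞ)` of the rotation group, with the period normalised to `2π`. -/
def rot (π : UnitaryRep V) (t : ℝ) : V ≃ₗᵢ[ℂ] V := π.toHom (expG (t • Xi))

lemma rot_add (π : UnitaryRep V) (s t : ℝ) (u : V) : π.rot (s + t) u = π.rot s (π.rot t u) := by
  simp only [rot, expG_add_smul, toHom_mul]

lemma rot_zero (π : UnitaryRep V) (u : V) : π.rot 0 u = u := by
  rw [rot, zero_smul, expG_zero, toHom_one]

lemma rot_two_pi (π : UnitaryRep V) (u : V) : π.rot (2 * Real.pi) u = u := by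
  rw [rot, expG_two_pi_smul_Xi, toHom_one]

lemma continuous_rot (π : UnitaryRep V) (u : V) : Continuous fun t => π.rot t u :=
  (π.continuous_orbit u).comp (continuous_expG_smul Xi)

lemma inner_rot_left (π : UnitaryRep V) (t : ℝ) (u v : V) :
    ⟪π.rot t u, v⟫_ℂ = ⟪u, π.rot (-t) v⟫_ℂ := by
  rw [rot, inner_toHom_left, rot, neg_smul, expG_neg]

/-- The Fourier integrand `e^{-ikt} π(exp tΞ) u`. -/
def mode (π : UnitaryRep V) (k : ℤ) (u : V) (t : ℝ) : V := exp (-(k * t) * I) • π.rot t u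

lemma continuous_mode (π : UnitaryRep V) (k : ℤ) (u : V) : Continuous (π.mode k u) :=
  Continuous.smul (by fun_prop) (π.continuous_rot u)

lemma norm_mode (π : UnitaryRep V) (k : ℤ) (u : V) (t : ℝ) : ‖π.mode k u t‖ = ‖u‖ := by
  have hphase : -((k : ℂ) * t) * I = ((-(k * t) : ℝ) : ℂ) * I := by push_cast; ring
  rw [mode, norm_smul, LinearIsometryEquiv.norm_map, hphase, norm_exp_ofReal_mul_I, one_mul]

lemma mode_add (π : UnitaryRep V) (k : ℤ) (u v : V) (t : ℝ) :
    π.mode k (u + v) t = π.mode k u t + π.mode k v t := by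
  simp only [mode, map_add, smul_add]

lemma mode_smul (π : UnitaryRep V) (k : ℤ) (c : ℂ) (u : V) (t : ℝ) :
    π.mode k (c • u) t = c • π.mode k u t := by
  simp only [mode, map_smul, smul_comm c]

lemma mode_periodic (π : UnitaryRep V) (k : ℤ) (u : V) :
    Function.Periodic (π.mode k u) (2 * Real.pi) := by
  intro t
  have hphase : -((k : ℂ) * ((t + 2 * Real.pi : ℝ) : ℂ)) * I
      = -(k * t) * I + ((-k : ℤ) : ℂ) * (2 * Real.pi * I) := by push_cast; ring
  rw [mode, mode, rot_add, rot_two_pi, hphase, exp_add, exp_int_mul_two_pi_mul_I, mul_one]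

lemma mode_rot (π : UnitaryRep V) (k : ℤ) (u : V) (s t : ℝ) :
    π.mode k (π.rot s u) t = exp (k * s * I) • π.mode k u (t + s) := by
  rw [mode, mode, rot_add, smul_smul, ← exp_add]
  congr 2
  push_cast
  ring

lemma inner_mode_right (π : UnitaryRep V) (k : ℤ) (u v : V) (t : ℝ) :
    ⟪u, π.mode k v t⟫_ℂ = ⟪π.mode k u (-t), v⟫_ℂ := by
  rw [mode, mode, inner_smul_left, inner_smul_right, inner_rot_left, neg_neg, ← exp_conj]
  congr 2
  simp

lemma norm_integral_mode_le (π : UnitaryRep V) (k : ℤ) (u : V) :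
    ‖(1 / (2 * Real.pi) : ℂ) • ∫ t in (0 : ℝ)..2 * Real.pi, π.mode k u t‖ ≤ ‖u‖ := by
  have hintegral := intervalIntegral.norm_integral_le_of_norm_le_const (a := 0)
    (b := 2 * Real.pi) (f := π.mode k u) (C := ‖u‖) fun t _ => (π.norm_mode k u t).le
  rw [sub_zero, abs_of_pos Real.two_pi_pos] at hintegral
  have hnorm : ‖(1 / (2 * Real.pi) : ℂ)‖ = 1 / (2 * Real.pi) := by
    simp [abs_of_pos Real.pi_pos]
  rw [norm_smul, hnorm, one_div, inv_mul_le_iff₀ Real.two_pi_pos]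
  exact hintegral.trans_eq (mul_comm _ _)

/-- The projection onto the vectors of weight `k` under the rotation group. -/
def projK (π : UnitaryRep V) (k : ℤ) : V →L[ℂ] V :=
  LinearMap.mkContinuous
    { toFun := fun u => (1 / (2 * Real.pi) : ℂ) • ∫ t in (0 : ℝ)..2 * Real.pi, π.mode k u t
      map_add' := fun u v => by
        simp_rw [mode_add, ← smul_add]
        rw [intervalIntegral.integral_add ((π.continuous_mode k u).intervalIntegrable _ _)
          ((π.continuous_mode k v).intervalIntegrable _ _)]
      map_smul' := fun c u => by
        simp_rw [mode_smul, intervalIntegral.integral_smul, RingHom.id_apply, smul_comm c] }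
    1 fun u => by simpa only [one_mul] using! π.norm_integral_mode_le k u

lemma projK_apply (π : UnitaryRep V) (k : ℤ) (u : V) :
    π.projK k u = (1 / (2 * Real.pi) : ℂ) • ∫ t in (0 : ℝ)..2 * Real.pi, π.mode k u t := rfl

/-- The space of vectors of weight `k`, i.e. of vectors on which `exp tΞ` acts by `e^{ikt}`; it is
encoded as the space of fixed vectors of `projK k`. -/
def weightSpace (π : UnitaryRep V) (k : ℤ) : Submodule ℂ V :=
  (π.projK k - 1 : V →L[ℂ] V).ker

lemma mem_weightSpace (π : UnitaryRep V) (k : ℤ) (u : V) :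
    u ∈ π.weightSpace k ↔ π.projK k u = u := by
  simp [weightSpace, sub_eq_zero]

lemma projK_rot (π : UnitaryRep V) (k : ℤ) (s : ℝ) (u : V) :
    π.projK k (π.rot s u) = exp (k * s * I) • π.projK k u := by
  rw [projK_apply, projK_apply, smul_comm, ← intervalIntegral.integral_smul]
  simp_rw [mode_rot, intervalIntegral.integral_smul]
  rw [intervalIntegral.integral_comp_add_right (fun t => π.mode k u t), zero_add, add_comm,
    (π.mode_periodic k u).intervalIntegral_add_eq s 0, zero_add]

variable [CompleteSpace V]

lemma projK_eq_self (π : UnitaryRep V) (k : ℤ) {u : V}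
    (h : ∀ t, π.rot t u = exp (k * t * I) • u) : π.projK k u = u := by
  have hmode (t : ℝ) : π.mode k u t = u := by
    rw [mode, h, smul_smul, ← exp_add, neg_mul, neg_add_cancel, exp_zero, one_smul]
  have hpi : (Real.pi : ℂ) ≠ 0 := mod_cast Real.pi_ne_zero
  simp_rw [projK_apply, hmode]
  rw [intervalIntegral.integral_const, sub_zero, ← Complex.coe_smul, smul_smul]
  push_cast
  rw [one_div_mul_cancel (mul_ne_zero two_ne_zero hpi), one_smul]

lemma inner_projK_right_eq_integral (π : UnitaryRep V) (k : ℤ) (u v : V) :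
    ⟪u, π.projK k v⟫_ℂ
      = (1 / (2 * Real.pi) : ℂ) * ∫ t in (0 : ℝ)..2 * Real.pi, ⟪u, π.mode k v t⟫_ℂ := by
  rw [projK_apply, inner_smul_right]
  congr 1
  exact ((innerSL ℂ u).intervalIntegral_comp_comm
    ((π.continuous_mode k v).intervalIntegrable _ _)).symm

lemma inner_projK_right (π : UnitaryRep V) (k : ℤ) (u v : V) :
    ⟪u, π.projK k v⟫_ℂ = ⟪π.projK k u, v⟫_ℂ := by
  have hconj (f : ℝ → ℂ) : conj (∫ t in (0 : ℝ)..2 * Real.pi, f t)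
      = ∫ t in (0 : ℝ)..2 * Real.pi, conj (f t) := by
    simp only [intervalIntegral.integral_of_le Real.two_pi_pos.le, integral_conj]
  have hperiodic : Function.Periodic (fun t => ⟪π.mode k u t, v⟫_ℂ) (2 * Real.pi) := fun t => by
    simp only [π.mode_periodic k u t]
  have hreflect : ∫ t in (0 : ℝ)..2 * Real.pi, ⟪u, π.mode k v t⟫_ℂ
      = ∫ t in (0 : ℝ)..2 * Real.pi, ⟪π.mode k u t, v⟫_ℂ := by
    have hshift := hperiodic.intervalIntegral_add_eq (-(2 * Real.pi)) 0
    rw [neg_add_cancel, zero_add] at hshift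
    simp_rw [inner_mode_right]
    rw [intervalIntegral.integral_comp_neg (fun t => ⟪π.mode k u t, v⟫_ℂ), neg_zero, hshift]
  rw [← inner_conj_symm (π.projK k u), inner_projK_right_eq_integral, hreflect,
    inner_projK_right_eq_integral, map_mul, hconj]
  simp_rw [inner_conj_symm]
  rw [map_div₀, map_one, map_mul, conj_ofReal, map_ofNat]

lemma rot_projK (π : UnitaryRep V) (k : ℤ) (s : ℝ) (u : V) :
    π.rot s (π.projK k u) = exp (k * s * I) • π.projK k u := by
  refine ext_inner_left ℂ fun v => ?_
  rw [← neg_neg s, ← inner_rot_left, inner_projK_right, projK_rot, inner_smul_left,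
    inner_smul_right, inner_projK_right, ← exp_conj]
  simp

lemma projK_projK_self (π : UnitaryRep V) (k : ℤ) (u : V) :
    π.projK k (π.projK k u) = π.projK k u :=
  π.projK_eq_self k fun t => π.rot_projK k t u

lemma inner_projK_of_ne (π : UnitaryRep V) {j k : ℤ} (hjk : j ≠ k) (u v : V) :
    ⟪π.projK j u, π.projK k v⟫_ℂ = 0 := by
  set s : ℝ := Real.pi / (k - j) with hs
  have hphase : (starRingEnd ℂ) (j * s * I) + k * s * I = Real.pi * I := by
    have hkj : (k : ℂ) - j ≠ 0 := sub_ne_zero.2 (mod_cast hjk.symm)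
    simp only [map_mul, conj_I, conj_ofReal, hs, map_intCast]
    push_cast
    field_simp
    ring
  have hinvariant := (π.rot s).inner_map_map (π.projK j u) (π.projK k v)
  rw [rot_projK, rot_projK, inner_smul_left, inner_smul_right, ← mul_assoc, ← exp_conj,
    ← exp_add, hphase, exp_pi_mul_I, neg_one_mul] at hinvariant
  exact self_eq_neg.1 hinvariant.symm

lemma projK_projK_of_ne (π : UnitaryRep V) {j k : ℤ} (hjk : j ≠ k) (u : V) :
    π.projK j (π.projK k u) = 0 := by
  refine ext_inner_left ℂ fun v => ?_
  rw [inner_projK_right, inner_projK_of_ne π hjk, inner_zero_right]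

lemma eq_zero_of_projK_eq_zero (π : UnitaryRep V) {u : V} (h : ∀ k, π.projK k u = 0) : u = 0 := by
  have hcoeff (k : ℤ) :
      ∫ t in (0 : ℝ)..2 * Real.pi, exp (-(k * t) * I) * ⟪u, π.rot t u⟫_ℂ = 0 := by
    have hintegral := π.inner_projK_right_eq_integral k u u
    simp only [h k, inner_zero_right, mode, inner_smul_right] at hintegral
    exact (mul_eq_zero.1 hintegral.symm).resolve_left (by simp [Real.pi_ne_zero])
  have hzero := congrFun (eq_zero_of_periodic_of_integral_eq_zero
    (continuous_const.inner (π.continuous_rot u))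
    (fun t => by rw [rot_add, rot_two_pi]) hcoeff) 0
  rw [rot_zero] at hzero
  exact inner_self_eq_zero.1 hzero

lemma isHilbertSum_weightSpace (π : UnitaryRep V) :
    IsHilbertSum ℂ (fun k => π.weightSpace k) fun k => (π.weightSpace k).subtypeₗᵢ := by
  have (k : ℤ) : CompleteSpace (π.weightSpace k) :=
    (ContinuousLinearMap.isClosed_ker (π.projK k - 1)).completeSpace_coe
  refine IsHilbertSum.mkInternal _ (fun j k hjk u v => ?_) ?_
  · have hu := (π.mem_weightSpace j u).1 u.2
    have hv := (π.mem_weightSpace k v).1 v.2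
    rw [Submodule.coe_subtypeₗᵢ, Submodule.coe_subtypeₗᵢ, Submodule.subtype_apply,
      Submodule.subtype_apply, ← hu, ← hv, inner_projK_of_ne π hjk]
  · rw [top_le_iff, Submodule.topologicalClosure_eq_top_iff, Submodule.eq_bot_iff]
    refine fun w hw => π.eq_zero_of_projK_eq_zero fun k => ?_
    have hmem : π.projK k w ∈ ⨆ k, π.weightSpace k :=
      Submodule.mem_iSup_of_mem k ((π.mem_weightSpace k _).2 (π.projK_projK_self k w))
    have horth := (Submodule.mem_orthogonal _ _).1 hw _ hmem
    rw [← inner_self_eq_zero (𝕜 := ℂ), inner_projK_right, projK_projK_self, horth]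

lemma hasSum_projK (π : UnitaryRep V) (u : V) : HasSum (fun k : ℤ => π.projK k u) u := by
  have hH := π.isHilbertSum_weightSpace
  have hcomponent (k : ℤ) : π.projK k (hH.linearIsometryEquiv u k) = hH.linearIsometryEquiv u k :=
    (π.mem_weightSpace k _).1 (hH.linearIsometryEquiv u k).2
  have hsum := hH.hasSum_linearIsometryEquiv_symm (hH.linearIsometryEquiv u)
  simp only [LinearIsometryEquiv.symm_apply_apply, Submodule.coe_subtypeₗᵢ,
    Submodule.subtype_apply] at hsum
  convert hsum using 2 with k
  refine ((π.projK k).hasSum hsum).unique ?_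
  convert hasSum_single k fun j hj => ?_ using 1
  · exact (hcomponent k).symm
  · rw [← hcomponent j, projK_projK_of_ne π hj.symm]

lemma hasSum_inner_projK (π : UnitaryRep V) (u v : V) :
    HasSum (fun k : ℤ => ⟪π.projK k u, π.projK k v⟫_ℂ) ⟪u, v⟫_ℂ := by
  simpa only [← inner_projK_right, projK_projK_self]
    using! (innerSL ℂ u).hasSum (π.hasSum_projK v)

lemma hasSum_norm_sq_projK (π : UnitaryRep V) (u : V) :
    HasSum (fun k : ℤ => ‖π.projK k u‖ ^ 2) (‖u‖ ^ 2) := by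
  have h := Complex.reCLM.hasSum (π.hasSum_inner_projK u u)
  simpa [Function.comp_def, inner_self_eq_norm_sq_to_K, ← ofReal_pow] using h

end UnitaryRep

end KTypes

/-! ### Ladder operators -/

section Ladder

open scoped InnerProductSpace
open MeasureTheory Complex

namespace UnitaryRep

variable {V : Type*} [NormedAddCommGroup V] [InnerProductSpace ℂ V]

/-- The ladder operators `H + e i B`, `e = ±1`, which shift the weight by `e`. -/
def ladder (π : UnitaryRep V) (e : ℤ) : Module.End ℂ π.smooth :=
  π.dpi Hg + ((e : ℂ) * I) • π.dpi Bg

lemma ladder_apply (π : UnitaryRep V) (e : ℤ) (u : π.smooth) :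
    π.ladder e u = π.dpi Hg u + ((e : ℂ) * I) • π.dpi Bg u := rfl

lemma inner_ladder_left (π : UnitaryRep V) (e : ℤ) (u v : π.smooth) :
    ⟪(π.ladder e u : V), v⟫_ℂ = -⟪(u : V), π.ladder (-e) v⟫_ℂ := by
  simp only [ladder_apply, Submodule.coe_add, Submodule.coe_smul, inner_add_left, inner_add_right,
    inner_smul_left, inner_smul_right, inner_dpi_left, map_mul, conj_I, map_intCast]
  push_cast
  ring

lemma dpi_Hg_eq_ladder (π : UnitaryRep V) (u : π.smooth) :
    π.dpi Hg u = (1 / 2 : ℂ) • (π.ladder 1 u + π.ladder (-1) u) := by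
  simp only [ladder_apply]
  push_cast
  module

lemma dpi_Bg_eq_ladder (π : UnitaryRep V) (u : π.smooth) :
    π.dpi Bg u = (-I / 2 : ℂ) • (π.ladder 1 u - π.ladder (-1) u) := by
  have hsub : π.ladder 1 u - π.ladder (-1) u = (2 * I) • π.dpi Bg u := by
    simp only [ladder_apply]
    push_cast
    module
  have hI : -I / 2 * (2 * I) = 1 := by linear_combination -I_mul_I
  rw [hsub, smul_smul, hI, one_smul]

lemma norm_sq_Hg_add_norm_sq_Bg (π : UnitaryRep V) {lam : ℝ} (h : π.HasCasimirScalar lam)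
    (v : π.smooth) :
    ‖(π.dpi Hg v : V)‖ ^ 2 + ‖(π.dpi Bg v : V)‖ ^ 2
      = ‖(π.dpi Xi v : V)‖ ^ 2 + lam / 4 * ‖(v : V)‖ ^ 2 := by
  have hinner := congrArg (fun A : Module.End ℂ π.smooth => ⟪(v : V), (A v : V)⟫_ℂ) h
  have hsq (X : sl2) : ⟪(v : V), (π.dpi X ^ 2) v⟫_ℂ = -(‖(π.dpi X v : V)‖ : ℂ) ^ 2 := by
    rw [pow_two, Module.End.mul_apply, inner_dpi_right]
    exact congrArg Neg.neg (inner_self_eq_norm_sq_to_K _)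
  simp only [casimir, LinearMap.sub_apply, LinearMap.smul_apply, Module.End.one_apply,
    Submodule.coe_sub, Submodule.coe_smul, inner_sub_right, inner_smul_right, hsq,
    inner_self_eq_norm_sq_to_K, coe_algebraMap] at hinner
  have hreal : (4 : ℝ) * -(‖(π.dpi Xi v : V)‖ ^ 2) - 4 * -(‖(π.dpi Hg v : V)‖ ^ 2)
      - 4 * -(‖(π.dpi Bg v : V)‖ ^ 2) = lam * ‖(v : V)‖ ^ 2 := mod_cast hinner
  linarith

variable [CompleteSpace V]

lemma toHomS_ladder (π : UnitaryRep V) {e : ℤ} (he : e = 1 ∨ e = -1) (t : ℝ) (u : π.smooth) :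
    π.toHomS (expS (t • Xi)) (π.ladder e u)
      = exp (e * t * I) • π.ladder e (π.toHomS (expS (t • Xi)) u) := by
  have hadd (c : ℂ) (v w : π.smooth) : π.toHomS (expS (t • Xi)) (v + c • w)
      = π.toHomS (expS (t • Xi)) v + c • π.toHomS (expS (t • Xi)) w :=
    Subtype.ext (by simp [coe_toHomS])
  have hexp : exp (e * t * I) = Real.cos t + e * Real.sin t * I := by
    rcases he with rfl | rfl
    · simp [exp_mul_I]
    · rw [exp_mul_I]
      simp
  have he_sq : (e : ℂ) * e = 1 := by rcases he with rfl | rfl <;> norm_num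
  have hcoeff : (Real.cos t + e * Real.sin t * I : ℂ) * (e * I)
      = -(Real.sin t : ℂ) + e * I * Real.cos t := by
    linear_combination (Real.sin t : ℂ) * I * I * he_sq + (Real.sin t : ℂ) * I_mul_I
  have hdistrib (p q : π.smooth) : (Real.cos t + e * Real.sin t * I : ℂ) • (p + (e * I : ℂ) • q)
      = (Real.cos t + e * Real.sin t * I : ℂ) • p
        + (-(Real.sin t : ℂ) + e * I * Real.cos t) • q := by
    rw [smul_add, smul_smul, hcoeff]
  rw [ladder_apply, hadd, ← dpi_Ad, ← dpi_Ad, Ad_Xi_Hg, Ad_Xi_Bg, sub_eq_add_neg, ← neg_smul,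
    dpi_add_smul, dpi_add_smul, ladder_apply, hexp, hdistrib]
  push_cast
  module

lemma inner_projK_ladder (π : UnitaryRep V) {e : ℤ} (he : e = 1 ∨ e = -1) (k : ℤ)
    (u y : π.smooth) :
    ⟪(y : V), π.projK (k + e) (π.ladder e u)⟫_ℂ = -⟪(π.ladder (-e) y : V), π.projK k u⟫_ℂ := by
  rw [inner_projK_right_eq_integral, inner_projK_right_eq_integral, ← mul_neg,
    ← intervalIntegral.integral_neg]
  congr 1
  refine intervalIntegral.integral_congr fun t _ => ?_
  have hrot : π.rot t (π.ladder e u)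
      = exp (e * t * I) • (π.ladder e (π.toHomS (expS (t • Xi)) u) : V) :=
    congrArg Subtype.val (π.toHomS_ladder he t u)
  have hmode : π.mode (k + e) (π.ladder e u) t
      = exp (-(k * t) * I) • (π.ladder e (π.toHomS (expS (t • Xi)) u) : V) := by
    rw [mode, hrot, smul_smul, ← exp_add]
    congr 2
    push_cast
    ring
  have hskew := π.inner_ladder_left (-e) y (π.toHomS (expS (t • Xi)) u)
  rw [neg_neg, coe_toHomS, ← expG_eq_proj_expS] at hskew
  rw [hmode, mode, inner_smul_right, inner_smul_right, rot, hskew, mul_neg, neg_neg]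

lemma dpi_combination (π : UnitaryRep V) (a b c : ℝ) (u : π.smooth) :
    π.dpi (a • Xi + (b • Hg + c • Bg)) u
      = (a : ℂ) • π.dpi Xi u + ((b : ℂ) • π.dpi Hg u + (c : ℂ) • π.dpi Bg u) := by
  simpa only [one_smul, Complex.ofReal_one, dpi_add_smul π b c]
    using π.dpi_add_smul a 1 Xi (b • Hg + c • Bg) u

lemma hasDerivAt_rot_projK (π : UnitaryRep V) (k : ℤ) (u : V) :
    HasDerivAt (fun t : ℝ => π.toHom (expG (t • Xi)) (π.projK k u)) ((k * I) • π.projK k u) 0 := by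
  have hphase : HasDerivAt (fun t : ℝ => (k : ℂ) * (t : ℂ) * I) (k * I) 0 := by
    simpa using ((hasDerivAt_id (0 : ℝ)).ofReal_comp.const_mul (k : ℂ)).mul_const I
  have hexp : HasDerivAt (fun t : ℝ => exp (k * t * I)) (k * I) 0 := by
    simpa using hphase.cexp
  exact (hexp.smul_const (π.projK k u)).congr_of_eventuallyEq
    (.of_forall fun t => π.rot_projK k t u)

lemma inner_dpi_Xi_projK (π : UnitaryRep V) (k : ℤ) (u : V) (y : π.smooth) :
    ⟪(π.dpi Xi y : V), π.projK k u⟫_ℂ = -(k * I * ⟪(y : V), π.projK k u⟫_ℂ) := by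
  have hderiv := (π.hasDerivAt_dpi Xi y).inner ℂ (π.hasDerivAt_rot_projK k u)
  simp only [LinearIsometryEquiv.inner_map_map, zero_smul, expG_zero, toHom_one,
    inner_smul_right] at hderiv
  exact eq_neg_of_add_eq_zero_right
    (hderiv.unique (hasDerivAt_const (0 : ℝ) (⟪(y : V), π.projK k u⟫_ℂ)))

lemma hasDerivAt_projK (π : UnitaryRep V) (k : ℤ) (u : π.smooth) (a b c : ℝ) :
    HasDerivAt (fun t : ℝ => π.toHom (expG (t • (a • Xi + (b • Hg + c • Bg)))) (π.projK k u))
      ((a * (k * I) : ℂ) • π.projK k u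
        + ((b / 2 - c * I / 2 : ℂ) • π.projK (k + 1) (π.ladder 1 u)
          + (b / 2 + c * I / 2 : ℂ) • π.projK (k + -1) (π.ladder (-1) u))) 0 := by
  refine π.hasDerivAt_of_weak _ fun y => ?_
  have hraise := π.inner_projK_ladder (.inl rfl) k u y
  have hlower := π.inner_projK_ladder (.inr rfl) k u y
  rw [neg_neg] at hlower
  rw [dpi_combination, dpi_Hg_eq_ladder, dpi_Bg_eq_ladder, ← inner_conj_symm,
    ← inner_conj_symm (π.projK k (u : V)), ← map_neg]
  congr 1
  simp only [Submodule.coe_add, Submodule.coe_sub, Submodule.coe_smul, inner_add_left,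
    inner_add_right, inner_sub_left, inner_smul_left, inner_smul_right, hraise, hlower,
    inner_dpi_Xi_projK, map_div₀, map_neg, conj_I, conj_ofReal, map_one, map_ofNat]
  ring

lemma projK_mem_smooth (π : UnitaryRep V) (k : ℤ) {u : V} (hu : u ∈ π.smooth) :
    π.projK k u ∈ π.smooth := by
  refine (Submodule.mem_iInf _).2 fun n => ?_
  induction n generalizing k u with
  | zero => exact Submodule.mem_top
  | succ n ih =>
    intro X
    obtain ⟨a, b, c, rfl⟩ := exists_eq_smul_add_smul_add_smul X
    refine ⟨_, ?_, π.hasDerivAt_projK k ⟨u, hu⟩ a b c⟩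
    exact add_mem (Submodule.smul_mem _ _ (ih k hu))
      (add_mem (Submodule.smul_mem _ _ (ih _ (Subtype.mem _)))
        (Submodule.smul_mem _ _ (ih _ (Subtype.mem _))))

/-- The projection onto the vectors of weight `k`, as a map of the smooth vectors. -/
def projS (π : UnitaryRep V) (k : ℤ) (u : π.smooth) : π.smooth :=
  ⟨π.projK k u, π.projK_mem_smooth k u.2⟩

lemma coe_projS (π : UnitaryRep V) (k : ℤ) (u : π.smooth) :
    (π.projS k u : V) = π.projK k u := rfl

lemma dpi_Xi_projS (π : UnitaryRep V) (k : ℤ) (u : π.smooth) :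
    π.dpi Xi (π.projS k u) = ((k : ℂ) * I) • π.projS k u :=
  π.dpi_eq_of_hasDerivAt (π.hasDerivAt_rot_projK k u)

lemma dpi_Xi_eq_of_projK_eq (π : UnitaryRep V) (k : ℤ) {u : π.smooth}
    (hu : π.projK k u = (u : V)) : π.dpi Xi u = ((k : ℂ) * I) • u := by
  have hproj : π.projS k u = u := Subtype.ext hu
  rw [← hproj, dpi_Xi_projS]

lemma projS_dpi_Xi (π : UnitaryRep V) (k : ℤ) (u : π.smooth) :
    π.projS k (π.dpi Xi u) = ((k : ℂ) * I) • π.projS k u := by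
  refine π.ext_inner_smoothGarding fun f hf y => ?_
  rw [coe_projS, ← inner_projK_right, ← coe_projS, inner_dpi_left, dpi_Xi_projS,
    Submodule.coe_smul, Submodule.coe_smul, inner_smul_right, inner_smul_left, coe_projS,
    coe_projS, ← inner_projK_right]
  simp

lemma projS_ladder (π : UnitaryRep V) {e : ℤ} (he : e = 1 ∨ e = -1) (k : ℤ) (u : π.smooth) :
    π.projS (k + e) (π.ladder e u) = π.ladder e (π.projS k u) := by
  refine π.ext_inner_smoothGarding fun f hf y => ?_
  rw [coe_projS, ← inner_conj_symm, inner_projK_ladder π he, ← coe_projS, inner_ladder_left,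
    neg_neg, neg_neg, inner_conj_symm]

lemma norm_sq_ladder (π : UnitaryRep V) {lam : ℝ} (h : π.HasCasimirScalar lam) {e : ℤ}
    (he : e = 1 ∨ e = -1) (k : ℤ) {v : π.smooth} (hv : π.projK k v = (v : V)) :
    ‖(π.ladder e v : V)‖ ^ 2 = (k ^ 2 + e * k + lam / 4) * ‖(v : V)‖ ^ 2 := by
  have hXi := π.dpi_Xi_eq_of_projK_eq k hv
  have hnorm_Xi : ‖(π.dpi Xi v : V)‖ ^ 2 = k ^ 2 * ‖(v : V)‖ ^ 2 := by
    rw [hXi, Submodule.coe_smul, norm_smul, mul_pow, norm_mul, norm_I, mul_one,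
      Complex.norm_intCast, sq_abs]
  have hcommutator : ⟪(π.dpi Hg v : V), π.dpi Bg v⟫_ℂ - ⟪(π.dpi Bg v : V), π.dpi Hg v⟫_ℂ
      = -(k * I) * (‖(v : V)‖ : ℂ) ^ 2 := by
    have hlie := congrArg (fun w : π.smooth => ⟪(v : V), (w : V)⟫_ℂ) (π.dpi_lie Hg Bg v)
    simp only [lie_Hg_Bg, Submodule.coe_sub, inner_sub_right, hXi, Submodule.coe_smul,
      inner_smul_right, inner_self_eq_norm_sq_to_K, coe_algebraMap] at hlie
    rw [inner_dpi_left, inner_dpi_left]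
    linear_combination hlie
  have he_sq : (e : ℂ) * e = 1 := by rcases he with rfl | rfl <;> norm_num
  have hexpand : (‖(π.ladder e v : V)‖ : ℂ) ^ 2 = (‖(π.dpi Hg v : V)‖ : ℂ) ^ 2
      + (‖(π.dpi Bg v : V)‖ : ℂ) ^ 2 + e * k * (‖(v : V)‖ : ℂ) ^ 2 := by
    have hBg := inner_self_eq_norm_sq_to_K (𝕜 := ℂ) (π.dpi Bg v : V)
    have hHg := inner_self_eq_norm_sq_to_K (𝕜 := ℂ) (π.dpi Hg v : V)
    have hladder := inner_self_eq_norm_sq_to_K (𝕜 := ℂ) (π.ladder e v : V)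
    rw [ladder_apply, Submodule.coe_add, Submodule.coe_smul, inner_add_left, inner_add_right,
      inner_add_right, inner_smul_left, inner_smul_left, inner_smul_right, inner_smul_right,
      hBg, hHg, map_mul, conj_I, map_intCast] at hladder
    rw [ladder_apply, Submodule.coe_add, Submodule.coe_smul]
    simp only [coe_algebraMap] at hladder
    linear_combination -hladder + (e * I : ℂ) * hcommutator
      - (e * e * (‖(π.dpi Bg v : V)‖ : ℂ) ^ 2 + e * k * (‖(v : V)‖ : ℂ) ^ 2) * I_mul_I
      + (‖(π.dpi Bg v : V)‖ : ℂ) ^ 2 * he_sq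
  have hreal : ‖(π.ladder e v : V)‖ ^ 2 = ‖(π.dpi Hg v : V)‖ ^ 2 + ‖(π.dpi Bg v : V)‖ ^ 2
      + e * k * ‖(v : V)‖ ^ 2 := mod_cast hexpand
  rw [hreal, π.norm_sq_Hg_add_norm_sq_Bg h v, hnorm_Xi]
  ring

end UnitaryRep

end Ladder

/-! ### Spherical vectors -/

section Spherical

open scoped InnerProductSpace Topology
open MeasureTheory Complex

variable {V : Type*} [NormedAddCommGroup V] [InnerProductSpace ℂ V]

lemma antitoneOn_radial_energy {f g h : ℝ → ℂ} {c : ℝ} (hf : ∀ t, HasDerivAt f (g t) t)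
    (hg : ∀ t, HasDerivAt g (h t) t)
    (hode : ∀ t, Real.sinh t * h t = -(Real.cosh t * g t) - c * (Real.sinh t * f t)) :
    AntitoneOn (fun t => ‖g t‖ ^ 2 + c * ‖f t‖ ^ 2) (Set.Ici 0) := by
  have hderiv (t : ℝ) : HasDerivAt (fun t => ‖g t‖ ^ 2 + c * ‖f t‖ ^ 2)
      (2 * ⟪g t, h t⟫_ℝ + c * (2 * ⟪f t, g t⟫_ℝ)) t :=
    (hg t).norm_sq.add ((hf t).norm_sq.const_mul c)
  refine antitoneOn_of_deriv_nonpos (convex_Ici 0)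
    (fun s _ => (hderiv s).continuousAt.continuousWithinAt)
    (fun s _ => (hderiv s).differentiableAt.differentiableWithinAt) fun s hs => ?_
  rw [interior_Ici, Set.mem_Ioi] at hs
  rw [(hderiv s).deriv]
  have hdissipation : Real.sinh s * (2 * ⟪g s, h s⟫_ℝ + c * (2 * ⟪f s, g s⟫_ℝ))
      = -(2 * Real.cosh s * ‖g s‖ ^ 2) := by
    have hre := congrArg (fun z => (conj (g s) * z).re) (hode s)
    simp only [Complex.inner, ← Complex.normSq_eq_norm_sq, Complex.normSq_apply, mul_re, sub_re,
      neg_re, mul_im, sub_im, neg_im, conj_re, conj_im, ofReal_re, ofReal_im] at hre ⊢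
    linear_combination 2 * hre
  refine nonpos_of_mul_nonpos_right (hdissipation.trans_le ?_) (Real.sinh_pos_iff.2 hs)
  exact neg_nonpos.2 (by positivity)

lemma eq_zero_of_radial_ode {f g h : ℝ → ℂ} {c : ℝ} (hc : 0 < c)
    (hf : ∀ t, HasDerivAt f (g t) t) (hg : ∀ t, HasDerivAt g (h t) t)
    (hode : ∀ t, Real.sinh t * h t = -(Real.cosh t * g t) - c * (Real.sinh t * f t))
    (hf_zero : f 0 = 0) {t : ℝ} (ht : 0 ≤ t) : f t = 0 := by
  have hg_zero : g 0 = 0 := by simpa using hode 0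
  have henergy := antitoneOn_radial_energy hf hg hode Set.self_mem_Ici ht ht
  simp only [hf_zero, hg_zero, norm_zero] at henergy
  have hnorm_sq : ‖f t‖ ^ 2 ≤ 0 := by nlinarith [sq_nonneg ‖g t‖]
  simpa using hnorm_sq.antisymm (sq_nonneg _)

namespace UnitaryRep

lemma IsIrreducible.eq_zero_or_eq_zero {π : UnitaryRep V} (hirr : π.IsIrreducible) {u v : V}
    (horth : ∀ g, ⟪v, π.toHom g u⟫_ℂ = 0) : u = 0 ∨ v = 0 := by
  let W : Submodule ℂ V :=
    ⨅ g, (innerSL ℂ v ∘L ((π.toHom g).toContinuousLinearEquiv : V →L[ℂ] V)).ker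
  have mem_W {w : V} : w ∈ W ↔ ∀ g, ⟪v, π.toHom g w⟫_ℂ = 0 := Submodule.mem_iInf _
  have hclosed : IsClosed (W : Set V) := by
    rw [Submodule.coe_iInf]
    exact isClosed_iInter fun g => ContinuousLinearMap.isClosed_ker _
  rcases hirr.2 W hclosed fun g w hw => mem_W.2 fun g' => by
    rw [← toHom_mul]; exact mem_W.1 hw _ with hW | hW
  · exact .inl ((Submodule.mem_bot ℂ).1 (hW ▸ mem_W.2 horth))
  · have hself := mem_W.1 (hW ▸ Submodule.mem_top : v ∈ W) 1
    exact .inr (inner_self_eq_zero.1 (π.toHom_one v ▸ hself))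

lemma IsIrreducible.eq_zero_of_fixed {π : UnitaryRep V} (hirr : π.IsIrreducible)
    (hnt : ¬ π.IsTrivial) {v : V} (hv : ∀ g, π.toHom g v = v) : v = 0 := by
  let W : Submodule ℂ V :=
    ⨅ g, (((π.toHom g).toContinuousLinearEquiv : V →L[ℂ] V) - .id ℂ V).ker
  have mem_W {w : V} : w ∈ W ↔ ∀ g, π.toHom g w = w :=
    (Submodule.mem_iInf _).trans (forall_congr' fun g => sub_eq_zero)
  have hclosed : IsClosed (W : Set V) := by
    rw [Submodule.coe_iInf]
    exact isClosed_iInter fun g => ContinuousLinearMap.isClosed_ker _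
  rcases hirr.2 W hclosed fun g w hw => by rwa [mem_W.1 hw g] with hW | hW
  · exact (Submodule.mem_bot ℂ).1 (hW ▸ mem_W.2 hv)
  · exact (hnt fun g w => mem_W.1 (hW ▸ Submodule.mem_top : w ∈ W) g).elim

lemma dpi_Hg_dpi_Hg_of_dpi_Xi_eq_zero (π : UnitaryRep V) {lam : ℝ} (h : π.HasCasimirScalar lam)
    {u : π.smooth} (hu : π.dpi Xi u = 0) :
    π.dpi Hg (π.dpi Hg u) = -π.dpi Bg (π.dpi Bg u) - (lam / 4 : ℂ) • u := by
  have hcasimir := congrArg (fun A : Module.End ℂ π.smooth => A u) h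
  simp only [casimir, LinearMap.sub_apply, LinearMap.smul_apply, pow_two, Module.End.mul_apply,
    Module.End.one_apply, hu, map_zero, smul_zero, zero_sub] at hcasimir
  have hquarter : (lam / 4 : ℂ) • u = (1 / 4 : ℂ) • ((lam : ℂ) • u) := by module
  rw [hquarter, ← hcasimir]
  module

variable [CompleteSpace V]

lemma exists_smooth_projK_eq (π : UnitaryRep V) [Nontrivial V] :
    ∃ (k : ℤ) (u : π.smooth), (u : V) ≠ 0 ∧ π.projK k u = (u : V) := by
  by_contra! hnone
  have hsmooth (u : V) (hu : u ∈ π.smooth) : u = 0 := π.eq_zero_of_projK_eq_zero fun k => by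
    by_contra hne
    exact hnone k (π.projS k ⟨u, hu⟩) hne (π.projK_projK_self k u)
  obtain ⟨v, hv⟩ := exists_ne (0 : V)
  exact hv (π.dense_smooth.eq_zero_of_inner_right (𝕜 := ℂ) fun w hw => by
    rw [hsmooth w hw, inner_zero_left])

lemma projK_ladder_of_projK_eq (π : UnitaryRep V) {e : ℤ} (he : e = 1 ∨ e = -1) {k : ℤ}
    {v : π.smooth} (hv : π.projK k v = (v : V)) :
    π.projK (k + e) (π.ladder e v) = (π.ladder e v : V) := by
  have hproj : π.projS k v = v := Subtype.ext hv
  rw [← coe_projS, projS_ladder π he, hproj]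

lemma ladder_ne_zero (π : UnitaryRep V) {lam : ℝ} (h : π.HasCasimirScalar lam) {e : ℤ}
    (he : e = 1 ∨ e = -1) {k : ℤ} (hpos : 0 < k ^ 2 + e * k + lam / 4) {v : π.smooth}
    (hv : π.projK k v = (v : V)) (hne : (v : V) ≠ 0) : (π.ladder e v : V) ≠ 0 := by
  have hnorm_sq : ‖(π.ladder e v : V)‖ ^ 2 ≠ 0 := by
    rw [π.norm_sq_ladder h he k hv]
    exact mul_ne_zero hpos.ne' (pow_ne_zero 2 (norm_ne_zero_iff.2 hne))
  simpa using hnorm_sq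

lemma exists_projK_zero_eq (π : UnitaryRep V) {lam : ℝ} (h : π.HasCasimirScalar lam)
    (hlam : 0 < lam) {k : ℤ} {v : π.smooth} (hv : π.projK k v = (v : V)) (hne : (v : V) ≠ 0) :
    ∃ u : π.smooth, (u : V) ≠ 0 ∧ π.projK 0 u = (u : V) := by
  induction hn : k.natAbs generalizing k v with
  | zero => exact ⟨v, hne, by rwa [← Int.natAbs_eq_zero.1 hn]⟩
  | succ n ih =>
    obtain ⟨e, he, hcloser, hnonneg⟩ : ∃ e : ℤ, (e = 1 ∨ e = -1) ∧ (k + e).natAbs = n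
        ∧ 0 ≤ k ^ 2 + e * k := by
      rcases lt_or_gt_of_ne (show k ≠ 0 by lia) with hk | hk
      · exact ⟨1, .inl rfl, by lia, by nlinarith⟩
      · exact ⟨-1, .inr rfl, by lia, by nlinarith⟩
    have hnonneg_real : (0 : ℝ) ≤ k ^ 2 + e * k := mod_cast hnonneg
    exact ih (π.projK_ladder_of_projK_eq he hv)
      (π.ladder_ne_zero h he (by positivity) hv hne) hcloser

lemma exists_spherical (π : UnitaryRep V) [Nontrivial V] {lam : ℝ} (h : π.HasCasimirScalar lam)
    (hlam : 0 < lam) : ∃ φ : π.smooth, ‖(φ : V)‖ = 1 ∧ π.projK 0 φ = (φ : V) := by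
  obtain ⟨k, u, hne, hu⟩ := π.exists_smooth_projK_eq
  obtain ⟨v, hv_ne, hv⟩ := π.exists_projK_zero_eq h hlam hu hne
  refine ⟨((‖(v : V)‖⁻¹ : ℝ) : ℂ) • v, ?_, ?_⟩
  · rw [Submodule.coe_smul, norm_smul, Complex.norm_real, norm_inv, norm_norm,
      inv_mul_cancel₀ (norm_ne_zero_iff.2 hv_ne)]
  · rw [Submodule.coe_smul, map_smul, hv]

lemma rot_of_projK_zero (π : UnitaryRep V) {u : V} (hu : π.projK 0 u = u) (t : ℝ) :
    π.rot t u = u := by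
  simpa [hu] using π.rot_projK 0 t u

lemma dpi_Xi_of_projK_zero (π : UnitaryRep V) {u : π.smooth} (hu : π.projK 0 u = (u : V)) :
    π.dpi Xi u = 0 := by
  simpa using π.dpi_Xi_eq_of_projK_eq 0 hu

lemma sinh_mul_inner_orbit_dpi_Bg (π : UnitaryRep V) {ψ : π.smooth} (hψ : π.dpi Xi ψ = 0)
    (w : π.smooth) (s : ℝ) :
    Real.sinh s * ⟪(ψ : V), π.toHom (expG (s • Hg)) (π.dpi Bg w)⟫_ℂ
      = Real.cosh s * ⟪(ψ : V), π.toHom (expG (s • Hg)) (π.dpi Xi w)⟫_ℂ := by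
  have hAd := π.dpi_Ad (expS ((-s) • Hg)) Xi (π.toHomS (expS (s • Hg)) w)
  have hcancel : π.toHomS (expS ((-s) • Hg)) (π.toHomS (expS (s • Hg)) w) = w := by
    refine Subtype.ext ?_
    rw [coe_toHomS, coe_toHomS, neg_smul, expS_neg, map_inv, toHom_inv_toHom]
  rw [hcancel, Ad_Hg_Xi, dpi_add_smul, Real.cosh_neg, Real.sinh_neg] at hAd
  have hinner := congrArg (fun v : π.smooth => ⟪(ψ : V), π.toHom (expG (s • Hg)) v⟫_ℂ) hAd
  simp only [coe_toHomS] at hinner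
  rw [neg_smul, expS_neg, map_inv, ← expG_eq_proj_expS, toHom_toHom_inv, inner_dpi_right, hψ]
    at hinner
  simp only [Submodule.coe_add, Submodule.coe_smul, map_add, map_smul, inner_add_right,
    inner_smul_right, Submodule.coe_zero, inner_zero_left, neg_zero] at hinner
  push_cast at hinner ⊢
  linear_combination -hinner

lemma inner_geodesic_eq_zero_of_nonneg (π : UnitaryRep V) {lam : ℝ} (h : π.HasCasimirScalar lam)
    (hlam : 0 < lam) {φ ψ : π.smooth} (hφ : π.projK 0 φ = (φ : V)) (hψ : π.projK 0 ψ = (ψ : V))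
    (horth : ⟪(ψ : V), φ⟫_ℂ = 0) {t : ℝ} (ht : 0 ≤ t) :
    ⟪(ψ : V), π.toHom (expG (t • Hg)) φ⟫_ℂ = 0 := by
  have hderiv (v : π.smooth) (s : ℝ) :
      HasDerivAt (fun t : ℝ => ⟪(ψ : V), π.toHom (expG (t • Hg)) v⟫_ℂ)
        ⟪(ψ : V), π.toHom (expG (s • Hg)) (π.dpi Hg v)⟫_ℂ s := by
    simpa using (hasDerivAt_const s (ψ : V)).inner ℂ (π.hasDerivAt_orbit Hg v s)
  have hXφ := π.dpi_Xi_of_projK_zero hφ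
  have hXi_Bg : π.dpi Xi (π.dpi Bg φ) = π.dpi Hg φ := by
    have hlie := π.dpi_lie Xi Bg φ
    rw [lie_Xi_Bg, hXφ, map_zero, sub_zero] at hlie
    exact hlie.symm
  refine eq_zero_of_radial_ode (c := lam / 4) (by positivity) (hderiv φ) (hderiv (π.dpi Hg φ))
    (fun s => ?_) (by simpa [expG_zero, toHom_one] using horth) ht
  have htransport :=
    π.sinh_mul_inner_orbit_dpi_Bg (π.dpi_Xi_of_projK_zero hψ) (π.dpi Bg φ) s
  rw [hXi_Bg] at htransport
  rw [π.dpi_Hg_dpi_Hg_of_dpi_Xi_eq_zero h hXφ]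
  simp only [Submodule.coe_sub, Submodule.coe_neg, Submodule.coe_smul, map_sub, map_neg, map_smul,
    inner_sub_right, inner_neg_right, inner_smul_right]
  push_cast at htransport ⊢
  linear_combination -htransport

lemma inner_toHom_eq_zero (π : UnitaryRep V) {lam : ℝ} (h : π.HasCasimirScalar lam)
    (hlam : 0 < lam) {φ ψ : π.smooth} (hφ : π.projK 0 φ = (φ : V)) (hψ : π.projK 0 ψ = (ψ : V))
    (horth : ⟪(ψ : V), φ⟫_ℂ = 0) (g : PSL(2, ℝ)) : ⟪(ψ : V), π.toHom g φ⟫_ℂ = 0 := by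
  obtain ⟨a, t, b, rfl⟩ := exists_cartan g
  have hradial : ⟪(ψ : V), π.toHom (expG (a • Xi) * expG (t • Hg) * expG (b • Xi)) φ⟫_ℂ
      = ⟪(ψ : V), π.toHom (expG (t • Hg)) φ⟫_ℂ := by
    have hrot := π.inner_rot_left (-a) (ψ : V) (π.toHom (expG (t • Hg)) φ)
    rw [neg_neg, π.rot_of_projK_zero hψ] at hrot
    rw [toHom_mul, toHom_mul, ← rot, ← rot, π.rot_of_projK_zero hφ, hrot]
  rw [hradial]
  rcases le_total 0 t with ht | ht
  · exact π.inner_geodesic_eq_zero_of_nonneg h hlam hφ hψ horth ht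
  · have hswap := π.inner_geodesic_eq_zero_of_nonneg h hlam hψ hφ
      (inner_eq_zero_symm.1 horth) (neg_nonneg.2 ht)
    rw [neg_smul, expG_neg, ← inner_toHom_left] at hswap
    exact inner_eq_zero_symm.1 hswap

lemma spherical_eq_zero_of_inner_eq_zero (π : UnitaryRep V) {lam : ℝ}
    (h : π.HasCasimirScalar lam) (hlam : 0 < lam) (hirr : π.IsIrreducible) {φ ψ : π.smooth}
    (hφ : π.projK 0 φ = (φ : V)) (hψ : π.projK 0 ψ = (ψ : V)) (horth : ⟪(ψ : V), φ⟫_ℂ = 0)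
    (hne : (φ : V) ≠ 0) : (ψ : V) = 0 :=
  (hirr.eq_zero_or_eq_zero (π.inner_toHom_eq_zero h hlam hφ hψ horth)).resolve_left hne

lemma projK_zero_eq (π : UnitaryRep V) {lam : ℝ} (h : π.HasCasimirScalar lam) (hlam : 0 < lam)
    (hirr : π.IsIrreducible) {φ : π.smooth} (hφ : π.projK 0 φ = (φ : V)) (hnorm : ‖(φ : V)‖ = 1)
    (u : V) : π.projK 0 u = ⟪(φ : V), u⟫_ℂ • (φ : V) := by
  refine π.dense_smooth.induction (fun u hu => ?_)
    (isClosed_eq (π.projK 0).continuous (by fun_prop)) u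
  let ψ : π.smooth := π.projS 0 ⟨u, hu⟩ - ⟪(φ : V), u⟫_ℂ • φ
  have coe_ψ : (ψ : V) = π.projK 0 u - ⟪(φ : V), u⟫_ℂ • (φ : V) := rfl
  refine sub_eq_zero.1 (coe_ψ.symm.trans ?_)
  refine π.spherical_eq_zero_of_inner_eq_zero h hlam hirr hφ ?_ ?_
    (norm_ne_zero_iff.1 (hnorm ▸ one_ne_zero))
  · rw [coe_ψ, map_sub, map_smul, projK_projK_self, hφ]
  · rw [coe_ψ, inner_sub_left, inner_smul_left, ← inner_projK_right, hφ, inner_conj_symm,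
      inner_self_eq_one_of_norm_eq_one hnorm, mul_one, sub_self]

lemma toHom_eq_self_of_spherical (π : UnitaryRep V) {lam : ℝ} (h : π.HasCasimirScalar lam)
    (hlam : lam ≤ 0) {v : π.smooth} (hv : π.projK 0 v = (v : V)) (g : PSL(2, ℝ)) :
    π.toHom g v = (v : V) := by
  have hHg : (π.dpi Hg v : V) = 0 := by
    have hnorm := π.norm_sq_Hg_add_norm_sq_Bg h v
    rw [π.dpi_Xi_of_projK_zero hv, Submodule.coe_zero, norm_zero] at hnorm
    have hnorm_sq : ‖(π.dpi Hg v : V)‖ ^ 2 ≤ 0 := by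
      nlinarith [sq_nonneg ‖(v : V)‖, sq_nonneg ‖(π.dpi Bg v : V)‖]
    simpa using hnorm_sq.antisymm (sq_nonneg _)
  have hderiv (s : ℝ) : HasDerivAt (fun t : ℝ => π.toHom (expG (t • Hg)) (v : V)) 0 s := by
    simpa only [hHg, map_zero] using π.hasDerivAt_orbit Hg v s
  have hgeodesic (t : ℝ) : π.toHom (expG (t • Hg)) (v : V) = v := by
    simpa [expG_zero, toHom_one] using is_const_of_deriv_eq_zero
      (fun s => (hderiv s).differentiableAt) (fun s => (hderiv s).deriv) t 0
  obtain ⟨a, t, b, rfl⟩ := exists_cartan g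
  have hrot := π.rot_of_projK_zero hv
  rw [toHom_mul, toHom_mul, ← rot, ← rot, hrot, hgeodesic, hrot]

lemma projK_zero_eq_zero (π : UnitaryRep V) {lam : ℝ} (h : π.HasCasimirScalar lam)
    (hlam : lam ≤ 0) (hirr : π.IsIrreducible) (hnt : ¬ π.IsTrivial) (u : V) : π.projK 0 u = 0 := by
  refine π.dense_smooth.induction (fun u hu => ?_)
    (isClosed_eq (π.projK 0).continuous continuous_const) u
  exact hirr.eq_zero_of_fixed hnt <|
    π.toHom_eq_self_of_spherical h hlam (v := π.projS 0 ⟨u, hu⟩) (π.projK_projK_self 0 u)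

end UnitaryRep

end Spherical

/-! ### Estimates off the spherical vectors -/

section Estimates

open scoped InnerProductSpace
open Complex

variable {V : Type*} [NormedAddCommGroup V] [InnerProductSpace ℂ V]

/-- The region `Re ζ ≤ 1/2` of spectral parameters, which keeps a distance `1/2` from the values
`k²`, `k ≠ 0`, of `-Ξ²` off the `K`-fixed vectors. -/
def spectralHalfPlane : Set ℂ := {ζ | ζ.re ≤ 1 / 2}

lemma mem_spectralHalfPlane {ζ : ℂ} : ζ ∈ spectralHalfPlane ↔ ζ.re ≤ 1 / 2 := Iff.rfl

lemma isClosed_spectralHalfPlane : IsClosed spectralHalfPlane :=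
  isClosed_le continuous_re continuous_const

lemma closedBall_subset_spectralHalfPlane : Metric.closedBall 0 (1 / 2) ⊆ spectralHalfPlane :=
  fun ζ hζ => ζ.re_le_norm.trans (mem_closedBall_zero_iff.1 hζ)

lemma one_le_intCast_sq {k : ℤ} (hk : k ≠ 0) : (1 : ℝ) ≤ (k : ℝ) ^ 2 :=
  mod_cast (one_le_sq_iff_one_le_abs k).2 (Int.one_le_abs hk)

lemma sq_half_le_norm_sq_sub {k : ℤ} (hk : k ≠ 0) {ζ : ℂ} (hζ : ζ ∈ spectralHalfPlane) :
    (k : ℝ) ^ 2 / 2 ≤ ‖(k : ℂ) ^ 2 - ζ‖ := by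
  have hre : ((k : ℂ) ^ 2 - ζ).re = (k : ℝ) ^ 2 - ζ.re := by
    rw [sub_re]
    norm_cast
  refine le_trans ?_ ((k : ℂ) ^ 2 - ζ).re_le_norm
  rw [hre]
  linarith [one_le_intCast_sq hk, mem_spectralHalfPlane.1 hζ]

namespace UnitaryRep

/-- The operator `-Ξ²` on smooth vectors. -/
def lapl (π : UnitaryRep V) : Module.End ℂ π.smooth := -(π.dpi Xi ^ 2)

lemma lapl_apply (π : UnitaryRep V) (v : π.smooth) :
    π.lapl v = -π.dpi Xi (π.dpi Xi v) := by
  rw [lapl, LinearMap.neg_apply, pow_two, Module.End.mul_apply]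

lemma inner_lapl_self (π : UnitaryRep V) (v : π.smooth) :
    ⟪(v : V), π.lapl v⟫_ℂ = (‖(π.dpi Xi v : V)‖ : ℂ) ^ 2 := by
  rw [lapl_apply, Submodule.coe_neg, inner_neg_right, inner_dpi_right, neg_neg]
  exact inner_self_eq_norm_sq_to_K _

lemma norm_sq_Xi_le (π : UnitaryRep V) (v : π.smooth) :
    ‖(π.dpi Xi v : V)‖ ^ 2 ≤ ‖(v : V)‖ * ‖(π.lapl v : V)‖ := by
  have hnorm := norm_inner_le_norm (𝕜 := ℂ) (v : V) (π.lapl v)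
  rwa [inner_lapl_self, norm_pow, Complex.norm_real, norm_norm] at hnorm

lemma lapl_eq_of_dpi_Xi_eq (π : UnitaryRep V) {k : ℤ} {v : π.smooth}
    (hv : π.dpi Xi v = ((k : ℂ) * I) • v) : π.lapl v = (k : ℂ) ^ 2 • v := by
  rw [lapl_apply, hv, map_smul, hv, smul_smul, ← neg_smul]
  congr 1
  linear_combination (-(k : ℂ) ^ 2) * I_mul_I

/-- The orthogonal complement of the `K`-fixed vectors. -/
def nonspherical (π : UnitaryRep V) : Submodule ℂ V := (π.projK 0).ker

lemma mem_nonspherical (π : UnitaryRep V) (u : V) : u ∈ π.nonspherical ↔ π.projK 0 u = 0 :=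
  LinearMap.mem_ker

/-- The smooth vectors in the orthogonal complement of the `K`-fixed vectors. -/
def smoothNonspherical (π : UnitaryRep V) : Submodule ℂ π.smooth :=
  π.nonspherical.comap π.smooth.subtype

/-- The inclusion of `smoothNonspherical` into `nonspherical`. -/
def inclNS (π : UnitaryRep V) : π.smoothNonspherical →ₗ[ℂ] π.nonspherical :=
  (π.smooth.subtype ∘ₗ π.smoothNonspherical.subtype).codRestrict _ fun v => v.2

lemma coe_inclNS (π : UnitaryRep V) (v : π.smoothNonspherical) :
    (π.inclNS v : V) = (v : π.smooth) := rfl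

variable [CompleteSpace V]

lemma norm_le_of_norm_projK_le (π : UnitaryRep V) {u w : V} {c : ℝ} (hc : 0 ≤ c)
    (h : ∀ k, ‖π.projK k u‖ ≤ c * ‖π.projK k w‖) : ‖u‖ ≤ c * ‖w‖ := by
  have hw := (π.hasSum_norm_sq_projK w).mul_left (c ^ 2)
  simp_rw [← mul_pow] at hw
  exact le_of_sq_le_sq (hasSum_le (fun k => by gcongr; exact h k) (π.hasSum_norm_sq_projK u) hw)
    (by positivity)

lemma projK_dpi_Xi (π : UnitaryRep V) (k : ℤ) (v : π.smooth) :
    π.projK k (π.dpi Xi v) = ((k : ℂ) * I) • π.projK k v :=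
  congrArg Subtype.val (π.projS_dpi_Xi k v)

lemma projK_lapl (π : UnitaryRep V) (k : ℤ) (v : π.smooth) :
    π.projK k (π.lapl v) = ((k : ℂ) ^ 2) • π.projK k v := by
  rw [lapl_apply, Submodule.coe_neg, map_neg, projK_dpi_Xi, projK_dpi_Xi, smul_smul, ← neg_smul]
  congr 1
  linear_combination (-(k : ℂ) ^ 2) * I_mul_I

lemma norm_projK_lapl (π : UnitaryRep V) (k : ℤ) (v : π.smooth) :
    ‖π.projK k (π.lapl v)‖ = (k : ℝ) ^ 2 * ‖π.projK k v‖ := by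
  rw [projK_lapl, norm_smul, norm_pow, Complex.norm_intCast, sq_abs]

lemma norm_projK_lapl_sub (π : UnitaryRep V) (k : ℤ) (ζ : ℂ) (v : π.smooth) :
    ‖π.projK k ((π.lapl v : V) - ζ • (v : V))‖ = ‖(k : ℂ) ^ 2 - ζ‖ * ‖π.projK k v‖ := by
  rw [map_sub, map_smul, projK_lapl, ← sub_smul, norm_smul]

lemma hasSum_norm_sq_Xi (π : UnitaryRep V) (v : π.smooth) :
    HasSum (fun k : ℤ => (k : ℝ) ^ 2 * ‖π.projK k v‖ ^ 2) (‖(π.dpi Xi v : V)‖ ^ 2) := by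
  convert π.hasSum_norm_sq_projK (π.dpi Xi v) using 2 with k
  rw [projK_dpi_Xi, norm_smul, mul_pow, norm_mul, norm_I, mul_one, Complex.norm_intCast, sq_abs]

lemma norm_lapl_le (π : UnitaryRep V) {ζ : ℂ} (hζ : ζ ∈ spectralHalfPlane) {v : π.smooth}
    (hv : π.projK 0 v = 0) : ‖(π.lapl v : V)‖ ≤ 2 * ‖(π.lapl v : V) - ζ • (v : V)‖ := by
  refine π.norm_le_of_norm_projK_le zero_le_two fun k => ?_
  rw [norm_projK_lapl, norm_projK_lapl_sub, ← mul_assoc]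
  rcases eq_or_ne k 0 with rfl | hk
  · rw [hv, norm_zero, mul_zero, mul_zero]
  · gcongr
    linarith [sq_half_le_norm_sq_sub hk hζ]

lemma norm_le_norm_lapl_sub (π : UnitaryRep V) {ζ : ℂ} (hζ : ζ ∈ spectralHalfPlane) {v : π.smooth}
    (hv : π.projK 0 v = 0) : ‖(v : V)‖ ≤ 2 * ‖(π.lapl v : V) - ζ • (v : V)‖ := by
  refine π.norm_le_of_norm_projK_le zero_le_two fun k => ?_
  rw [norm_projK_lapl_sub, ← mul_assoc]
  rcases eq_or_ne k 0 with rfl | hk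
  · rw [hv, norm_zero, mul_zero]
  · refine le_mul_of_one_le_left (norm_nonneg _) ?_
    linarith [sq_half_le_norm_sq_sub hk hζ, one_le_intCast_sq hk]

lemma norm_sq_Hg_le (π : UnitaryRep V) {lam L : ℝ} (h : π.HasCasimirScalar lam) (hL : lam ≤ L)
    (hL0 : 0 ≤ L) {ζ : ℂ} (hζ : ζ ∈ spectralHalfPlane) {v : π.smooth} (hv : π.projK 0 v = 0) :
    ‖(π.dpi Hg v : V)‖ ^ 2 ≤ (L + 4) * ‖(π.lapl v : V) - ζ • (v : V)‖ ^ 2 := by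
  set w := (π.lapl v : V) - ζ • (v : V)
  have hv_le : ‖(v : V)‖ ≤ 2 * ‖w‖ := π.norm_le_norm_lapl_sub hζ hv
  have hlapl_le : ‖(π.lapl v : V)‖ ≤ 2 * ‖w‖ := π.norm_lapl_le hζ hv
  calc ‖(π.dpi Hg v : V)‖ ^ 2
      ≤ ‖(π.dpi Xi v : V)‖ ^ 2 + lam / 4 * ‖(v : V)‖ ^ 2 := by
        linarith [π.norm_sq_Hg_add_norm_sq_Bg h v, sq_nonneg ‖(π.dpi Bg v : V)‖]
    _ ≤ ‖(v : V)‖ * ‖(π.lapl v : V)‖ + L / 4 * ‖(v : V)‖ ^ 2 := by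
        gcongr
        exact π.norm_sq_Xi_le v
    _ ≤ 2 * ‖w‖ * (2 * ‖w‖) + L / 4 * (2 * ‖w‖) ^ 2 := by gcongr
    _ = (L + 4) * ‖w‖ ^ 2 := by ring

end UnitaryRep

/-- The share of the off-diagonal matrix coefficient of `H` between the weights `j` and `k = j ± 1`
that is charged to `j`. The shares `|j|/10` at the smaller and `5|j|/12` at the larger weight have
product `|jk|/24`, as the arithmetic-geometric mean inequality requires, while the weights `j = ±1`,
where `-Ξ²` is smallest, are charged `1/10` only. -/
def offDiagWeight (j k : ℤ) : ℝ :=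
  if |j| < |k| then |(j : ℝ)| / 10 else if k = 0 then 0 else 5 * |(j : ℝ)| / 12

lemma offDiagWeight_nonneg (j k : ℤ) : 0 ≤ offDiagWeight j k := by
  unfold offDiagWeight
  split_ifs <;> positivity

lemma offDiagWeight_neg (j k : ℤ) : offDiagWeight (-j) (-k) = offDiagWeight j k := by
  simp [offDiagWeight]

lemma offDiagWeight_of_pos {k : ℤ} (hk : 0 < k) : offDiagWeight k (k + 1) = k / 10 := by
  have hk' : (0 : ℝ) < k := mod_cast hk
  rw [offDiagWeight, if_pos (by rw [abs_of_pos hk, abs_of_pos (by lia)]; lia), abs_of_pos hk']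

lemma offDiagWeight_add_one_of_pos {k : ℤ} (hk : 0 < k) :
    offDiagWeight (k + 1) k = 5 * (k + 1) / 12 := by
  have hk' : (0 : ℝ) < k + 1 := mod_cast (by lia : 0 < k + 1)
  rw [offDiagWeight, if_neg (by rw [abs_of_pos hk, abs_of_pos (by lia)]; lia), if_neg hk.ne']
  push_cast
  rw [abs_of_pos hk']

lemma offDiagWeight_add_le {k : ℤ} (hk : k ≠ 0) :
    offDiagWeight k (k + 1) + offDiagWeight k (k - 1) ≤ (k : ℝ) ^ 2 - 9 / 10 := by
  wlog hpos : 0 < k generalizing k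
  · have hneg := this (neg_ne_zero.2 hk) (by lia)
    rw [show -k + 1 = -(k - 1) by ring, show -k - 1 = -(k + 1) by ring, offDiagWeight_neg,
      offDiagWeight_neg, Int.cast_neg, neg_sq] at hneg
    linarith
  rw [offDiagWeight_of_pos hpos]
  obtain rfl | hk2 : k = 1 ∨ 2 ≤ k := by lia
  · norm_num [offDiagWeight]
  · have hsub : offDiagWeight k (k - 1) = 5 * k / 12 := by
      simpa using offDiagWeight_add_one_of_pos (k := k - 1) (by lia)
    have hk2' : (2 : ℝ) ≤ k := mod_cast hk2
    rw [hsub]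
    nlinarith

lemma four_mul_offDiagWeight_mul {k : ℤ} (hk : k ≠ 0) (hk' : k + 1 ≠ 0) :
    4 * offDiagWeight k (k + 1) * offDiagWeight (k + 1) k = (k : ℝ) * (k + 1) / 6 := by
  wlog hpos : 0 < k generalizing k
  · have hneg := this (k := -(k + 1)) (by lia) (by lia) (by lia)
    rw [show -(k + 1) + 1 = -k by ring, offDiagWeight_neg, offDiagWeight_neg] at hneg
    push_cast at hneg
    linarith
  rw [offDiagWeight_of_pos hpos, offDiagWeight_add_one_of_pos hpos]
  ring

lemma two_le_intCast_mul_add_one {k : ℤ} (hk : k ≠ 0) (hk' : k + 1 ≠ 0) :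
    (2 : ℝ) ≤ k * (k + 1) := by
  obtain hpos | hneg : 1 ≤ k ∨ k ≤ -2 := by lia
  · have : (1 : ℝ) ≤ k := mod_cast hpos
    nlinarith
  · have : (k : ℝ) ≤ -2 := mod_cast hneg
    nlinarith

namespace UnitaryRep

lemma norm_inner_dpi_Hg_le (π : UnitaryRep V) (v : π.smooth) :
    ‖⟪(v : V), π.dpi Hg v⟫_ℂ‖ ≤ ‖⟪(v : V), π.ladder 1 v⟫_ℂ‖ := by
  have hlower : ⟪(v : V), π.ladder (-1) v⟫_ℂ = -conj ⟪(v : V), π.ladder 1 v⟫_ℂ := by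
    rw [inner_conj_symm, inner_ladder_left, neg_neg]
  have htriangle := norm_sub_le ⟪(v : V), π.ladder 1 v⟫_ℂ (conj ⟪(v : V), π.ladder 1 v⟫_ℂ)
  rw [RCLike.norm_conj] at htriangle
  rw [dpi_Hg_eq_ladder, Submodule.coe_smul, Submodule.coe_add, inner_smul_right, inner_add_right,
    hlower, ← sub_eq_add_neg, norm_mul, norm_div, norm_one, Complex.norm_ofNat]
  linarith

variable [CompleteSpace V]

lemma norm_sq_ladder_projS (π : UnitaryRep V) {lam : ℝ} (h : π.HasCasimirScalar lam) (k : ℤ)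
    (v : π.smooth) :
    ‖(π.ladder 1 (π.projS k v) : V)‖ ^ 2 = (k * (k + 1) + lam / 4) * ‖π.projK k (v : V)‖ ^ 2 := by
  rw [π.norm_sq_ladder h (.inl rfl) k (π.projK_projK_self k v), coe_projS]
  push_cast
  ring

lemma ladder_projS_zero (π : UnitaryRep V) {v : π.smooth} (hv : π.projK 0 v = 0) (e : ℤ) :
    π.ladder e (π.projS 0 v) = 0 := by
  have hzero : π.projS 0 v = 0 := Subtype.ext hv
  rw [hzero, map_zero]

lemma norm_inner_projK_ladder_le (π : UnitaryRep V) {lam : ℝ} (h : π.HasCasimirScalar lam)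
    (hlam : 0 < lam) {ρ : ℝ} (hρ : 0 ≤ ρ) (hρ1 : ρ ^ 2 * (lam + 6) ≤ 1) {v : π.smooth}
    (hv : π.projK 0 v = 0) (k : ℤ) :
    ρ * ‖⟪π.projK (k + 1) (v : V), π.projK (k + 1) (π.ladder 1 v)⟫_ℂ‖
      ≤ offDiagWeight k (k + 1) * ‖π.projK k v‖ ^ 2
        + offDiagWeight (k + 1) k * ‖π.projK (k + 1) v‖ ^ 2 := by
  have hk_nonneg := offDiagWeight_nonneg k (k + 1)
  have hk1_nonneg := offDiagWeight_nonneg (k + 1) k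
  have hladder : π.projK (k + 1) (π.ladder 1 v) = (π.ladder 1 (π.projS k v) : V) :=
    congrArg Subtype.val (π.projS_ladder (.inl rfl) k v)
  rcases eq_or_ne k 0 with rfl | hk
  · rw [hladder, π.ladder_projS_zero hv, Submodule.coe_zero, inner_zero_right, norm_zero, mul_zero]
    positivity
  rcases eq_or_ne (k + 1) 0 with hk' | hk'
  · rw [hk', hv, inner_zero_left, norm_zero, mul_zero, ← hk']
    positivity
  have hcoeff : ρ ^ 2 * ‖(π.ladder 1 (π.projS k v) : V)‖ ^ 2
      ≤ 4 * offDiagWeight k (k + 1) * offDiagWeight (k + 1) k * ‖π.projK k (v : V)‖ ^ 2 := by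
    rw [π.norm_sq_ladder_projS h, four_mul_offDiagWeight_mul hk hk', ← mul_assoc]
    gcongr
    nlinarith [two_le_intCast_mul_add_one hk hk', mul_nonneg (sq_nonneg ρ) hlam.le]
  set p := offDiagWeight k (k + 1)
  set q := offDiagWeight (k + 1) k
  set a := ‖π.projK k (v : V)‖
  set b := ‖π.projK (k + 1) (v : V)‖
  set c := ‖(π.ladder 1 (π.projS k v) : V)‖
  have hcauchy : ‖⟪π.projK (k + 1) (v : V), π.projK (k + 1) (π.ladder 1 v)⟫_ℂ‖ ≤ b * c := by
    rw [hladder]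
    exact norm_inner_le_norm _ _
  refine (mul_le_mul_of_nonneg_left hcauchy hρ).trans (le_of_sq_le_sq ?_ (by positivity))
  calc (ρ * (b * c)) ^ 2 = ρ ^ 2 * c ^ 2 * b ^ 2 := by ring
    _ ≤ 4 * p * q * a ^ 2 * b ^ 2 := by gcongr
    _ = 4 * (p * a ^ 2) * (q * b ^ 2) := by ring
    _ ≤ (p * a ^ 2 + q * b ^ 2) ^ 2 := by linarith [sq_nonneg (p * a ^ 2 - q * b ^ 2)]

lemma norm_inner_dpi_Hg_le_norm_sq_Xi_sub (π : UnitaryRep V) {lam : ℝ}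
    (h : π.HasCasimirScalar lam) (hlam : 0 < lam) {ρ : ℝ} (hρ : 0 ≤ ρ)
    (hρ1 : ρ ^ 2 * (lam + 6) ≤ 1) {v : π.smooth} (hv : π.projK 0 v = 0) :
    ρ * ‖⟪(v : V), π.dpi Hg v⟫_ℂ‖ ≤ ‖(π.dpi Xi v : V)‖ ^ 2 - 9 / 10 * ‖(v : V)‖ ^ 2 := by
  let up (k : ℤ) : ℝ := offDiagWeight k (k + 1) * ‖π.projK k (v : V)‖ ^ 2
  let down (k : ℤ) : ℝ := offDiagWeight k (k - 1) * ‖π.projK k (v : V)‖ ^ 2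
  have hup (k : ℤ) : 0 ≤ up k := mul_nonneg (offDiagWeight_nonneg _ _) (sq_nonneg _)
  have hdown (k : ℤ) : 0 ≤ down k := mul_nonneg (offDiagWeight_nonneg _ _) (sq_nonneg _)
  have hdiag := (π.hasSum_norm_sq_Xi v).sub ((π.hasSum_norm_sq_projK (v : V)).mul_left (9 / 10))
  have hle (k : ℤ) : up k + down k
      ≤ (k : ℝ) ^ 2 * ‖π.projK k (v : V)‖ ^ 2 - 9 / 10 * ‖π.projK k (v : V)‖ ^ 2 := by
    rcases eq_or_ne k 0 with rfl | hk
    · simp [up, down, hv]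
    · rw [← add_mul, ← sub_mul]
      exact mul_le_mul_of_nonneg_right (offDiagWeight_add_le hk) (sq_nonneg _)
  have hup_summable : Summable up :=
    .of_nonneg_of_le hup (fun k => by linarith [hle k, hdown k]) hdiag.summable
  have hdown_summable : Summable down :=
    .of_nonneg_of_le hdown (fun k => by linarith [hle k, hup k]) hdiag.summable
  have hdown_shift : HasSum (fun k => down (k + 1)) (∑' k, down k) :=
    (Equiv.addRight (1 : ℤ)).hasSum_iff.2 hdown_summable.hasSum
  have hladder : HasSum (fun k => (ρ : ℂ) * ⟪π.projK (k + 1) (v : V),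
      π.projK (k + 1) (π.ladder 1 v)⟫_ℂ) (ρ * ⟪(v : V), π.ladder 1 v⟫_ℂ) :=
    ((Equiv.addRight (1 : ℤ)).hasSum_iff.2 (π.hasSum_inner_projK (v : V) (π.ladder 1 v))).mul_left _
  have hnorm (z : ℂ) : ‖(ρ : ℂ) * z‖ = ρ * ‖z‖ := by
    rw [norm_mul, Complex.norm_real, Real.norm_of_nonneg hρ]
  calc ρ * ‖⟪(v : V), π.dpi Hg v⟫_ℂ‖
      ≤ ‖(ρ : ℂ) * ⟪(v : V), π.ladder 1 v⟫_ℂ‖ := by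
        rw [hnorm]
        exact mul_le_mul_of_nonneg_left (π.norm_inner_dpi_Hg_le v) hρ
    _ ≤ ∑' k, up k + ∑' k, down k := by
        refine hladder.norm_le_of_bounded (hup_summable.hasSum.add hdown_shift) fun k => ?_
        rw [hnorm]
        simpa only [up, down, add_sub_cancel_right]
          using π.norm_inner_projK_ladder_le h hlam hρ hρ1 hv k
    _ ≤ ‖(π.dpi Xi v : V)‖ ^ 2 - 9 / 10 * ‖(v : V)‖ ^ 2 :=
        hasSum_le hle (hup_summable.hasSum.add hdown_summable.hasSum) hdiag

instance (π : UnitaryRep V) : CompleteSpace π.nonspherical :=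
  (ContinuousLinearMap.isClosed_ker (π.projK 0)).completeSpace_coe

/-- The operator `-Ξ²` from `smoothNonspherical` to `nonspherical`. -/
def laplNS (π : UnitaryRep V) : π.smoothNonspherical →ₗ[ℂ] π.nonspherical :=
  (π.smooth.subtype ∘ₗ π.lapl ∘ₗ π.smoothNonspherical.subtype).codRestrict _ fun v => by
    change π.projK 0 (π.lapl v) = 0
    rw [projK_lapl, Int.cast_zero, zero_pow two_ne_zero, zero_smul]

/-- The operator `H` compressed to `nonspherical`. -/
def geoNS (π : UnitaryRep V) : π.smoothNonspherical →ₗ[ℂ] π.nonspherical :=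
  π.nonspherical.orthogonalProjectionOnto.toLinearMap ∘ₗ
    π.smooth.subtype ∘ₗ π.dpi Hg ∘ₗ π.smoothNonspherical.subtype

lemma coe_laplNS (π : UnitaryRep V) (v : π.smoothNonspherical) :
    (π.laplNS v : V) = π.lapl v := rfl

lemma geoNS_apply (π : UnitaryRep V) (v : π.smoothNonspherical) :
    π.geoNS v = π.nonspherical.orthogonalProjectionOnto (π.dpi Hg v : V) := rfl

lemma norm_laplNS_sub (π : UnitaryRep V) (ζ : ℂ) (v : π.smoothNonspherical) :
    ‖(π.laplNS - ζ • π.inclNS) v‖ = ‖(π.lapl v : V) - ζ • ((v : π.smooth) : V)‖ := rfl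

lemma norm_geoNS_le (π : UnitaryRep V) (v : π.smoothNonspherical) :
    ‖π.geoNS v‖ ≤ ‖(π.dpi Hg v : V)‖ := by
  rw [geoNS_apply]
  exact π.nonspherical.norm_orthogonalProjectionOnto_apply_le (π.dpi Hg v : V)

lemma inner_laplNS_sub_geoNS_sub (π : UnitaryRep V) (a b : ℂ) (w : π.nonspherical)
    (v : π.smoothNonspherical) :
    ⟪w, π.laplNS v - a • π.geoNS v - b • π.inclNS v⟫_ℂ
      = ⟪(w : V), (π.lapl v : V) - a • (π.dpi Hg v : V) - b • ((v : π.smooth) : V)⟫_ℂ := by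
  simp only [inner_sub_right, inner_smul_right, geoNS_apply,
    Submodule.inner_orthogonalProjectionOnto_eq_of_mem_left]
  rfl

lemma denseRange_laplNS_sub (π : UnitaryRep V) {ζ : ℂ} (hζ : ζ ∈ spectralHalfPlane) :
    DenseRange (π.laplNS - ζ • π.inclNS) := by
  suffices h : (π.laplNS - ζ • π.inclNS).rangeᗮ = ⊥ by
    rwa [← Submodule.topologicalClosure_eq_top_iff,
      ← Submodule.dense_iff_topologicalClosure_eq_top] at h
  refine (Submodule.eq_bot_iff _).2 fun w hw => ?_
  refine Subtype.ext (π.eq_zero_of_projK_eq_zero fun k => ?_)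
  rcases eq_or_ne k 0 with rfl | hk
  · exact (π.mem_nonspherical _).1 w.2
  refine π.dense_smooth.eq_zero_of_inner_right (𝕜 := ℂ) fun u hu => ?_
  let p : π.smooth := π.projS k ⟨u, hu⟩
  have hp : π.projK 0 p = 0 := π.projK_projK_of_ne hk.symm u
  have hlapl : π.lapl p = (k : ℂ) ^ 2 • p := π.lapl_eq_of_dpi_Xi_eq (π.dpi_Xi_projS k _)
  have hinner : ⟪(π.lapl p : V) - ζ • (p : V), (w : V)⟫_ℂ = 0 :=
    (Submodule.mem_orthogonal _ _).1 hw _ ⟨(⟨p, hp⟩ : π.smoothNonspherical), rfl⟩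
  rw [hlapl, Submodule.coe_smul, ← sub_smul, inner_smul_left, mul_eq_zero, map_eq_zero] at hinner
  rw [inner_projK_right]
  refine hinner.resolve_left fun hzero => ?_
  have hpos := sq_half_le_norm_sq_sub hk hζ
  rw [hzero, norm_zero] at hpos
  linarith [one_le_intCast_sq hk]

lemma relBounded (π : UnitaryRep V) {lam L : ℝ} (h : π.HasCasimirScalar lam) (hL : lam ≤ L)
    (hL0 : 0 ≤ L) :
    RelBounded π.inclNS π.laplNS π.geoNS spectralHalfPlane (√(L + 4)) 2 where
  nonneg := Real.sqrt_nonneg _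
  zero_mem := by simp [spectralHalfPlane]
  conj_mem ζ hζ := by simpa [spectralHalfPlane] using hζ
  denseRange_sub ζ hζ := π.denseRange_laplNS_sub hζ
  norm_perturbation_le ζ hζ v := by
    rw [norm_laplNS_sub]
    refine (π.norm_geoNS_le v).trans (le_of_sq_le_sq ?_ (by positivity))
    rw [mul_pow, Real.sq_sqrt (by positivity)]
    exact π.norm_sq_Hg_le h hL hL0 hζ v.2
  norm_le_sub ζ hζ v := by
    rw [norm_laplNS_sub, Submodule.coe_norm, coe_laplNS]
    exact π.norm_lapl_le hζ v.2
  norm_incl_le v := by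
    rw [Submodule.coe_norm, Submodule.coe_norm, coe_laplNS, coe_inclNS]
    simpa using π.norm_le_norm_lapl_sub (ζ := 0) (by simp [spectralHalfPlane]) v.2

lemma coercive (π : UnitaryRep V) {lam : ℝ} (h : π.HasCasimirScalar lam) (hlam : 0 < lam)
    {x ζ : ℂ} (hx : ‖x‖ ^ 2 * (lam + 6) ≤ 1) (hζ : ζ ∈ spectralHalfPlane)
    (v : π.smoothNonspherical) :
    2 / 5 * ‖π.inclNS v‖ ^ 2
      ≤ (⟪π.inclNS v, π.laplNS v - conj x • π.geoNS v - conj ζ • π.inclNS v⟫_ℂ).re := by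
  set w : V := ((v : π.smooth) : V)
  have hexpand : ⟪π.inclNS v, π.laplNS v - conj x • π.geoNS v - conj ζ • π.inclNS v⟫_ℂ
      = ((‖(π.dpi Xi v : V)‖ ^ 2 : ℝ) : ℂ) - conj x * ⟪w, π.dpi Hg v⟫_ℂ
        - conj ζ * ((‖w‖ ^ 2 : ℝ) : ℂ) := by
    rw [inner_laplNS_sub_geoNS_sub, coe_inclNS, inner_sub_right, inner_sub_right, inner_smul_right,
      inner_smul_right, inner_lapl_self, inner_self_eq_norm_sq_to_K]
    push_cast
    rfl
  have hHg := π.norm_inner_dpi_Hg_le_norm_sq_Xi_sub h hlam (norm_nonneg x) hx v.2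
  have hre := (conj x * ⟪w, π.dpi Hg v⟫_ℂ).re_le_norm
  rw [norm_mul, RCLike.norm_conj] at hre
  have hζ_mul : ζ.re * ‖w‖ ^ 2 ≤ 1 / 2 * ‖w‖ ^ 2 := mul_le_mul_of_nonneg_right hζ (sq_nonneg _)
  rw [hexpand, Submodule.coe_norm, coe_inclNS, sub_re, sub_re, ofReal_re, re_mul_ofReal, conj_re]
  linarith

end UnitaryRep

end Estimates

/-! ### Weak solutions -/

section Schur

open scoped InnerProductSpace
open Complex

variable {V : Type*} [NormedAddCommGroup V] [InnerProductSpace ℂ V]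

namespace UnitaryRep

/-- The formal adjoint `-Ξ² - x̄H - ζ̄` of `-Ξ² + xH - ζ` on smooth vectors. -/
def formalAdj (π : UnitaryRep V) (x ζ : ℂ) : Module.End ℂ π.smooth :=
  π.formalT (-conj x) - conj ζ • 1

lemma coe_formalAdj (π : UnitaryRep V) (x ζ : ℂ) (v : π.smooth) :
    (π.formalAdj x ζ v : V) = (π.lapl v : V) - conj x • (π.dpi Hg v : V) - conj ζ • (v : V) := by
  have hformalT : π.formalT (-conj x) v = π.lapl v - conj x • π.dpi Hg v := by
    rw [formalT, LinearMap.add_apply, LinearMap.smul_apply, neg_smul, ← sub_eq_add_neg, lapl]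
  rw [formalAdj, LinearMap.sub_apply, hformalT]
  rfl

/-- The weak formulation of the equation `(T(x) - ζ) u = w`. -/
def WeakSol (π : UnitaryRep V) (x ζ : ℂ) (u w : V) : Prop :=
  ∀ v : π.smooth, ⟪w, (v : V)⟫_ℂ = ⟪u, π.formalAdj x ζ v⟫_ℂ

/-- `φ` is a smooth unit vector spanning the `K`-fixed vectors. -/
structure IsSpherical (π : UnitaryRep V) (φ : π.smooth) : Prop where
  norm_eq : ‖(φ : V)‖ = 1
  projK_zero : π.projK 0 φ = (φ : V)
  projK_zero_eq : ∀ u : V, π.projK 0 u = ⟪(φ : V), u⟫_ℂ • (φ : V)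

namespace IsSpherical

variable {π : UnitaryRep V} {φ : π.smooth}

lemma inner_self (hφ : π.IsSpherical φ) : ⟪(φ : V), (φ : V)⟫_ℂ = 1 := by
  rw [inner_self_eq_norm_sq_to_K, hφ.norm_eq, RCLike.ofReal_one, one_pow]

lemma ne_zero (hφ : π.IsSpherical φ) : (φ : V) ≠ 0 :=
  norm_ne_zero_iff.1 (hφ.norm_eq.trans_ne one_ne_zero)

lemma projK_zero_eq_zero_iff (hφ : π.IsSpherical φ) (u : V) :
    π.projK 0 u = 0 ↔ ⟪(φ : V), u⟫_ℂ = 0 := by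
  rw [hφ.projK_zero_eq, smul_eq_zero, or_iff_left hφ.ne_zero]

lemma projK_zero_sub (hφ : π.IsSpherical φ) (u : V) :
    π.projK 0 (u - ⟪(φ : V), u⟫_ℂ • (φ : V)) = 0 := by
  rw [map_sub, map_smul, hφ.projK_zero, hφ.projK_zero_eq, sub_self]

lemma weakSol_iff_nonspherical (hφ : π.IsSpherical φ) {x ζ : ℂ} {u w : V} :
    π.WeakSol x ζ u w ↔
      (∀ v : π.smooth, π.projK 0 v = 0 → ⟪w, (v : V)⟫_ℂ = ⟪u, π.formalAdj x ζ v⟫_ℂ) ∧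
        ⟪w, (φ : V)⟫_ℂ = ⟪u, π.formalAdj x ζ φ⟫_ℂ := by
  refine ⟨fun h => ⟨fun v _ => h v, h φ⟩, fun ⟨hoff, hdiag⟩ v => ?_⟩
  set β := ⟪(φ : V), (v : V)⟫_ℂ
  have hsplit : v = (v - β • φ) + β • φ := by rw [sub_add_cancel]
  rw [hsplit, map_add, map_smul, Submodule.coe_add, Submodule.coe_add, Submodule.coe_smul,
    Submodule.coe_smul, inner_add_right, inner_add_right, inner_smul_right, inner_smul_right,
    hoff _ (hφ.projK_zero_sub v), hdiag]

end IsSpherical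

variable [CompleteSpace V]

lemma weakSol_iff (π : UnitaryRep V) (x ζ : ℂ) (u w : V) :
    π.WeakSol x ζ u w ↔ ∃ hu : u ∈ (π.T x).domain, π.T x ⟨u, hu⟩ - ζ • u = w := by
  have hdense : Dense ((π.formalTPMap (-conj x)).domain : Set V) := π.dense_smooth
  have hadj : π.WeakSol x ζ u w ↔ ∀ v : (π.formalTPMap (-conj x)).domain,
      ⟪w + ζ • u, (v : V)⟫_ℂ = ⟪u, π.formalTPMap (-conj x) v⟫_ℂ := by
    refine forall_congr' fun v => ?_
    have hcoe : (π.formalAdj x ζ v : V) = π.formalTPMap (-conj x) v - conj ζ • (v : V) := rfl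
    rw [hcoe, inner_sub_right, inner_add_left, inner_smul_left, inner_smul_right,
      eq_sub_iff_add_eq]
  rw [hadj]
  constructor
  · intro h
    have hu : u ∈ (π.T x).domain := LinearPMap.mem_adjoint_domain_of_exists u ⟨w + ζ • u, h⟩
    have hT : π.T x ⟨u, hu⟩ = w + ζ • u := LinearPMap.adjoint_apply_eq hdense ⟨u, hu⟩ h
    exact ⟨hu, by rw [hT, add_sub_cancel_right]⟩
  · rintro ⟨hu, rfl⟩ v
    rw [sub_add_cancel]
    exact LinearPMap.adjoint_isFormalAdjoint hdense ⟨u, hu⟩ v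

lemma mem_resolventSet_of_weakSol (π : UnitaryRep V) {x ζ : ℂ} (R : V →L[ℂ] V)
    (h : ∀ u w, π.WeakSol x ζ u w ↔ u = R w) : ζ ∈ resolventSet (π.T x) :=
  ⟨R, fun w => (π.weakSol_iff x ζ _ w).1 ((h _ w).2 rfl),
    fun u => ((h _ _).1 ((π.weakSol_iff x ζ u _).2 ⟨u.2, rfl⟩)).symm⟩

/-- The resolvent on the complement of the `K`-fixed vectors, extended by zero. -/
def resNS (π : UnitaryRep V) {C M : ℝ}
    (hR : RelBounded π.inclNS π.laplNS π.geoNS spectralHalfPlane C M) (x ζ : ℂ) : V →L[ℂ] V :=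
  π.nonspherical.subtypeL ∘L hR.resolvent x ζ ∘L π.nonspherical.orthogonalProjectionOnto

section Resolvent

variable (π : UnitaryRep V) {C M : ℝ}
  (hR : RelBounded π.inclNS π.laplNS π.geoNS spectralHalfPlane C M) {x ζ : ℂ}

lemma resNS_apply (w : V) :
    π.resNS hR x ζ w = (hR.resolvent x ζ (π.nonspherical.orthogonalProjectionOnto w) : V) := rfl

lemma projK_zero_resNS (w : V) : π.projK 0 (π.resNS hR x ζ w) = 0 :=
  (hR.resolvent x ζ (π.nonspherical.orthogonalProjectionOnto w)).2

lemma eq_resNS_iff (hx : ‖x‖ * C < 1) (hζ : ζ ∈ spectralHalfPlane) {u : V}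
    (hu : π.projK 0 u = 0) (w : V) :
    u = π.resNS hR x ζ w ↔
      ∀ v : π.smooth, π.projK 0 v = 0 → ⟪w, (v : V)⟫_ℂ = ⟪u, π.formalAdj x ζ v⟫_ℂ := by
  let u' : π.nonspherical := ⟨u, hu⟩
  have hiff := hR.inner_eq_iff_eq_resolvent hx hζ u' (π.nonspherical.orthogonalProjectionOnto w)
  simp only [inner_laplNS_sub_geoNS_sub, ← coe_formalAdj,
    Submodule.inner_orthogonalProjectionOnto_eq_of_mem_right, coe_inclNS] at hiff
  rw [resNS_apply, ← Subtype.ext_iff (a1 := u'), ← hiff]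
  exact ⟨fun h v hv => h ⟨v, hv⟩, fun h v => h v v.2⟩

lemma resNS_sub_resNS {η : ℂ} (hx : ‖x‖ * C < 1) (hζ : ζ ∈ spectralHalfPlane)
    (hη : η ∈ spectralHalfPlane) (w : V) :
    π.resNS hR x ζ w - π.resNS hR x η w = (ζ - η) • π.resNS hR x ζ (π.resNS hR x η w) := by
  simp only [resNS_apply, Submodule.orthogonalProjectionOnto_mem_subspace_eq_self]
  exact congrArg Subtype.val (hR.resolvent_sub_resolvent hx hζ hη _)

lemma differentiableOn_inner_resNS {U : Set ℂ} {f : ℂ → ℂ} (hf : DifferentiableOn ℂ f U)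
    (hU : ∀ x ∈ U, ‖x‖ * C < 1) (hfZ : Set.MapsTo f U spectralHalfPlane) (u w : V) :
    DifferentiableOn ℂ (fun x => ⟪u, π.resNS hR x (f x) w⟫_ℂ) U := by
  let evalInner : (π.nonspherical →L[ℂ] π.nonspherical) →L[ℂ] ℂ :=
    (innerSL ℂ u ∘L π.nonspherical.subtypeL) ∘L
      ContinuousLinearMap.apply ℂ π.nonspherical (π.nonspherical.orthogonalProjectionOnto w)
  have hcomp : DifferentiableOn ℂ (fun x => evalInner (hR.resolvent x (f x))) U :=
    evalInner.differentiable.comp_differentiableOn (hR.differentiableOn_resolvent hf hU hfZ)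
  exact hcomp

lemma norm_resNS_le {lam : ℝ} (h : π.HasCasimirScalar lam) (hlam : 0 < lam)
    (hx : ‖x‖ * C < 1) (hx' : ‖x‖ ^ 2 * (lam + 6) ≤ 1) (hζ : ζ ∈ spectralHalfPlane) (w : V) :
    ‖π.resNS hR x ζ w‖ ≤ 5 / 2 * ‖w‖ := by
  calc ‖π.resNS hR x ζ w‖
      ≤ (2 / 5)⁻¹ * ‖π.nonspherical.orthogonalProjectionOnto w‖ :=
        hR.norm_resolvent_le hx hζ (by norm_num) (π.coercive h hlam hx' hζ) _
    _ ≤ 5 / 2 * ‖w‖ := by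
        rw [inv_div]
        gcongr
        exact π.nonspherical.norm_orthogonalProjectionOnto_apply_le w

include hR in
lemma mem_resolventSet_of_projK_zero (h0 : ∀ u, π.projK 0 u = 0) (hx : ‖x‖ * C < 1)
    (hζ : ζ ∈ spectralHalfPlane) : ζ ∈ resolventSet (π.T x) :=
  π.mem_resolventSet_of_weakSol (π.resNS hR x ζ) fun u w => by
    rw [π.eq_resNS_iff hR hx hζ (h0 u)]
    exact ⟨fun h v _ => h v, fun h v => h v (h0 _)⟩

end Resolvent

namespace IsSpherical

variable {π : UnitaryRep V} {φ : π.smooth}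

lemma dpi_Xi_eq_zero (hφ : π.IsSpherical φ) : π.dpi Xi φ = 0 :=
  π.dpi_Xi_of_projK_zero hφ.projK_zero

lemma lapl_eq_zero (hφ : π.IsSpherical φ) : π.lapl φ = 0 := by
  rw [lapl_apply, hφ.dpi_Xi_eq_zero, map_zero, neg_zero]

lemma inner_lapl_eq_zero (hφ : π.IsSpherical φ) (v : π.smooth) :
    ⟪(φ : V), (π.lapl v : V)⟫_ℂ = 0 := by
  rw [lapl_apply, Submodule.coe_neg, inner_neg_right, inner_dpi_right, hφ.dpi_Xi_eq_zero,
    Submodule.coe_zero, inner_zero_left, neg_zero, neg_zero]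

lemma projK_ladder (hφ : π.IsSpherical φ) {e : ℤ} (he : e = 1 ∨ e = -1) :
    π.projK e (π.ladder e φ) = (π.ladder e φ : V) := by
  simpa only [zero_add] using π.projK_ladder_of_projK_eq he hφ.projK_zero

lemma projK_zero_Hg (hφ : π.IsSpherical φ) : π.projK 0 (π.dpi Hg φ) = 0 := by
  rw [dpi_Hg_eq_ladder, Submodule.coe_smul, Submodule.coe_add, map_smul, map_add,
    ← hφ.projK_ladder (.inl rfl), ← hφ.projK_ladder (.inr rfl),
    projK_projK_of_ne π (by decide), projK_projK_of_ne π (by decide), add_zero, smul_zero]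

lemma lapl_ladder (hφ : π.IsSpherical φ) {e : ℤ} (he : e = 1 ∨ e = -1) :
    π.lapl (π.ladder e φ) = π.ladder e φ := by
  have he_sq : (e : ℂ) ^ 2 = 1 := by rcases he with rfl | rfl <;> norm_num
  rw [π.lapl_eq_of_dpi_Xi_eq (π.dpi_Xi_eq_of_projK_eq e (hφ.projK_ladder he)), he_sq, one_smul]

lemma lapl_Hg (hφ : π.IsSpherical φ) : π.lapl (π.dpi Hg φ) = π.dpi Hg φ := by
  rw [dpi_Hg_eq_ladder, map_smul, map_add, hφ.lapl_ladder (.inl rfl), hφ.lapl_ladder (.inr rfl)]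

lemma norm_sq_Hg (hφ : π.IsSpherical φ) {lam : ℝ} (h : π.HasCasimirScalar lam) :
    ‖(π.dpi Hg φ : V)‖ ^ 2 = lam / 8 := by
  have hup := π.norm_sq_ladder h (.inl rfl) 0 hφ.projK_zero
  have hdown := π.norm_sq_ladder h (.inr rfl) 0 hφ.projK_zero
  have horth : ⟪(π.ladder 1 φ : V), (π.ladder (-1) φ : V)⟫_ℂ = 0 := by
    rw [← hφ.projK_ladder (.inl rfl), ← hφ.projK_ladder (.inr rfl),
      inner_projK_of_ne π (by decide)]
  have hpyth := norm_add_sq_eq_norm_sq_add_norm_sq_of_inner_eq_zero _ _ horth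
  rw [← pow_two, ← pow_two, ← pow_two, hup, hdown, hφ.norm_eq] at hpyth
  rw [dpi_Hg_eq_ladder, Submodule.coe_smul, Submodule.coe_add, norm_smul, mul_pow, hpyth]
  norm_num
  ring

lemma inner_formalAdj_of_projK_zero (hφ : π.IsSpherical φ) (x ζ : ℂ) {v : π.smooth}
    (hv : π.projK 0 v = 0) :
    ⟪(φ : V), π.formalAdj x ζ v⟫_ℂ = conj x * ⟪(π.dpi Hg φ : V), (v : V)⟫_ℂ := by
  rw [coe_formalAdj, inner_sub_right, inner_sub_right, inner_smul_right, inner_smul_right,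
    hφ.inner_lapl_eq_zero, inner_dpi_right, (hφ.projK_zero_eq_zero_iff _).1 hv]
  ring

lemma inner_formalAdj_self (hφ : π.IsSpherical φ) (x ζ : ℂ) (u : V) :
    ⟪u, π.formalAdj x ζ φ⟫_ℂ
      = -(conj x * ⟪u, (π.dpi Hg φ : V)⟫_ℂ) - conj ζ * ⟪u, (φ : V)⟫_ℂ := by
  rw [coe_formalAdj, inner_sub_right, inner_sub_right, inner_smul_right, inner_smul_right,
    hφ.lapl_eq_zero, Submodule.coe_zero, inner_zero_right, zero_sub]

lemma inner_eq_inner_add_smul_formalAdj_iff (hφ : π.IsSpherical φ) {x ζ : ℂ} {u : V} (α : ℂ)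
    (w : V) {v : π.smooth} (hv : π.projK 0 v = 0) :
    ⟪w, (v : V)⟫_ℂ = ⟪u + α • (φ : V), π.formalAdj x ζ v⟫_ℂ ↔
      ⟪w - (α * x) • (π.dpi Hg φ : V), (v : V)⟫_ℂ = ⟪u, π.formalAdj x ζ v⟫_ℂ := by
  rw [inner_add_left, inner_smul_left, hφ.inner_formalAdj_of_projK_zero x ζ hv, inner_sub_left,
    inner_smul_left, map_mul, mul_assoc, sub_eq_iff_eq_add]

lemma inner_eq_inner_add_smul_formalAdj_self_iff (hφ : π.IsSpherical φ) {x ζ : ℂ} {u : V}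
    (hu : π.projK 0 u = 0) (α : ℂ) (w : V) :
    ⟪w, (φ : V)⟫_ℂ = ⟪u + α • (φ : V), π.formalAdj x ζ φ⟫_ℂ ↔
      ⟪(φ : V), w⟫_ℂ = -(x * ⟪(π.dpi Hg φ : V), u⟫_ℂ) - ζ * α := by
  have hφH : ⟪(φ : V), (π.dpi Hg φ : V)⟫_ℂ = 0 :=
    (hφ.projK_zero_eq_zero_iff _).1 hφ.projK_zero_Hg
  have huφ : ⟪u, (φ : V)⟫_ℂ = 0 := inner_eq_zero_symm.1 ((hφ.projK_zero_eq_zero_iff _).1 hu)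
  rw [hφ.inner_formalAdj_self, inner_add_left, inner_add_left, inner_smul_left, inner_smul_left,
    hφH, huφ, hφ.inner_self, ← (starRingEnd ℂ).injective.eq_iff]
  simp only [map_sub, map_neg, map_mul, inner_conj_symm, conj_conj, mul_zero, add_zero, zero_add,
    mul_one]

lemma weakSol_add_smul_iff (hφ : π.IsSpherical φ) {C M : ℝ}
    (hR : RelBounded π.inclNS π.laplNS π.geoNS spectralHalfPlane C M) {x ζ : ℂ} (hx : ‖x‖ * C < 1)
    (hζ : ζ ∈ spectralHalfPlane) {u : V} (hu : π.projK 0 u = 0) (α : ℂ) (w : V) :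
    π.WeakSol x ζ (u + α • (φ : V)) w ↔
      u = π.resNS hR x ζ (w - (α * x) • (π.dpi Hg φ : V)) ∧
        ⟪(φ : V), w⟫_ℂ = -(x * ⟪(π.dpi Hg φ : V), u⟫_ℂ) - ζ * α := by
  rw [hφ.weakSol_iff_nonspherical, π.eq_resNS_iff hR hx hζ hu,
    hφ.inner_eq_inner_add_smul_formalAdj_self_iff hu]
  refine and_congr_left fun _ => forall₂_congr fun v hv => ?_
  exact hφ.inner_eq_inner_add_smul_formalAdj_iff α w hv

end IsSpherical

end UnitaryRep

end Schur

/-! ### The Schur complement -/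

section Multiplicity

variable {V : Type*} [NormedAddCommGroup V] [NormedSpace ℂ V] {T : V →ₗ.[ℂ] V} {ζ : ℂ}

lemma mem_spec_of_apply_eq_smul (u : T.domain) (hu : (u : V) ≠ 0) (hT : T u = ζ • (u : V)) :
    ζ ∈ spec T := by
  rintro ⟨R, -, hR⟩
  have hRu := hR u
  rw [hT, sub_self, map_zero] at hRu
  exact hu hRu.symm

lemma kerPow_le_span_singleton {e : V}
    (h : ∀ u : T.domain, T u - ζ • (u : V) ∈ Submodule.span ℂ {e} →
      (u : V) ∈ Submodule.span ℂ {e}) (n : ℕ) :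
    kerPow T ζ n ≤ Submodule.span ℂ {e} := by
  induction n with
  | zero => exact bot_le
  | succ n ih =>
    rintro u ⟨hu, hker⟩
    exact h ⟨u, hu⟩ (ih hker)

lemma isSimpleEigenvalue_of_forall_mem_span (e : T.domain) (he : (e : V) ≠ 0)
    (hT : T e = ζ • (e : V))
    (h : ∀ u : T.domain, T u - ζ • (u : V) ∈ Submodule.span ℂ {(e : V)} →
      (u : V) ∈ Submodule.span ℂ {(e : V)}) :
    IsSimpleEigenvalue T ζ := by
  have he_mem : (e : V) ∈ kerPow T ζ 1 := ⟨e.2, sub_eq_zero.2 hT⟩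
  have hsup : (⨆ n, kerPow T ζ n) = Submodule.span ℂ {(e : V)} :=
    le_antisymm (iSup_le (kerPow_le_span_singleton h))
      ((Submodule.span_singleton_le_iff_mem _ _).2 (Submodule.mem_iSup_of_mem 1 he_mem))
  exact ⟨⟨e, he, hT⟩, by rw [hsup, finrank_span_singleton he]⟩

end Multiplicity

section Eigenvalue

open scoped InnerProductSpace NNReal
open Complex

variable {V : Type*} [NormedAddCommGroup V] [InnerProductSpace ℂ V] [CompleteSpace V]

lemma mul_sqrt_add_four_lt_one {t lam : ℝ} (hlam : 0 < lam) (ht : t ^ 2 * (lam + 6) < 1) :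
    t * √(lam + 4) < 1 := by
  refine lt_of_pow_lt_pow_left₀ 2 zero_le_one ?_
  rw [mul_pow, Real.sq_sqrt (by positivity)]
  linarith [sq_nonneg t]

namespace UnitaryRep

section SchurComplement

variable {π : UnitaryRep V} {φ : π.smooth} {C M : ℝ}
  {hR : RelBounded π.inclNS π.laplNS π.geoNS spectralHalfPlane C M} {x ζ : ℂ}

/-- The matrix coefficient of the resolvent off the `K`-fixed vectors that enters the Schur
complement `x² ⟪Hφ, R(x, ζ) Hφ⟫ - ζ` of `T(x) - ζ` on the line of the spherical vector `φ`. -/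
def schurCoeff (π : UnitaryRep V) {C M : ℝ}
    (hR : RelBounded π.inclNS π.laplNS π.geoNS spectralHalfPlane C M) (φ : π.smooth) (x ζ : ℂ) :
    ℂ :=
  ⟪(π.dpi Hg φ : V), π.resNS hR x ζ (π.dpi Hg φ)⟫_ℂ

/-- The vector with component `φ` along the spherical vector on which `T(x) - ζ` takes values in
the line of `φ`; it is the eigenvector when the Schur complement vanishes. -/
def schurVec (π : UnitaryRep V) {C M : ℝ}
    (hR : RelBounded π.inclNS π.laplNS π.geoNS spectralHalfPlane C M) (φ : π.smooth) (x ζ : ℂ) :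
    V :=
  φ - x • π.resNS hR x ζ (π.dpi Hg φ)

lemma schurCoeff_sub_schurCoeff (hx : ‖x‖ * C < 1) (hζ : ζ ∈ spectralHalfPlane) {η : ℂ}
    (hη : η ∈ spectralHalfPlane) :
    π.schurCoeff hR φ x ζ - π.schurCoeff hR φ x η
      = (ζ - η) * ⟪(π.dpi Hg φ : V), π.resNS hR x ζ (π.resNS hR x η (π.dpi Hg φ))⟫_ℂ := by
  rw [schurCoeff, schurCoeff, ← inner_sub_right, π.resNS_sub_resNS hR hx hζ hη, inner_smul_right]

namespace IsSpherical

lemma inner_resNS (hφ : π.IsSpherical φ) (w : V) : ⟪(φ : V), π.resNS hR x ζ w⟫_ℂ = 0 :=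
  (hφ.projK_zero_eq_zero_iff _).1 (π.projK_zero_resNS hR w)

lemma resNS_self (hφ : π.IsSpherical φ) : π.resNS hR x ζ φ = 0 := by
  have horth : (φ : V) ∈ π.nonsphericalᗮ := (Submodule.mem_orthogonal' _ _).2 fun w hw =>
    (hφ.projK_zero_eq_zero_iff w).1 ((π.mem_nonspherical w).1 hw)
  rw [resNS_apply, Submodule.orthogonalProjectionOnto_apply_of_mem_orthogonal horth, map_zero,
    Submodule.coe_zero]

lemma resNS_zero_zero_Hg (hφ : π.IsSpherical φ) :
    π.resNS hR 0 0 (π.dpi Hg φ) = (π.dpi Hg φ : V) := by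
  refine ((π.eq_resNS_iff hR (by simp) (by simp [spectralHalfPlane]) hφ.projK_zero_Hg _).2
    fun v _ => ?_).symm
  have hsymm : ⟪(π.dpi Hg φ : V), (π.lapl v : V)⟫_ℂ = ⟪(π.lapl (π.dpi Hg φ) : V), (v : V)⟫_ℂ := by
    simp only [lapl_apply, Submodule.coe_neg, inner_neg_right, inner_neg_left, inner_dpi_right,
      neg_neg]
  rw [coe_formalAdj, map_zero, zero_smul, zero_smul, sub_zero, sub_zero, hsymm, hφ.lapl_Hg]

lemma inner_schurVec (hφ : π.IsSpherical φ) : ⟪(φ : V), π.schurVec hR φ x ζ⟫_ℂ = 1 := by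
  rw [schurVec, inner_sub_right, inner_smul_right, hφ.inner_resNS, hφ.inner_self, mul_zero,
    sub_zero]

lemma schurVec_ne_zero (hφ : π.IsSpherical φ) : π.schurVec hR φ x ζ ≠ 0 := by
  intro hzero
  have hone := hφ.inner_schurVec (hR := hR) (x := x) (ζ := ζ)
  rw [hzero, inner_zero_right] at hone
  exact zero_ne_one hone

lemma resNS_schurVec (hφ : π.IsSpherical φ) :
    π.resNS hR x ζ (π.schurVec hR φ x ζ)
      = -(x • π.resNS hR x ζ (π.resNS hR x ζ (π.dpi Hg φ))) := by
  rw [schurVec, map_sub, hφ.resNS_self, map_smul, zero_sub]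

lemma weakSol_iff_schur (hφ : π.IsSpherical φ)
    (hR : RelBounded π.inclNS π.laplNS π.geoNS spectralHalfPlane C M) (hx : ‖x‖ * C < 1)
    (hζ : ζ ∈ spectralHalfPlane) (u w : V) :
    π.WeakSol x ζ u w ↔
      u = ⟪(φ : V), u⟫_ℂ • π.schurVec hR φ x ζ + π.resNS hR x ζ w ∧
        (x ^ 2 * π.schurCoeff hR φ x ζ - ζ) * ⟪(φ : V), u⟫_ℂ
          = ⟪(φ : V), w⟫_ℂ + x * ⟪(π.dpi Hg φ : V), π.resNS hR x ζ w⟫_ℂ := by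
  set α := ⟪(φ : V), u⟫_ℂ
  set u' := u - α • (φ : V) with hu'
  have hsplit : u = u' + α • (φ : V) := (sub_add_cancel u _).symm
  have hres : π.resNS hR x ζ (w - (α * x) • (π.dpi Hg φ : V))
      = π.resNS hR x ζ w - (α * x) • π.resNS hR x ζ (π.dpi Hg φ) := by rw [map_sub, map_smul]
  have hoff : u' = π.resNS hR x ζ (w - (α * x) • (π.dpi Hg φ : V)) ↔
      u = α • π.schurVec hR φ x ζ + π.resNS hR x ζ w := by
    rw [hres, hu', schurVec, smul_sub, smul_smul, sub_eq_iff_eq_add]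
    constructor <;> intro h <;> rw [h] <;> abel
  have hu'_proj : π.projK 0 u' = 0 := hφ.projK_zero_sub u
  have hweak := hφ.weakSol_add_smul_iff hR hx hζ hu'_proj α w
  rw [← hsplit] at hweak
  rw [hweak, ← hoff]
  refine and_congr_right fun hu'_eq => ?_
  rw [hu'_eq, hres, inner_sub_right, inner_smul_right, ← schurCoeff]
  constructor <;> intro h <;> linear_combination -h

lemma mem_resolventSet (hφ : π.IsSpherical φ) (hx : ‖x‖ * C < 1) (hζ : ζ ∈ spectralHalfPlane)
    (hne : x ^ 2 * π.schurCoeff hR φ x ζ ≠ ζ) : ζ ∈ resolventSet (π.T x) := by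
  set F := x ^ 2 * π.schurCoeff hR φ x ζ - ζ with hF
  have hF_ne : F ≠ 0 := sub_ne_zero.2 hne
  let ℓ : V →L[ℂ] ℂ :=
    F⁻¹ • (innerSL ℂ (φ : V) + x • (innerSL ℂ (π.dpi Hg φ : V) ∘L π.resNS hR x ζ))
  have hℓ (w : V) : F * ℓ w = ⟪(φ : V), w⟫_ℂ + x * ⟪(π.dpi Hg φ : V), π.resNS hR x ζ w⟫_ℂ :=
    mul_inv_cancel_left₀ hF_ne _
  refine π.mem_resolventSet_of_weakSol
    (ℓ.smulRight (π.schurVec hR φ x ζ) + π.resNS hR x ζ) fun u w => ?_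
  rw [hφ.weakSol_iff_schur hR hx hζ, ← hF, ← hℓ, mul_right_inj' hF_ne, _root_.add_apply,
    ContinuousLinearMap.smulRight_apply]
  constructor
  · rintro ⟨hu, hcoeff⟩
    rwa [hcoeff] at hu
  · intro hu
    have hcoeff : ⟪(φ : V), u⟫_ℂ = ℓ w := by
      rw [hu, inner_add_right, inner_smul_right, hφ.inner_schurVec, hφ.inner_resNS, mul_one,
        add_zero]
    exact ⟨by rwa [hcoeff], hcoeff⟩

lemma exists_T_schurVec_eq (hφ : π.IsSpherical φ) (hx : ‖x‖ * C < 1) (hζ : ζ ∈ spectralHalfPlane)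
    (heq : x ^ 2 * π.schurCoeff hR φ x ζ = ζ) :
    ∃ e : (π.T x).domain, (e : V) = π.schurVec hR φ x ζ ∧ π.T x e = ζ • (e : V) := by
  have hsol : π.WeakSol x ζ (π.schurVec hR φ x ζ) 0 := by
    rw [hφ.weakSol_iff_schur hR hx hζ, hφ.inner_schurVec, heq]
    simp
  obtain ⟨he, hT⟩ := (π.weakSol_iff x ζ _ _).1 hsol
  exact ⟨⟨_, he⟩, rfl, sub_eq_zero.1 hT⟩

lemma mem_spec_iff (hφ : π.IsSpherical φ) (hx : ‖x‖ * C < 1) (hζ : ζ ∈ spectralHalfPlane) :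
    ζ ∈ spec (π.T x) ↔ x ^ 2 * π.schurCoeff hR φ x ζ = ζ := by
  refine ⟨fun hspec => ?_, fun heq => ?_⟩
  · by_contra hne
    exact hspec (hφ.mem_resolventSet hx hζ hne)
  · obtain ⟨e, he, hT⟩ := hφ.exists_T_schurVec_eq hx hζ heq
    exact mem_spec_of_apply_eq_smul e (he ▸ hφ.schurVec_ne_zero) hT

lemma isSimpleEigenvalue (hφ : π.IsSpherical φ) (hx : ‖x‖ * C < 1) (hζ : ζ ∈ spectralHalfPlane)
    (heq : x ^ 2 * π.schurCoeff hR φ x ζ = ζ)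
    (hlt : ‖x ^ 2 * ⟪(π.dpi Hg φ : V), π.resNS hR x ζ (π.resNS hR x ζ (π.dpi Hg φ))⟫_ℂ‖ < 1) :
    IsSimpleEigenvalue (π.T x) ζ := by
  obtain ⟨e, he, hT⟩ := hφ.exists_T_schurVec_eq hx hζ heq
  refine isSimpleEigenvalue_of_forall_mem_span e (he ▸ hφ.schurVec_ne_zero) hT fun u hu => ?_
  rw [he] at hu ⊢
  obtain ⟨β, hβ⟩ := Submodule.mem_span_singleton.1 hu
  have hsol : π.WeakSol x ζ u (β • π.schurVec hR φ x ζ) :=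
    (π.weakSol_iff x ζ _ _).2 ⟨u.2, hβ.symm⟩
  obtain ⟨hu_eq, hscalar⟩ := (hφ.weakSol_iff_schur hR hx hζ _ _).1 hsol
  have hβ_zero : β = 0 := by
    rw [heq, sub_self, zero_mul, inner_smul_right, hφ.inner_schurVec, map_smul, hφ.resNS_schurVec,
      inner_smul_right, inner_neg_right, inner_smul_right] at hscalar
    by_contra hβ_ne
    have hone : x ^ 2 * ⟪(π.dpi Hg φ : V), π.resNS hR x ζ (π.resNS hR x ζ (π.dpi Hg φ))⟫_ℂ = 1 :=
      mul_left_cancel₀ hβ_ne (by linear_combination hscalar)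
    rw [hone, norm_one] at hlt
    exact lt_irrefl _ hlt
  rw [hβ_zero, zero_smul, map_zero, add_zero] at hu_eq
  exact Submodule.mem_span_singleton.2 ⟨_, hu_eq.symm⟩

variable {lam : ℝ}

lemma schurCoeff_zero_zero (hφ : π.IsSpherical φ) (h : π.HasCasimirScalar lam) :
    π.schurCoeff hR φ 0 0 = (lam : ℂ) / 8 := by
  have hnorm : (‖(π.dpi Hg φ : V)‖ : ℂ) ^ 2 = lam / 8 := mod_cast hφ.norm_sq_Hg h
  rw [schurCoeff, hφ.resNS_zero_zero_Hg, ← hnorm]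
  exact inner_self_eq_norm_sq_to_K _

lemma norm_schurCoeff_le (hφ : π.IsSpherical φ) (h : π.HasCasimirScalar lam) (hlam : 0 < lam)
    (hx : ‖x‖ * C < 1) (hx' : ‖x‖ ^ 2 * (lam + 6) ≤ 1) (hζ : ζ ∈ spectralHalfPlane) :
    ‖π.schurCoeff hR φ x ζ‖ ≤ 5 / 16 * lam := by
  set w := (π.dpi Hg φ : V)
  calc ‖π.schurCoeff hR φ x ζ‖ ≤ ‖w‖ * ‖π.resNS hR x ζ w‖ := norm_inner_le_norm _ _
    _ ≤ ‖w‖ * (5 / 2 * ‖w‖) := by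
        gcongr
        exact π.norm_resNS_le hR h hlam hx hx' hζ w
    _ = 5 / 2 * ‖w‖ ^ 2 := by ring
    _ = 5 / 16 * lam := by rw [hφ.norm_sq_Hg h]; ring

lemma norm_sq_mul_inner_resNS_resNS_le (hφ : π.IsSpherical φ) (h : π.HasCasimirScalar lam)
    (hlam : 0 < lam) (hx : ‖x‖ * C < 1) (hx' : ‖x‖ ^ 2 * (lam + 6) ≤ 1) {η : ℂ}
    (hζ : ζ ∈ spectralHalfPlane) (hη : η ∈ spectralHalfPlane) :
    ‖x ^ 2 * ⟪(π.dpi Hg φ : V), π.resNS hR x ζ (π.resNS hR x η (π.dpi Hg φ))⟫_ℂ‖ ≤ 25 / 32 := by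
  set w := (π.dpi Hg φ : V)
  have hres (ξ : ℂ) (hξ : ξ ∈ spectralHalfPlane) := π.norm_resNS_le hR h hlam hx hx' hξ
  calc ‖x ^ 2 * ⟪w, π.resNS hR x ζ (π.resNS hR x η w)⟫_ℂ‖
      ≤ ‖x‖ ^ 2 * (‖w‖ * ‖π.resNS hR x ζ (π.resNS hR x η w)‖) := by
        rw [norm_mul, norm_pow]
        gcongr
        exact norm_inner_le_norm _ _
    _ ≤ ‖x‖ ^ 2 * (‖w‖ * (5 / 2 * (5 / 2 * ‖w‖))) := by
        gcongr
        exact (hres ζ hζ _).trans (by gcongr; exact hres η hη w)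
    _ = 25 / 4 * (‖x‖ ^ 2 * ‖w‖ ^ 2) := by ring
    _ ≤ 25 / 32 := by
        rw [hφ.norm_sq_Hg h]
        linarith [sq_nonneg ‖x‖]

lemma exists_schur_fixedPoint (hφ : π.IsSpherical φ) (h : π.HasCasimirScalar lam) (hlam : 0 < lam)
    (hR : RelBounded π.inclNS π.laplNS π.geoNS spectralHalfPlane C M) {U : Set ℂ} (hU : IsOpen U)
    (hUC : ∀ x ∈ U, ‖x‖ * C < 1) (hUlam : ∀ x ∈ U, ‖x‖ ^ 2 * (lam + 6) ≤ 1) :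
    ∃ μ : ℂ → ℂ, DifferentiableOn ℂ μ U ∧ ∀ x ∈ U, ‖μ x‖ ≤ 1 / 2 ∧
      x ^ 2 * π.schurCoeff hR φ x (μ x) = μ x ∧
      ∀ ζ ∈ spectralHalfPlane, x ^ 2 * π.schurCoeff hR φ x ζ = ζ → ζ = μ x := by
  refine exists_differentiableOn_fixedPoint hU (fun x ζ => x ^ 2 * π.schurCoeff hR φ x ζ)
    isClosed_spectralHalfPlane one_half_pos.le closedBall_subset_spectralHalfPlane
    (κ := 25 / 32) (by rw [← NNReal.coe_lt_coe]; norm_num) (fun x hx ζ hζ => ?_)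
    (fun x hx => ?_) fun f hf hfZ => ?_
  · have hcoeff := hφ.norm_schurCoeff_le (hR := hR) h hlam (hUC x hx) (hUlam x hx) hζ
    rw [mem_closedBall_zero_iff, norm_mul, norm_pow]
    calc ‖x‖ ^ 2 * ‖π.schurCoeff hR φ x ζ‖ ≤ ‖x‖ ^ 2 * (5 / 16 * lam) := by gcongr
      _ ≤ 1 / 2 := by linarith [hUlam x hx, sq_nonneg ‖x‖]
  · refine LipschitzOnWith.of_dist_le_mul fun ζ hζ η hη => ?_
    rw [dist_eq_norm, dist_eq_norm, ← mul_sub, schurCoeff_sub_schurCoeff (hUC x hx) hζ hη,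
      mul_left_comm, norm_mul, mul_comm]
    gcongr
    exact hφ.norm_sq_mul_inner_resNS_resNS_le h hlam (hUC x hx) (hUlam x hx) hζ hη
  · exact (differentiableOn_id.pow 2).mul (π.differentiableOn_inner_resNS hR hf hUC hfZ _ _)

lemma norm_schurCoeff_sub_le (hφ : π.IsSpherical φ) (h : π.HasCasimirScalar lam) (hlam : 0 < lam)
    (hR : RelBounded π.inclNS π.laplNS π.geoNS spectralHalfPlane C M) {r : ℝ}
    (hUC : ∀ x ∈ Metric.ball (0 : ℂ) r, ‖x‖ * C < 1)
    (hUlam : ∀ x ∈ Metric.ball (0 : ℂ) r, ‖x‖ ^ 2 * (lam + 6) ≤ 1) {μ : ℂ → ℂ}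
    (hμ : DifferentiableOn ℂ μ (Metric.ball 0 r))
    (hμZ : Set.MapsTo μ (Metric.ball 0 r) spectralHalfPlane) (hμ0 : μ 0 = 0) {x : ℂ}
    (hx : x ∈ Metric.ball (0 : ℂ) r) :
    ‖π.schurCoeff hR φ x (μ x) - (lam : ℂ) / 8‖ ≤ (lam + 6) / 2 / r * ‖x‖ := by
  set g : ℂ → ℂ := fun y => π.schurCoeff hR φ y (μ y)
  have hg : DifferentiableOn ℂ g (Metric.ball 0 r) :=
    π.differentiableOn_inner_resNS hR hμ hUC hμZ _ _
  have hg0 : g 0 = (lam : ℂ) / 8 := by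
    simp only [g, hμ0, hφ.schurCoeff_zero_zero h]
  have hg0_norm : ‖g 0‖ = lam / 8 := by
    rw [hg0, norm_div, Complex.norm_real, Real.norm_of_nonneg hlam.le, Complex.norm_ofNat]
  have hmaps : Set.MapsTo g (Metric.ball 0 r) (Metric.closedBall (g 0) ((lam + 6) / 2)) := by
    intro y hy
    have hgy : ‖g y‖ ≤ 5 / 16 * lam :=
      hφ.norm_schurCoeff_le h hlam (hUC y hy) (hUlam y hy) (hμZ hy)
    rw [mem_closedBall_iff_norm]
    linarith [norm_sub_le (g y) (g 0)]
  have hschwarz := Complex.dist_le_div_mul_dist_of_mapsTo_ball hg hmaps hx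
  rwa [dist_eq_norm, dist_zero_right, hg0] at hschwarz

lemma norm_fixedPoint_sub_le (hφ : π.IsSpherical φ) (h : π.HasCasimirScalar lam) (hlam : 0 < lam)
    (hR : RelBounded π.inclNS π.laplNS π.geoNS spectralHalfPlane C M) {r : ℝ}
    (hr_sq : r ^ 2 * (lam + 6) = 1) (hUC : ∀ x ∈ Metric.ball (0 : ℂ) r, ‖x‖ * C < 1)
    (hUlam : ∀ x ∈ Metric.ball (0 : ℂ) r, ‖x‖ ^ 2 * (lam + 6) ≤ 1) {μ : ℂ → ℂ}
    (hμ : DifferentiableOn ℂ μ (Metric.ball 0 r))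
    (hμZ : Set.MapsTo μ (Metric.ball 0 r) spectralHalfPlane) (hμ0 : μ 0 = 0) {x : ℂ}
    (hx : x ∈ Metric.ball (0 : ℂ) r) (heq : x ^ 2 * π.schurCoeff hR φ x (μ x) = μ x) :
    ‖μ x - (lam : ℂ) / 8 * x ^ 2‖ ≤ ‖x‖ ^ 3 / (2 * r ^ 2 * (r - ‖x‖)) := by
  have hcoeff := hφ.norm_schurCoeff_sub_le h hlam hR hUC hUlam hμ hμZ hμ0 hx
  have hfactor : μ x - (lam : ℂ) / 8 * x ^ 2
      = x ^ 2 * (π.schurCoeff hR φ x (μ x) - (lam : ℂ) / 8) := by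
    rw [mul_sub, heq, mul_comm (x ^ 2)]
  have hgap : 0 < r - ‖x‖ := sub_pos.2 (mem_ball_zero_iff.1 hx)
  have hr : 0 < r := (norm_nonneg x).trans_lt (mem_ball_zero_iff.1 hx)
  have hlam_eq : lam + 6 = 1 / r ^ 2 := eq_one_div_of_mul_eq_one_right hr_sq
  rw [hfactor, norm_mul, norm_pow]
  calc ‖x‖ ^ 2 * ‖π.schurCoeff hR φ x (μ x) - (lam : ℂ) / 8‖
      ≤ ‖x‖ ^ 2 * ((lam + 6) / 2 / r * ‖x‖) := by gcongr
    _ = ‖x‖ ^ 3 / (2 * r ^ 2 * r) := by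
        rw [hlam_eq]
        field_simp
    _ ≤ ‖x‖ ^ 3 / (2 * r ^ 2 * (r - ‖x‖)) := by
        gcongr
        exact sub_le_self _ (norm_nonneg x)

end IsSpherical

end SchurComplement

namespace IsSpherical

variable {π : UnitaryRep V} {φ : π.smooth} {lam : ℝ}

theorem exists_eigenvalue (hφ : π.IsSpherical φ) (h : π.HasCasimirScalar lam) (hlam : 0 < lam)
    {r : ℝ} (hr : 0 < r) (hr_sq : r ^ 2 * (lam + 6) = 1) :
    ∃ μ : ℂ → ℂ, DifferentiableOn ℂ μ (Metric.ball 0 r) ∧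
      ∀ x ∈ Metric.ball (0 : ℂ) r, IsSimpleEigenvalue (π.T x) (μ x) ∧ ‖μ x‖ ≤ 1 / 2 ∧
        spec (π.T x) ∩ {ζ : ℂ | ζ.re ≤ 1 / 2} = {μ x} ∧
        ‖μ x - (lam : ℂ) / 8 * x ^ 2‖ ≤ ‖x‖ ^ 3 / (2 * r ^ 2 * (r - ‖x‖)) := by
  have hR := π.relBounded h le_rfl hlam.le
  have hball (x : ℂ) (hx : x ∈ Metric.ball 0 r) : ‖x‖ ^ 2 * (lam + 6) < 1 := by
    rw [mem_ball_zero_iff] at hx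
    rw [← hr_sq]
    gcongr
  have hballC (x : ℂ) (hx : x ∈ Metric.ball 0 r) : ‖x‖ * √(lam + 4) < 1 :=
    mul_sqrt_add_four_lt_one hlam (hball x hx)
  have hball_le (x : ℂ) (hx : x ∈ Metric.ball 0 r) := (hball x hx).le
  obtain ⟨μ, hμ, hfix⟩ :=
    hφ.exists_schur_fixedPoint h hlam hR Metric.isOpen_ball hballC hball_le
  have hμZ : Set.MapsTo μ (Metric.ball 0 r) spectralHalfPlane := fun x hx =>
    closedBall_subset_spectralHalfPlane (mem_closedBall_zero_iff.2 (hfix x hx).1)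
  have hμ0 : μ 0 = 0 := by
    rw [← (hfix 0 (Metric.mem_ball_self hr)).2.1, zero_pow two_ne_zero, zero_mul]
  refine ⟨μ, hμ, fun x hx => ?_⟩
  obtain ⟨hnorm, heq, hunique⟩ := hfix x hx
  have hsmall := hφ.norm_sq_mul_inner_resNS_resNS_le (hR := hR) h hlam (hballC x hx)
    (hball_le x hx) (hμZ hx) (hμZ hx)
  refine ⟨hφ.isSimpleEigenvalue (hballC x hx) (hμZ hx) heq (hsmall.trans_lt (by norm_num)), hnorm,
    Set.Subset.antisymm ?_ (Set.singleton_subset_iff.2 ⟨?_, hμZ hx⟩), ?_⟩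
  · rintro ζ ⟨hspec, hζ⟩
    exact hunique ζ hζ ((hφ.mem_spec_iff (hballC x hx) hζ).1 hspec)
  · exact (hφ.mem_spec_iff (hballC x hx) (hμZ hx)).2 heq
  · exact hφ.norm_fixedPoint_sub_le h hlam hR hr_sq hballC hball_le hμ hμZ hμ0 hx heq

end IsSpherical

lemma exists_isSpherical (π : UnitaryRep V) {lam : ℝ} (h : π.HasCasimirScalar lam) (hlam : 0 < lam)
    (hirr : π.IsIrreducible) : ∃ φ, π.IsSpherical φ := by
  have := hirr.1
  obtain ⟨φ, hnorm, hφ⟩ := π.exists_spherical h hlam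
  exact ⟨φ, hnorm, hφ, π.projK_zero_eq h hlam hirr hφ hnorm⟩

lemma half_lt_re_of_mem_spec (π : UnitaryRep V) {lam : ℝ} (h : π.HasCasimirScalar lam)
    (hlam : lam ≤ 0) (hirr : π.IsIrreducible) (hnt : ¬π.IsTrivial) {x ζ : ℂ} (hx : ‖x‖ < 1 / 2)
    (hζ : ζ ∈ spec (π.T x)) : 1 / 2 < ζ.re := by
  by_contra! hre
  have hsqrt : √(0 + 4) = 2 := by
    rw [zero_add, Real.sqrt_eq_iff_mul_self_eq_of_pos two_pos]
    norm_num
  refine hζ (π.mem_resolventSet_of_projK_zero (π.relBounded h hlam le_rfl)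
    (π.projK_zero_eq_zero h hlam hirr hnt) ?_ hre)
  rw [hsqrt]
  linarith

lemma hasCasimirScalar_unique (π : UnitaryRep V) [Nontrivial V] {a b : ℝ}
    (ha : π.HasCasimirScalar a) (hb : π.HasCasimirScalar b) : a = b := by
  obtain ⟨-, u, hu, -⟩ := π.exists_smooth_projK_eq
  have hsmul : (a : ℂ) • u = (b : ℂ) • u := congrArg (· u) (ha.symm.trans hb)
  exact_mod_cast smul_left_injective ℂ (fun hzero => hu (congrArg Subtype.val hzero)) hsmul

lemma IsPrincipalSeries.isIrreducible_and_pos {π : UnitaryRep V} {s lam : ℝ}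
    (hs : π.IsPrincipalSeries s) (h : π.HasCasimirScalar lam) : π.IsIrreducible ∧ 0 < lam := by
  have := hs.1.1
  refine ⟨hs.1, ?_⟩
  rw [π.hasCasimirScalar_unique h hs.2]
  positivity

lemma IsComplementarySeries.isIrreducible_and_pos {π : UnitaryRep V} {s lam : ℝ}
    (hs : π.IsComplementarySeries s) (h : π.HasCasimirScalar lam) :
    π.IsIrreducible ∧ 0 < lam := by
  obtain ⟨hs_mem, -, hirr, hs_casimir⟩ := hs
  have := hirr.1
  refine ⟨hirr, ?_⟩
  rw [π.hasCasimirScalar_unique h hs_casimir, sub_pos]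
  exact (sq_lt_one_iff_abs_lt_one s).2 (abs_lt.2 hs_mem)

omit [CompleteSpace V] in
lemma IsDiscreteSeries.casimirScalar_nonpos {π : UnitaryRep V} {n : ℕ}
    (hn : π.IsDiscreteSeries n) : 1 - (2 * (n : ℝ) - 1) ^ 2 ≤ 0 := by
  have hone : (1 : ℝ) ≤ n := mod_cast hn.1
  rw [sub_nonpos]
  exact one_le_pow₀ (by linarith)

end UnitaryRep

lemma rpow_neg_half_sq_mul_self {a : ℝ} (ha : 0 < a) : (a ^ (-(1 / 2) : ℝ)) ^ 2 * a = 1 := by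
  rw [Real.rpow_neg ha.le, ← Real.sqrt_eq_rpow, inv_pow, Real.sq_sqrt ha.le, inv_mul_cancel₀ ha.ne']

lemma one_div_sqrt_thirtyTwo_lt_half : 1 / √32 < 1 / 2 :=
  one_div_lt_one_div_of_lt two_pos ((Real.lt_sqrt zero_le_two).2 (by norm_num))

end Eigenvalue

end KineticBrownian

end

theorem theorem3p5_general {V : Type*} [NormedAddCommGroup V] [InnerProductSpace ℂ V]
    [CompleteSpace V] (π : KineticBrownian.UnitaryRep V) (hirr : π.IsIrreducible) {lam : ℝ}
    (h : π.HasCasimirScalar lam) :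
    (0 < lam → ∀ r : ℝ, r = (lam + 6) ^ (-(1 / 2) : ℝ) →
      ∃ μ : ℂ → ℂ, DifferentiableOn ℂ μ (Metric.ball 0 r) ∧
        ∀ x ∈ Metric.ball (0 : ℂ) r,
          KineticBrownian.IsSimpleEigenvalue (π.T x) (μ x) ∧
          ‖μ x‖ ≤ 1 / 2 ∧
          KineticBrownian.spec (π.T x) ∩ {ζ : ℂ | ζ.re ≤ 1 / 2} = {μ x} ∧
          ‖μ x - (lam : ℂ) / 8 * x ^ 2‖ ≤ ‖x‖ ^ 3 / (2 * r ^ 2 * (r - ‖x‖))) ∧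
    (lam ≤ 0 → ¬π.IsTrivial → ∀ x : ℂ, ‖x‖ < 1 / 2 →
      ∀ ζ ∈ KineticBrownian.spec (π.T x), 1 / 2 < ζ.re) := by
  refine ⟨?_, fun hlam hnt x hx ζ hζ => π.half_lt_re_of_mem_spec h hlam hirr hnt hx hζ⟩
  rintro hlam r rfl
  obtain ⟨φ, hφ⟩ := π.exists_isSpherical h hlam hirr
  have hlam6 : 0 < lam + 6 := by positivity
  exact hφ.exists_eigenvalue h hlam (Real.rpow_pos_of_pos hlam6 _)
    (KineticBrownian.rpow_neg_half_sq_mul_self hlam6)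

theorem theorem3p5 {V : Type*} [NormedAddCommGroup V] [InnerProductSpace ℂ V] [CompleteSpace V]
    (π : KineticBrownian.UnitaryRep V) :
    (∀ lam r : ℝ, ((∃ s, π.IsPrincipalSeries s) ∨ (∃ s, π.IsComplementarySeries s)) →
      π.HasCasimirScalar lam → r = (lam + 6) ^ (-(1 / 2) : ℝ) →
      ∃ μ : ℂ → ℂ, DifferentiableOn ℂ μ (Metric.ball 0 r) ∧
        (∀ x ∈ Metric.ball (0 : ℂ) r,
          KineticBrownian.IsSimpleEigenvalue (π.T x) (μ x) ∧
          ‖μ x‖ ≤ 1 / 2 ∧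
          KineticBrownian.spec (π.T x) ∩ {ζ : ℂ | ζ.re ≤ 1 / 2} = {μ x} ∧
          ‖μ x - (lam : ℂ) / 8 * x ^ 2‖ ≤ ‖x‖ ^ 3 / (2 * r ^ 2 * (r - ‖x‖)))) ∧
    (∀ n : ℕ, π.IsDiscreteSeries n → ∀ x : ℂ, ‖x‖ < 1 / Real.sqrt 32 →
      ∀ ζ ∈ KineticBrownian.spec (π.T x), 1 / 2 < ζ.re) :=
  ⟨fun _lam r hπ h hr =>
    have ⟨hirr, hlam⟩ := hπ.elim (fun ⟨_, hs⟩ => hs.isIrreducible_and_pos h)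
      fun ⟨_, hs⟩ => hs.isIrreducible_and_pos h
    (theorem3p5_general π hirr h).1 hlam r hr,
  fun _n hn x hx => (theorem3p5_general π hn.2.1 hn.2.2.2).2 hn.casimirScalar_nonpos hn.2.2.1 x
    (hx.trans KineticBrownian.one_div_sqrt_thirtyTwo_lt_half)⟩
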